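/- Let $n\ge 1$ and let $\mathcal C_n$ be the half-cylinder with $n$ marked points, i.e. the annulus with $n$ marked points on one of its boundary components. Its universal cover $\overline{\mathcal C}_n$ has marked points $\alpha_i$ ($i\in\mathbb Z$) in this order along a boundary line. An edge $[\alpha_u,\alpha_v]$ of $\overline{\mathcal C}_n$ is the isotopy class of curves joining the two distinct marked points $\alpha_u,\alpha_v$, and its length is $|v-u|$; two edges intersect if, up to exchanging them, their endpoints satisfy $a_1<a_2<b_1<b_2$ for $[\alpha_{a_1},\alpha_{b_1}]$ and $[\alpha_{a_2},\alpha_{b_2}]$. The edges of $\mathcal C_n$ are the edges of $\overline{\mathcal C}_n$ up to translation of indices by multiples of $n$, with the same length; let $\pi$ denote the projection. A set of edges of $\overline{\mathcal C}_n$ is $3$-crossing-free if no three of its edges pairwise intersect. A $2$-triangulation of $\mathcal C_n$ is an inclusion-maximal set $T$ of edges of $\mathcal C_n$ such that $\pi^{-1}(T)$ is $3$-crossing-free. An edge of $\mathcal C_n$ is $2$-relevant if its length $\ell$ satisfies $2<\ell\le 2n$. The flip graph has the $2$-triangulations of $\mathcal C_n$ as vertices, and $T,T'$ are adjacent if $T'=(T\setminus\{e\})\cup\{f\}$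 for some edges $e\in T$ and $f\notin T$. The simplicial complex $\Delta_{\mathcal C_n,2}$ has the $2$-relevant edges of $\mathcal C_n$ as vertices, and its faces are the nonempty finite sets $F$ of $2$-relevant edges such that $\pi^{-1}(F)$ is $3$-crossing-free. **Theorem.** For every $n\ge 1$: 1. The flip graph of $2$-triangulations of $\mathcal C_n$ is regular, of degree $2(n-1)$. 2. Mapping a $2$-triangulation to its set of $2$-relevant edges is injective, and the facets (maximal faces) of $\Delta_{\mathcal C_n,2}$ are exactly the nonempty sets of $2$-relevant edges arising in this way. The complex $\Delta_{\mathcal C_n,2}$ is pure: every face lies in a facet, and every facet has exactly $2(n-1)$ vertices. It is moreover a weak pseudomanifold (without boundary): every face with $2(n-1)-1$ elements lies in exactly two facets. -/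

import Mathlib

namespace HalfCylinder

/-- An edge of the universal cover of the half-cylinder.  The marked points of the universal cover
are `α_i`, `i ∈ ℤ`, in this order along its boundary line; since the cover is simply connected, an
isotopy class of curves joining two different marked points is determined by its two endpoints,
recorded here as `lo < hi`. -/
@[ext]
structure CoverEdge where
  lo : ℤ
  hi : ℤ
  lt : lo < hi

namespace CoverEdge

/-- The edge `[u + j, v + j]`, for `e = [u, v]`. -/
def shift (e : CoverEdge) (j : ℤ) : CoverEdge :=
  ⟨e.lo + j, e.hi + j, by have := e.lt; omega⟩

/-- The length `|v - u|` of the edge `[u, v]`. -/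
def length (e : CoverEdge) : ℕ := (e.hi - e.lo).toNat

/-- Two edges intersect if, in the cyclic order of the marked points, their endpoints are pairwise
distinct and alternate. -/
def Intersects (e f : CoverEdge) : Prop :=
  (e.lo < f.lo ∧ f.lo < e.hi ∧ e.hi < f.hi) ∨ (f.lo < e.lo ∧ e.lo < f.hi ∧ f.hi < e.hi)

/-- `e` and `f` are translations of each other by a multiple of `n`. -/
def translationSetoid (n : ℕ) : Setoid CoverEdge where
  r e f := ∃ l : ℤ, f = e.shift (l * n)
  iseqv :=
    { refl := fun e => ⟨0, by ext <;> simp [shift]⟩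
      symm := by
        rintro e f ⟨l, rfl⟩
        exact ⟨-l, by ext <;> simp [shift]⟩
      trans := by
        rintro e f g ⟨l, rfl⟩ ⟨m, rfl⟩
        exact ⟨l + m, by ext <;> simp [shift] <;> ring⟩ }

end CoverEdge

/-- A `k`-crossing: a set of `k` pairwise intersecting edges of the universal cover. -/
def IsCrossing (k : ℕ) (s : Finset CoverEdge) : Prop :=
  s.card = k ∧ (s : Set CoverEdge).Pairwise CoverEdge.Intersects

/-- A set of edges of the universal cover that contains no `k`-crossing. -/
def CrossingFree (k : ℕ) (E : Set CoverEdge) : Prop :=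
  ∀ s : Finset CoverEdge, (s : Set CoverEdge) ⊆ E → ¬ IsCrossing k s

/-- The edges of the half-cylinder with `n` marked points. -/
def Edge (n : ℕ) : Type := Quotient (CoverEdge.translationSetoid n)

/-- The covering map on edges. -/
def proj (n : ℕ) (e : CoverEdge) : Edge n := Quotient.mk (CoverEdge.translationSetoid n) e

/-- The length of an edge of the half-cylinder: the length of any of its lifts. -/
def Edge.length {n : ℕ} (e : Edge n) : ℕ :=
  Quotient.lift CoverEdge.length
    (by rintro a b ⟨l, rfl⟩; simp [CoverEdge.length, CoverEdge.shift]) e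

/-- The lift to the universal cover of a set of edges of the half-cylinder. -/
def lift {n : ℕ} (T : Set (Edge n)) : Set CoverEdge := proj n ⁻¹' T

/-- A `k`-triangulation of the half-cylinder: a maximal set of edges whose lift contains no
`(k + 1)`-crossing. -/
def IsTriangulation {n : ℕ} (k : ℕ) (T : Set (Edge n)) : Prop :=
  Maximal (fun S : Set (Edge n) => CrossingFree (k + 1) (lift S)) T

/-- The `k`-relevant edges of the half-cylinder. -/
def Edge.IsRelevant {n : ℕ} (k : ℕ) (e : Edge n) : Prop :=
  k < e.length ∧ e.length ≤ k * n

/-- The flip graph: its vertices are the `k`-triangulations, and two of them are adjacent if one is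
obtained from the other by replacing one edge by an edge that was not there. (The edges exchanged
are automatically `k`-relevant: edges of length at most `k` intersect too few edges
to be in any `(k + 1)`-crossing, so they are in all `k`-triangulations, while edges of
length more than `k * n` are in none.) -/
def flipGraph (n k : ℕ) : SimpleGraph {T : Set (Edge n) // IsTriangulation k T} where
  Adj T T' := ∃ e f : Edge n, e ∈ T.1 ∧ f ∉ T.1 ∧ T'.1 = insert f (T.1 \ {e})
  symm := ⟨by
    rintro ⟨T, hT⟩ ⟨T', hT'⟩ ⟨e, f, he, hf, h⟩
    dsimp only at he hf h
    subst h
    have hef : e ≠ f := fun h => hf (h ▸ he)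
    refine ⟨f, e, by simp, by simp [hef], ?_⟩
    ext x
    by_cases hx : x = e <;> by_cases hy : x = f <;> simp_all⟩
  loopless := ⟨by
    rintro ⟨T, hT⟩ ⟨e, f, he, hf, h⟩
    dsimp only at he hf h
    exact hf (h ▸ Set.mem_insert f _)⟩

/-- The `k`-relevant edges of the half-cylinder, as a type. -/
abbrev RelevantEdge (n k : ℕ) : Type := {e : Edge n // e.IsRelevant k}

/-- The set of `k`-relevant edges that belong to `T`. -/
def relevantPart {n : ℕ} (k : ℕ) (T : Set (Edge n)) : Set (RelevantEdge n k) := {e | e.1 ∈ T}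

theorem CrossingFree.mono {k : ℕ} {E F : Set CoverEdge} (h : E ⊆ F) (hF : CrossingFree k F) :
    CrossingFree k E :=
  fun s hs => hF s (hs.trans h)

/-- A single `k`-relevant edge lifts to a set without `(k + 1)`-crossing. -/
theorem crossingFree_lift_singleton {n k : ℕ} (e : RelevantEdge n k) :
    CrossingFree (k + 1) (lift {e.1}) := by
  obtain ⟨e, he⟩ := e
  induction e using Quotient.inductionOn with
  | _ a =>
  obtain ⟨h1, h2⟩ := he
  change k < a.length at h1
  change a.length ≤ k * n at h2
  intro s hs ⟨hc, hp⟩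
  have hlt := a.lt
  have hlen : a.hi - a.lo ≤ k * n := by
    have : ((a.hi - a.lo).toNat : ℤ) ≤ ((k * n : ℕ) : ℤ) := by exact_mod_cast h2
    push_cast at this
    omega
  have hs' : ∀ f ∈ s, ∃ l : ℤ, f = a.shift (l * n) := by
    intro f hf
    have h : proj n f = proj n a := hs hf
    exact Quotient.exact h.symm
  have hne : s.Nonempty := Finset.card_pos.mp (by omega)
  choose! l hl using hs'
  have hinj : Set.InjOn l (s : Set CoverEdge) := by
    intro x hx y hy hxy
    rw [hl x hx, hl y hy, hxy]
  obtain ⟨f, hf, hmin⟩ := Finset.exists_min_image s l hne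
  have hsub : s.image l ⊆ Finset.Ico (l f) (l f + k) := by
    intro m hm
    obtain ⟨g, hg, rfl⟩ := Finset.mem_image.mp hm
    rw [Finset.mem_Ico]
    refine ⟨hmin g hg, ?_⟩
    by_contra! hge
    have hn : (0 : ℤ) ≤ n := by positivity
    have hmul : (l f + k) * (n : ℤ) ≤ l g * n := mul_le_mul_of_nonneg_right hge hn
    have hkey : a.hi + l f * n ≤ a.lo + l g * n := by linarith
    have hne : f ≠ g := by
      rintro rfl
      linarith
    have hI := hp hf hg hne
    rw [hl f hf, hl g hg] at hI
    simp only [CoverEdge.Intersects, CoverEdge.shift] at hI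
    omega
  have := Finset.card_le_card hsub
  rw [Finset.card_image_of_injOn hinj, hc, Int.card_Ico] at this
  omega

/-- The simplicial complex whose vertices are the `k`-relevant edges of the half-cylinder and
whose faces are the nonempty finite sets of `k`-relevant edges with `(k + 1)`-crossing-free lift. -/
def complex (n k : ℕ) : AbstractSimplicialComplex (RelevantEdge n k) where
  faces := {s | s.Nonempty ∧ CrossingFree (k + 1) (lift (Subtype.val '' (s : Set (RelevantEdge n k))))}
  isRelLowerSet_faces := by
    rintro s ⟨hs, hc⟩
    refine ⟨hs, fun t hts ht => ⟨ht, hc.mono ?_⟩⟩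
    exact Set.preimage_mono (Set.image_mono (by exact_mod_cast hts))
  singleton_mem := fun e => ⟨Finset.singleton_nonempty e, by
    simpa using crossingFree_lift_singleton e⟩

end HalfCylinder

section SimplicialComplex

variable {V : Type*}

/-- The facets of a simplicial complex are its maximal faces. -/
def AbstractSimplicialComplex.IsFacet (K : AbstractSimplicialComplex V) (s : Finset V) : Prop :=
  Maximal (fun t => t ∈ K.faces) s

/-- The complex is pure, with `d` vertices in every facet (so of dimension `d - 1`). -/
def AbstractSimplicialComplex.IsPure (K : AbstractSimplicialComplex V) (d : ℕ) : Prop :=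
  (∀ t ∈ K.faces, ∃ s, K.IsFacet s ∧ t ⊆ s) ∧ ∀ s, K.IsFacet s → s.card = d

/-- A weak pseudomanifold (without boundary) with `d` vertices in every facet: the complex is pure,
and every face of codimension one lies in exactly two facets. -/
def AbstractSimplicialComplex.IsWeakPseudomanifold (K : AbstractSimplicialComplex V) (d : ℕ) :
    Prop :=
  K.IsPure d ∧
    ∀ r ∈ K.faces, r.card + 1 = d → {s : Finset V | K.IsFacet s ∧ r ⊆ s}.encard = 2

end SimplicialComplex

/-!
The length of a relevant edge is at most `2 * n`, so the relevant edges can be wrapped around a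
`5 * n`-gon. Sets of relevant edges with `3`-crossing-free lift become sets of its chords,
invariant under rotation by `n`, without three pairwise crossing chords; conversely such a set has
no chords of length strictly between `2 * n` and `3 * n`, because they cross two of their
rotations.

Maximal sets of this kind are studied by induction on `n`. For `n ≥ 3` such a set contains a star
`0, p, 1, q, 2`. Collapsing the rotations of this star by multiples of `n` gives a maximal set for
`n - 1`, with a fixed number of orbits of chords fewer. The collapse is a bijection between the
maximal sets that contain the star and all maximal sets for `n - 1`, so it transports the
exchanges of the chords outside the star. A chord of the star is exchanged by hand; that there is
only one way to do so follows by comparing three hypothetical completions of the set without it.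
-/

namespace HalfCylinder

section Chords

/-- A set of chords of the `5 * m`-gon invariant under rotation by `m`. The vertices of the polygon
are unrolled to `ℤ`, and the chord joining the vertices `u < v < u + 5 * m` is recorded with both of
its orientations, as `(u, v)` and as `(v, u + 5 * m)`, together with the rotations of these. -/
structure Periodic (m : ℤ) (E : Set (ℤ × ℤ)) : Prop where
  shift : ∀ (j : ℤ) {u v : ℤ}, (u, v) ∈ E → (u + j * m, v + j * m) ∈ E
  twist : ∀ {u v : ℤ}, (u, v) ∈ E → (v, u + 5 * m) ∈ E
  lt : ∀ {u v : ℤ}, (u, v) ∈ E → u < v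
  lt_add : ∀ {u v : ℤ}, (u, v) ∈ E → v < u + 5 * m

/-- No three chords of the `5 * m`-gon in `E` pairwise cross: the six endpoints of three pairwise
crossing chords can be listed in cyclic order so that opposite ones are joined. -/
def NoTripleCrossing (m : ℤ) (E : Set (ℤ × ℤ)) : Prop :=
  ∀ ⦃a b c a' b' c' : ℤ⦄, (a, a') ∈ E → (b, b') ∈ E → (c, c') ∈ E →
    ¬ (a < b ∧ b < c ∧ c < a' ∧ a' < b' ∧ b' < c' ∧ c' < a + 5 * m)

/-- A rotation-invariant set of chords of the `5 * m`-gon without three pairwise crossing ones. -/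
structure TripleFree (m : ℤ) (E : Set (ℤ × ℤ)) : Prop extends Periodic m E where
  noTripleCrossing : NoTripleCrossing m E

/-- The polygonal counterpart of a `2`-triangulation of the half-cylinder: an inclusion-maximal
triple-free set of chords. -/
def MaxTripleFree (m : ℤ) (E : Set (ℤ × ℤ)) : Prop := Maximal (TripleFree m) E

/-- The orbit of the chord joining `a` and `b` under rotation by `m`, in both orientations. -/
def orbit (m a b : ℤ) : Set (ℤ × ℤ) :=
  {z | ∃ j : ℤ, z = (a + j * m, b + j * m) ∨ z = (b + j * m, a + 5 * m + j * m)}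

/-- The sides and the chords of length two of the `5 * m`-gon; they are in no triple crossing. -/
def shortChords (m : ℤ) : Set (ℤ × ℤ) :=
  {z | z.1 < z.2 ∧ z.2 < z.1 + 5 * m ∧ (z.2 ≤ z.1 + 2 ∨ z.1 + 5 * m ≤ z.2 + 2)}

variable {m n : ℤ} {E F : Set (ℤ × ℤ)} {a b u v : ℤ}

theorem mem_orbit : (u, v) ∈ orbit m a b ↔
    ∃ j : ℤ, (u = a + j * m ∧ v = b + j * m) ∨ (u = b + j * m ∧ v = a + 5 * m + j * m) := by
  simp only [orbit, Set.mem_ofPred_eq, Prod.mk.injEq]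

theorem mem_shortChords : (u, v) ∈ shortChords m ↔
    u < v ∧ v < u + 5 * m ∧ (v ≤ u + 2 ∨ u + 5 * m ≤ v + 2) := Iff.rfl

theorem self_mem_orbit : (a, b) ∈ orbit m a b := ⟨0, Or.inl (by simp)⟩

namespace Periodic

theorem pos (h : Periodic m E) (huv : (u, v) ∈ E) : 0 < m := by
  have := h.lt huv
  have := h.lt_add huv
  omega

theorem shift_iff (h : Periodic m E) (j : ℤ) : (u + j * m, v + j * m) ∈ E ↔ (u, v) ∈ E :=
  ⟨fun hz => by simpa using h.shift (-j) hz, h.shift j⟩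

theorem of_eq_shift (h : Periodic m E) {u' v' : ℤ} (j : ℤ) (hz : (u, v) ∈ E)
    (hu : u' = u + j * m) (hv : v' = v + j * m) : (u', v') ∈ E := by
  subst hu hv; exact h.shift j hz

theorem of_eq_twist (h : Periodic m E) {u' v' : ℤ} (j : ℤ) (hz : (u, v) ∈ E)
    (hu : u' = v + j * m) (hv : v' = u + 5 * m + j * m) : (u', v') ∈ E := by
  subst hu hv; exact h.shift j (h.twist hz)

theorem untwist (h : Periodic m E) (hz : (v, u + 5 * m) ∈ E) : (u, v) ∈ E :=
  h.of_eq_twist (-5) hz (by ring) (by ring)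

theorem orbit_subset (h : Periodic m E) (hz : (a, b) ∈ E) : orbit m a b ⊆ E := by
  rintro z ⟨j, rfl | rfl⟩
  · exact h.shift j hz
  · exact h.shift j (h.twist hz)

theorem union (hE : Periodic m E) (hF : Periodic m F) : Periodic m (E ∪ F) where
  shift j _ _ := Or.imp (hE.shift j) (hF.shift j)
  twist := Or.imp hE.twist hF.twist
  lt := Or.rec hE.lt hF.lt
  lt_add := Or.rec hE.lt_add hF.lt_add

theorem diff (hE : Periodic m E) (hF : Periodic m F) : Periodic m (E \ F) where
  shift j _ _ := And.imp (hE.shift j) (mt (hF.shift_iff j).1)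
  twist := And.imp hE.twist (mt hF.untwist)
  lt hz := hE.lt hz.1
  lt_add hz := hE.lt_add hz.1

theorem sUnion {C : Set (Set (ℤ × ℤ))} (hC : ∀ E ∈ C, Periodic m E) : Periodic m (⋃₀ C) where
  shift j _ _ := fun ⟨E, hE, hz⟩ => ⟨E, hE, (hC E hE).shift j hz⟩
  twist := fun ⟨E, hE, hz⟩ => ⟨E, hE, (hC E hE).twist hz⟩
  lt := fun ⟨E, hE, hz⟩ => (hC E hE).lt hz
  lt_add := fun ⟨E, hE, hz⟩ => (hC E hE).lt_add hz

end Periodic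

theorem shift_mem_orbit (j : ℤ) (h : (u, v) ∈ orbit m a b) :
    (u + j * m, v + j * m) ∈ orbit m a b := by
  obtain ⟨i, ⟨rfl, rfl⟩ | ⟨rfl, rfl⟩⟩ := mem_orbit.1 h
  · exact ⟨i + j, Or.inl (by ext <;> ring)⟩
  · exact ⟨i + j, Or.inr (by ext <;> ring)⟩

theorem periodic_orbit (hab : a < b) (hba : b < a + 5 * m) : Periodic m (orbit m a b) where
  shift j _ _ := shift_mem_orbit j
  twist {u v} h := by
    obtain ⟨i, ⟨rfl, rfl⟩ | ⟨rfl, rfl⟩⟩ := mem_orbit.1 h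
    · exact ⟨i, Or.inr (by ext <;> ring)⟩
    · exact ⟨i + 5, Or.inl (by ext <;> ring)⟩
  lt {u v} h := by obtain ⟨i, ⟨rfl, rfl⟩ | ⟨rfl, rfl⟩⟩ := mem_orbit.1 h <;> omega
  lt_add {u v} h := by obtain ⟨i, ⟨rfl, rfl⟩ | ⟨rfl, rfl⟩⟩ := mem_orbit.1 h <;> omega

theorem periodic_shortChords : Periodic m (shortChords m) where
  shift j u v := by simp only [mem_shortChords]; omega
  twist {u v} := by simp only [mem_shortChords]; omega
  lt h := h.1
  lt_add h := h.2.1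

theorem mem_orbit_comm (h : (u, v) ∈ orbit m a b) : (a, b) ∈ orbit m u v := by
  obtain ⟨j, ⟨rfl, rfl⟩ | ⟨rfl, rfl⟩⟩ := mem_orbit.1 h
  · exact ⟨-j, Or.inl (by ext <;> ring)⟩
  · exact ⟨-j - 5, Or.inr (by ext <;> ring)⟩

theorem mem_orbit_trans {c d : ℤ} (h : (u, v) ∈ orbit m a b) (h' : (a, b) ∈ orbit m c d) :
    (u, v) ∈ orbit m c d := by
  obtain ⟨i, ⟨rfl, rfl⟩ | ⟨rfl, rfl⟩⟩ := mem_orbit.1 h'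
  all_goals obtain ⟨j, ⟨rfl, rfl⟩ | ⟨rfl, rfl⟩⟩ := mem_orbit.1 h
  · exact ⟨i + j, Or.inl (by ext <;> ring)⟩
  · exact ⟨i + j, Or.inr (by ext <;> ring)⟩
  · exact ⟨i + j, Or.inr (by ext <;> ring)⟩
  · exact ⟨i + j + 5, Or.inl (by ext <;> ring)⟩

theorem orbit_eq_of_mem (h : (u, v) ∈ orbit m a b) : orbit m u v = orbit m a b :=
  Set.Subset.antisymm (fun _ hz => mem_orbit_trans hz h)
    fun _ hz => mem_orbit_trans hz (mem_orbit_comm h)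

namespace TripleFree

theorem of_subset (hE : TripleFree m E) (hF : Periodic m F) (h : F ⊆ E) : TripleFree m F :=
  ⟨hF, fun _ _ _ _ _ _ ha hb hc => hE.noTripleCrossing (h ha) (h hb) (h hc)⟩

theorem diff_orbit (hE : TripleFree m E) (hab : (a, b) ∈ E) : TripleFree m (E \ orbit m a b) :=
  hE.of_subset (hE.toPeriodic.diff (periodic_orbit (hE.lt hab) (hE.lt_add hab))) Set.sdiff_subset

end TripleFree

/-- Triple crossings are preserved when each endpoint `a` of a chord `(a, b)` is moved to `μ a b`,
as long as this is monotone enough to keep the cyclic order of the six endpoints. -/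
theorem noTripleCrossing_of_map {G : Set (ℤ × ℤ)} (hG : Periodic m G) (hE : NoTripleCrossing n E)
    (μ : ℤ → ℤ → ℤ) (hμ : ∀ {a b}, (a, b) ∈ G → μ (a + 5 * m) (b + 5 * m) = μ a b + 5 * n)
    (hmem : ∀ {a b}, (a, b) ∈ G → a + 3 ≤ b → b + 3 ≤ a + 5 * m → (μ a b, μ b (a + 5 * m)) ∈ E)
    (hlt : ∀ {a b c a' b' c'}, (a, a') ∈ G → (b, b') ∈ G → (c, c') ∈ G →
      a < b ∧ b < c ∧ c < a' ∧ a' < b' ∧ b' < c' ∧ c' < a + 5 * m → μ a a' < μ b b') :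
    NoTripleCrossing m G := by
  intro a b c a' b' c' ha hb hc h
  have ha' := hG.twist ha
  have hb' := hG.twist hb
  have hc' := hG.twist hc
  refine hE (hmem ha ?_ ?_) (hmem hb ?_ ?_) (hmem hc ?_ ?_)
    ⟨hlt ha hb hc ?_, hlt hb hc ha' ?_, hlt hc ha' hb' ?_, hlt ha' hb' hc' ?_,
      hlt hb' hc' (hG.twist ha') ?_, hμ ha ▸ hlt hc' (hG.twist ha') (hG.twist hb') ?_⟩ <;> omega

theorem TripleFree.union_shortChords (hE : TripleFree m E) : TripleFree m (E ∪ shortChords m) := by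
  have hP := hE.toPeriodic.union (periodic_shortChords (m := m))
  refine ⟨hP, noTripleCrossing_of_map hP hE.noTripleCrossing (fun a _ => a) (fun _ => rfl) ?_
    fun _ _ _ h => h.1⟩
  rintro a b (h | h) hab hba
  · exact h
  · rw [mem_shortChords] at h; omega

theorem TripleFree.sUnion {C : Set (Set (ℤ × ℤ))} (hC : ∀ E ∈ C, TripleFree m E)
    (hdir : DirectedOn (· ⊆ ·) C) : TripleFree m (⋃₀ C) := by
  refine ⟨.sUnion fun E hE => (hC E hE).toPeriodic, ?_⟩
  rintro a b c a' b' c' ⟨A, hA, ha⟩ ⟨B, hB, hb⟩ ⟨C', hC', hc⟩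
  obtain ⟨D, hD, hAD, hBD⟩ := hdir A hA B hB
  obtain ⟨D', hD', hDD', hCD'⟩ := hdir D hD C' hC'
  exact (hC D' hD').noTripleCrossing (hDD' (hAD ha)) (hDD' (hBD hb)) (hCD' hc)

theorem TripleFree.exists_maxTripleFree (hE : TripleFree m E) :
    ∃ F, E ⊆ F ∧ MaxTripleFree m F :=
  zorn_subset_nonempty {F | TripleFree m F} (fun C hC hchain _ =>
    ⟨⋃₀ C, .sUnion (fun _ hF => hC hF) hchain.directedOn, fun _ => Set.subset_sUnion_of_mem⟩) E hE

namespace MaxTripleFree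

theorem tripleFree (h : MaxTripleFree m E) : TripleFree m E := h.prop

theorem periodic (h : MaxTripleFree m E) : Periodic m E := h.prop.toPeriodic

theorem shortChords_subset (h : MaxTripleFree m E) : shortChords m ⊆ E :=
  Set.subset_union_right.trans (h.le_of_ge h.tripleFree.union_shortChords Set.subset_union_left)

theorem mem_of_union_orbit (h : MaxTripleFree m E) (hF : TripleFree m (E ∪ orbit m a b)) :
    (a, b) ∈ E :=
  h.le_of_ge hF Set.subset_union_left (Or.inr self_mem_orbit)

end MaxTripleFree

end Chords

section Counting

/-- The representatives `(u, v)`, `0 ≤ u < m`, of the translation classes of oriented chords. -/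
def fundamental (m : ℤ) (E : Set (ℤ × ℤ)) : Set (ℤ × ℤ) := {z | z ∈ E ∧ 0 ≤ z.1 ∧ z.1 < m}

/-- The number of oriented chords up to rotation; each orbit of chords contributes two. -/
noncomputable def chordCount (m : ℤ) (E : Set (ℤ × ℤ)) : ℕ := (fundamental m E).ncard

/-- The representative of an oriented chord in the fundamental domain. -/
def toFundamental (m : ℤ) (z : ℤ × ℤ) : ℤ × ℤ := (z.1 + -(z.1 / m) * m, z.2 + -(z.1 / m) * m)

variable {m n : ℤ} {E F : Set (ℤ × ℤ)} {a b : ℤ}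

theorem finite_fundamental (hE : Periodic m E) : (fundamental m E).Finite := by
  refine ((Set.finite_Icc (0 : ℤ) m).prod (Set.finite_Icc (0 : ℤ) (6 * m))).subset ?_
  rintro ⟨u, v⟩ ⟨h, h0, h1⟩
  have := hE.lt h
  have := hE.lt_add h
  simp only [Set.mem_prod, Set.mem_Icc] at *
  omega

theorem toFundamental_mem (hm : 0 < m) {z : ℤ × ℤ} (hz : ∀ j, (z.1 + j * m, z.2 + j * m) ∈ E) :
    toFundamental m z ∈ fundamental m E := by
  refine ⟨hz _, ?_, ?_⟩
  · have := Int.ediv_mul_le z.1 hm.ne'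
    simp only [toFundamental]; linarith
  · have := Int.lt_ediv_add_one_mul_self z.1 hm
    simp only [toFundamental]; linarith

theorem Periodic.toFundamental_mem (hm : 0 < m) (hE : Periodic m E) {z : ℤ × ℤ} (hz : z ∈ E) :
    toFundamental m z ∈ fundamental m E :=
  HalfCylinder.toFundamental_mem hm fun j => hE.shift j hz

theorem toFundamental_shift (hm : 0 < m) {z : ℤ × ℤ} (h0 : 0 ≤ z.1) (h1 : z.1 < m) (j : ℤ) :
    toFundamental m (z.1 + j * m, z.2 + j * m) = z := by
  have : (z.1 + j * m) / m = j := by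
    rw [Int.add_mul_ediv_right _ _ hm.ne', Int.ediv_eq_zero_of_lt h0 h1, zero_add]
  simp [toFundamental, this]

theorem exists_eq_shift_of_toFundamental_eq {z w : ℤ × ℤ}
    (h : toFundamental m z = toFundamental m w) : ∃ j : ℤ, z = (w.1 + j * m, w.2 + j * m) := by
  refine ⟨z.1 / m - w.1 / m, ?_⟩
  simp only [toFundamental, Prod.mk.injEq] at h
  ext <;> linarith

theorem chordCount_eq_of_bijOn (hm : 0 < m) (hn : 0 < n) (hE : Periodic m E) (hF : Periodic n F)
    (Φ : ℤ × ℤ → ℤ × ℤ)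
    (hΦ : ∀ j u v, Φ (u + j * m, v + j * m) = ((Φ (u, v)).1 + j * n, (Φ (u, v)).2 + j * n))
    (h : Set.BijOn Φ E F) : chordCount m E = chordCount n F := by
  refine Set.BijOn.ncard_eq (f := fun z => toFundamental n (Φ z))
    ⟨fun z hz => hF.toFundamental_mem hn (h.mapsTo hz.1), ?_, ?_⟩
  · intro z hz w hw heq
    obtain ⟨j, hj⟩ := exists_eq_shift_of_toFundamental_eq heq
    have hzw : (w.1 + j * m, w.2 + j * m) = z :=
      h.injOn (hE.shift j hw.1) hz.1 ((hΦ j w.1 w.2).trans hj.symm)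
    rw [← toFundamental_shift hm hw.2.1 hw.2.2 j, hzw]
    simpa using (toFundamental_shift hm hz.2.1 hz.2.2 0).symm
  · rintro z ⟨hz, h0, h1⟩
    obtain ⟨w, hw, rfl⟩ := h.surjOn hz
    refine ⟨toFundamental m w, hE.toFundamental_mem hm hw, ?_⟩
    simp only [toFundamental, hΦ]
    exact toFundamental_shift hn h0 h1 _

theorem fundamental_orbit (hm : 0 < m) : fundamental m (orbit m a b) =
    {toFundamental m (a, b), toFundamental m (b, a + 5 * m)} := by
  ext z
  constructor
  · rintro ⟨⟨j, rfl | rfl⟩, h0, h1⟩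
    · left
      simpa using (toFundamental_shift hm h0 h1 (-j)).symm
    · right
      simpa using (toFundamental_shift hm h0 h1 (-j)).symm
  · rintro (rfl | rfl)
    · exact toFundamental_mem hm fun j => shift_mem_orbit j self_mem_orbit
    · exact toFundamental_mem hm fun j => shift_mem_orbit j ⟨0, Or.inr (by simp)⟩

/-- A chord is not a rotation of itself with the other orientation, because `5` is odd. -/
theorem chordCount_orbit (hm : 0 < m) : chordCount m (orbit m a b) = 2 := by
  rw [chordCount, fundamental_orbit hm, Set.ncard_pair]
  intro h
  obtain ⟨j, hj⟩ := exists_eq_shift_of_toFundamental_eq h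
  simp only [Prod.mk.injEq] at hj
  have : (2 * j + 5) * m = 0 := by linarith
  rcases mul_eq_zero.1 this <;> omega

theorem chordCount_eq_diff_orbit_add_two (hE : Periodic m E) (hab : (a, b) ∈ E) :
    chordCount m E = chordCount m (E \ orbit m a b) + 2 := by
  have hsub : fundamental m (orbit m a b) ⊆ fundamental m E :=
    fun z hz => ⟨hE.orbit_subset hab hz.1, hz.2⟩
  have hdiff : fundamental m (E \ orbit m a b) = fundamental m E \ fundamental m (orbit m a b) := by
    ext z
    simp only [fundamental, Set.mem_ofPred_eq, Set.mem_sdiff]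
    tauto
  rw [← chordCount_orbit (a := a) (b := b) (hE.pos hab), chordCount, chordCount, chordCount, hdiff,
    Set.ncard_sdiff_add_ncard_of_subset hsub (finite_fundamental hE)]

theorem eq_of_chordCount_le (hm : 0 < m) (hE : Periodic m E) (hF : Periodic m F) (h : E ⊆ F)
    (hc : chordCount m F ≤ chordCount m E) : E = F := by
  have heq : fundamental m E = fundamental m F :=
    Set.eq_of_subset_of_ncard_le (fun _ hz => ⟨h hz.1, hz.2⟩) hc (finite_fundamental hF)
  refine h.antisymm fun z hz => ?_
  have hz' := heq ▸ hF.toFundamental_mem hm hz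
  exact (hE.shift_iff (-(z.1 / m))).1 hz'.1

end Counting

section Stars

variable {m : ℤ} {E F : Set (ℤ × ℤ)} {a b p q : ℤ}

/-- A chord whose length lies between `2 * m` and `3 * m` crosses two of its rotations, which cross
each other. -/
theorem TripleFree.length_le (hF : TripleFree m F) (h : (a, b) ∈ F) :
    b ≤ a + 2 * m ∨ a + 3 * m ≤ b := by
  by_contra! hlt
  exact hF.noTripleCrossing h (hF.shift 1 h) (hF.shift 2 h) (by omega)

theorem eq_of_mem_orbit_succ (hm : 2 ≤ m) {y : ℤ} (h : (a, y) ∈ orbit m (a + 1) b)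
    (hay : a + 1 < y) (hyb : y < b) (hb : b < a + 5 * m) :
    (b = a + 3 * m ∧ y = a + 1 + 2 * m) ∨ (b = a + 4 * m ∧ y = a + 1 + m) := by
  obtain ⟨j, ⟨ha, -⟩ | ⟨ha, rfl⟩⟩ := mem_orbit.1 h
  · have : (-j) * m = 1 := by linarith
    have := Int.eq_one_or_neg_one_of_mul_eq_one' this
    omega
  · obtain ⟨t, rfl⟩ : ∃ t, j = -t := ⟨-j, by ring⟩
    obtain rfl : b = a + t * m := by linarith
    have : t < 5 := by nlinarith
    have : 2 < t := by nlinarith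
    obtain rfl | rfl : t = 3 ∨ t = 4 := by omega
    · exact Or.inl ⟨rfl, by ring⟩
    · exact Or.inr ⟨rfl, by ring⟩

open Classical in
/-- The endpoint map which moves the ends `a + 1 + j * m` of the chords of `orbit m (a + 1) b` that
are not in `F` back to `a + j * m`. -/
noncomputable def slideBack (m : ℤ) (F : Set (ℤ × ℤ)) (a b u v : ℤ) : ℤ :=
  if (u, v) ∉ F ∧ ∃ j : ℤ, u = a + 1 + j * m ∧ v = b + j * m then u - 1 else u

theorem slideBack_of_mem {u v : ℤ} (h : (u, v) ∈ F) : slideBack m F a b u v = u :=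
  if_neg fun h' => h'.1 h

theorem mem_of_slideBack_ne {u v : ℤ} (h : slideBack m F a b u v ≠ u) :
    (u, v) ∉ F ∧ ∃ j : ℤ, u = a + 1 + j * m ∧ v = b + j * m :=
  of_not_not fun h' => h (if_neg h')

theorem slideBack_shift {j : ℤ} (h : (a + 1 + j * m, b + j * m) ∉ F) :
    slideBack m F a b (a + 1 + j * m) (b + j * m) = a + j * m :=
  (if_pos ⟨h, j, rfl, rfl⟩).trans (by ring)

theorem slideBack_twist (hm : 0 < m) (j : ℤ) :
    slideBack m F a b (b + j * m) (a + 1 + 5 * m + j * m) = b + j * m := by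
  refine if_neg fun ⟨_, i, h1, h2⟩ => ?_
  have : (5 + 2 * (j - i)) * m = 0 := by linarith
  rcases mul_eq_zero.1 this <;> omega

theorem slideBack_add_five (hF : Periodic m F) (u v : ℤ) :
    slideBack m F a b (u + 5 * m) (v + 5 * m) = slideBack m F a b u v + 5 * m := by
  have hiff : ((u + 5 * m, v + 5 * m) ∉ F ∧ ∃ j : ℤ, u + 5 * m = a + 1 + j * m ∧
      v + 5 * m = b + j * m) ↔ (u, v) ∉ F ∧ ∃ j : ℤ, u = a + 1 + j * m ∧ v = b + j * m :=
    and_congr (not_congr (hF.shift_iff 5))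
      ⟨fun ⟨j, h1, h2⟩ => ⟨j - 5, by linarith, by linarith⟩,
        fun ⟨j, h1, h2⟩ => ⟨j + 5, by linarith, by linarith⟩⟩
  by_cases h : (u, v) ∉ F ∧ ∃ j : ℤ, u = a + 1 + j * m ∧ v = b + j * m
  · rw [slideBack, slideBack, if_pos (hiff.2 h), if_pos h]
    ring
  · rw [slideBack, slideBack, if_neg (mt hiff.1 h), if_neg h]

theorem slideBack_mem (hF : Periodic m F) (h : (a, b) ∈ F) {u v : ℤ}
    (huv : (u, v) ∈ F ∪ orbit m (a + 1) b) :
    (slideBack m F a b u v, slideBack m F a b v (u + 5 * m)) ∈ F := by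
  by_cases hmem : (u, v) ∈ F
  · rwa [slideBack_of_mem hmem, slideBack_of_mem (hF.twist hmem)]
  have hm := hF.pos h
  obtain ⟨j, ⟨rfl, rfl⟩ | ⟨rfl, rfl⟩⟩ := mem_orbit.1 (huv.resolve_left hmem)
  · rw [slideBack_shift hmem, show a + 1 + j * m + 5 * m = a + 1 + 5 * m + j * m by ring,
      slideBack_twist hm]
    exact hF.shift j h
  · have hmem' : (a + 1 + (j + 5) * m, b + (j + 5) * m) ∉ F := fun h' =>
      hmem (hF.of_eq_twist (-5) h' (by ring) (by ring))
    rw [slideBack_twist hm, show a + 1 + 5 * m + j * m = a + 1 + (j + 5) * m by ring,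
      show b + j * m + 5 * m = b + (j + 5) * m by ring, slideBack_shift hmem']
    exact hF.of_eq_twist j h rfl (by ring)

/-- If adding the chord from `a + 1` to `b` creates a triple crossing, sliding its end `a + 1` back
to `a` must destroy it, so that one of the other two chords starts at `a`. -/
theorem TripleFree.union_orbit_succ (hF : TripleFree m F) (h : (a, b) ∈ F) (hab : a + 1 < b)
    (hcross : ∀ {x y z}, a + 1 < x → x < y → y < b → b < z → z < a + 5 * m →
      (a, y) ∈ F ∪ orbit m (a + 1) b → (x, z) ∉ F ∪ orbit m (a + 1) b) :
    TripleFree m (F ∪ orbit m (a + 1) b) := by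
  have hba := hF.lt_add h
  have hG := hF.toPeriodic.union (periodic_orbit (m := m) hab (by omega))
  refine ⟨hG, noTripleCrossing_of_map hG hF.noTripleCrossing (slideBack m F a b)
    (fun _ => slideBack_add_five hF.toPeriodic _ _)
    (fun huv _ _ => slideBack_mem hF.toPeriodic h huv) ?_⟩
  intro u v w u' v' w' hu hv hw huvw
  have hle : slideBack m F a b u u' ≤ u := by unfold slideBack; split_ifs <;> omega
  by_contra! hlt
  obtain ⟨hvF, j, rfl, rfl⟩ := mem_of_slideBack_ne (m := m) (F := F) (a := a) (b := b) (u := v)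
    (v := v') (by omega)
  have hv' := slideBack_shift hvF
  obtain rfl : u = a + j * m := by omega
  exact hcross (x := w - j * m) (y := u' - j * m) (z := w' - j * m) (by omega) (by omega)
    (by omega) (by omega) (by omega) (hG.of_eq_shift (-j) hu (by ring) (by ring))
    (hG.of_eq_shift (-j) hw (by ring) (by ring))

/-- Going around the polygon, `y` is the first vertex after `l` joined to `c` by a chord of `E`. -/
structure IsNextNeighbor (E : Set (ℤ × ℤ)) (c l y : ℤ) : Prop where
  lt : l < y
  mem : (c, y) ∈ E
  le : ∀ {x}, l < x → (c, x) ∈ E → y ≤ x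

theorem exists_isNextNeighbor {c l y : ℤ} (hly : l < y) (hy : (c, y) ∈ E) :
    ∃ x ≤ y, IsNextNeighbor E c l x := by
  obtain ⟨x, ⟨hlx, hx⟩, hle⟩ := Int.exists_least_of_bdd (P := fun x => l < x ∧ (c, x) ∈ E)
    ⟨l, fun _ h => h.1.le⟩ ⟨y, hly, hy⟩
  exact ⟨x, hle y ⟨hly, hy⟩, hlx, hx, fun h h' => hle _ ⟨h, h'⟩⟩

theorem IsNextNeighbor.union_orbit_one (hm : 3 ≤ m) (hF : TripleFree m F)
    (hp : IsNextNeighbor F 0 2 p) : TripleFree m (F ∪ orbit m 1 p) := by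
  have h2p := hp.lt
  have hp5 := hF.lt_add hp.mem
  refine hF.union_orbit_succ hp.mem (by omega) fun h0x hxy hyp _ _ hy => ?_
  rcases hy with hy | hy
  · have := hp.le (by omega) hy
    omega
  · obtain ⟨rfl, -⟩ | ⟨rfl, -⟩ := eq_of_mem_orbit_succ (by omega) hy (by omega) hyp hp5
    · have := hp.le (by omega) (hF.of_eq_twist (-3) hp.mem (v' := 2 * m) (by ring) (by ring))
      omega
    · have := hp.le (by omega) (hF.of_eq_twist (-4) hp.mem (v' := m) (by ring) (by ring))
      omega

namespace IsNextNeighbor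

variable {r x y z : ℤ}

theorem notMem_of_lt (hF : TripleFree m F) (hp : IsNextNeighbor F 0 2 p)
    (hr : IsNextNeighbor F 1 p r) (hx : 1 < x) (hxp : x < p) (hrz : r < z) (hz : z < 5 * m) :
    (x, z) ∉ F := fun h =>
  have := hr.lt
  hF.noTripleCrossing hp.mem hr.mem h (by omega)

theorem ne_four_mul (hm : 3 ≤ m) (hF : TripleFree m F) (hp : IsNextNeighbor F 0 2 p) :
    p ≠ 4 * m := by
  rintro rfl
  have := hp.le (by omega) (hF.of_eq_twist (-4) hp.mem (v' := m) (by ring) (by ring))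
  omega

theorem ne_one_add_three_mul (hm : 3 ≤ m) (hF : TripleFree m F) (hp : IsNextNeighbor F 0 2 p)
    (hr : IsNextNeighbor F 1 p r) : r ≠ 1 + 3 * m := by
  rintro rfl
  have hpr := hr.lt
  have hle : 1 + 2 * m ≤ p := by
    by_contra! hlt
    have := hr.le hlt (hF.of_eq_twist (-3) hr.mem (by ring) (by ring))
    omega
  obtain rfl : p = 3 * m := by
    have := hF.length_le hp.mem
    omega
  have := hp.le (by omega) (hF.of_eq_twist (-3) hp.mem (v' := 2 * m) (by ring) (by ring))
  omega

theorem notMem_union_orbit_two (hm : 3 ≤ m) (hF : TripleFree m F) (hp : IsNextNeighbor F 0 2 p)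
    (hr : IsNextNeighbor F 1 p r) (hx : 2 < x) (hxp : x < p) (hrz : r < z) (hz : z ≤ 5 * m) :
    (x, z) ∉ F ∪ orbit m 2 r := by
  have hpr := hr.lt
  rintro (h | h)
  · rcases hz.lt_or_eq with hz | rfl
    · exact hp.notMem_of_lt hF hr (by omega) hxp hrz hz h
    · have := hp.le hx (hF.untwist (by simpa using h))
      omega
  obtain ⟨j, ⟨rfl, rfl⟩ | ⟨rfl, rfl⟩⟩ := mem_orbit.1 h
  · have : 0 < j := by nlinarith
    have : m ≤ j * m := by nlinarith
    rcases hz.lt_or_eq with hz | hz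
    · exact hp.notMem_of_lt hF hr (by omega) (by omega) hrz hz (hF.shift j hr.mem)
    · have := hp.le (x := 1 + j * m) (by omega)
        (hF.untwist (by simpa [hz] using hF.shift j hr.mem))
      omega
  · by_cases hlt : r < 1 + 5 * m + j * m
    · exact hp.notMem_of_lt hF hr (by omega) hxp hlt (by omega) (hF.shift j (hF.twist hr.mem))
    obtain ⟨t, rfl⟩ : ∃ t, j = t - 5 := ⟨j + 5, by ring⟩
    obtain rfl : r = 1 + t * m := by linarith
    have : t < 5 := by nlinarith
    have : 0 < 2 * t - 5 := by nlinarith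
    obtain rfl | rfl : t = 3 ∨ t = 4 := by omega
    · exact hp.ne_one_add_three_mul hm hF hr rfl
    · have := hp.ne_four_mul hm hF
      exact hp.notMem_of_lt hF hr (x := m) (z := p + m) (by omega) (by omega) (by omega)
        (by omega) (hF.of_eq_shift 1 hp.mem (by ring) (by ring))

theorem union_orbit_two (hm : 3 ≤ m) (hF : TripleFree m F) (hp : IsNextNeighbor F 0 2 p)
    (hr : IsNextNeighbor F 1 p r) (hr5 : r < 5 * m) : TripleFree m (F ∪ orbit m 2 r) := by
  have h2p := hp.lt
  have hpr := hr.lt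
  refine hF.union_orbit_succ hr.mem (by omega) fun {x y z} hx hxy hyr hrz hz hy hxz => ?_
  have hpx : p ≤ x := by
    by_contra! hxp
    exact hp.notMem_union_orbit_two hm hF hr (by omega) hxp hrz (by omega) hxz
  rcases hy with hy | hy
  · have := hr.le (by omega) hy
    omega
  obtain ⟨rfl, -⟩ | ⟨rfl, rfl⟩ := eq_of_mem_orbit_succ (by omega) hy (by omega) hyr (by omega)
  · exact hp.ne_one_add_three_mul hm hF hr rfl
  have hle : 1 + m ≤ p := by
    by_contra! hlt
    have := hr.le hlt (hF.of_eq_twist (-4) hr.mem (by ring) (by ring))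
    omega
  obtain rfl : x = 1 + m := by omega
  rcases hxz with hxz | hxz
  · have := hr.le (x := z - m) (by omega) (hF.of_eq_shift (-1) hxz (by ring) (by ring))
    omega
  · obtain ⟨j, ⟨h1, -⟩ | ⟨h1, rfl⟩⟩ := mem_orbit.1 hxz
    · have := Int.eq_one_or_neg_one_of_mul_eq_one' (show (1 - j) * m = 1 by linarith)
      omega
    · have : j = -3 := mul_right_cancel₀ (b := m) (by omega) (by linarith)
      subst this
      omega

end IsNextNeighbor

/-- The `2`-star with vertices `0, 1, 2, p, q` is the pentagram `0, p, 1, q, 2`; its fifth chord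
`(0, 2)` is short. -/
structure Star (m : ℤ) (E : Set (ℤ × ℤ)) (p q : ℤ) : Prop where
  two_lt : 2 < p
  lt : p < q
  lt_five : q < 5 * m
  zero_p : (0, p) ∈ E
  one_p : (1, p) ∈ E
  one_q : (1, q) ∈ E
  two_q : (2, q) ∈ E

theorem MaxTripleFree.exists_star (hm : 3 ≤ m) (hE : MaxTripleFree m E) : ∃ p q, Star m E p q := by
  have hshort := hE.shortChords_subset
  obtain ⟨p, hpm, hp⟩ := exists_isNextNeighbor (c := 0) (l := 2) (y := 5 * m - 2) (by omega)
    (hshort (by rw [mem_shortChords]; omega))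
  obtain ⟨r, hrm, hr⟩ := exists_isNextNeighbor (c := 1) (l := p) (y := 5 * m - 1) (by omega)
    (hshort (by rw [mem_shortChords]; omega))
  exact ⟨p, r, hp.lt, hr.lt, by omega, hp.mem,
    hE.mem_of_union_orbit (hp.union_orbit_one hm hE.tripleFree), hr.mem,
    hE.mem_of_union_orbit (hp.union_orbit_two hm hE.tripleFree hr (by omega))⟩

/-- Chords from `0`, `1`, `2` to `x < y < z` pairwise cross. -/
theorem TripleFree.not_fan (hE : TripleFree m E) {x y z : ℤ} (hx : (0, x) ∈ E) (hy : (1, y) ∈ E)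
    (hz : (2, z) ∈ E) : ¬ (2 < x ∧ x < y ∧ y < z ∧ z < 5 * m) := fun _ =>
  hE.noTripleCrossing hx hy hz (by omega)

end Stars

section Collapse

/-- The position, after collapsing the rotations of the star `0, p, 1, q, 2`, of the end `u` of the
chord from `u` to `x`: the vertices `j * m` and `2 + j * m` become consecutive, and the chords at
`1 + j * m` are distributed between them according to the side of `p + j * m` on which they end. -/
def collapseEnd (m p u x : ℤ) : ℤ :=
  u - u / m - (if u % m = 0 ∨ (u % m = 1 ∧ p + u - 1 < x) then 0 else 1)

variable {m p q : ℤ} {E : Set (ℤ × ℤ)} {u w x y : ℤ}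

theorem emod_ediv_succ_cases (hm : 0 < m) (u : ℤ) :
    ((u + 1) % m = 0 ∧ u % m = m - 1 ∧ (u + 1) / m = u / m + 1) ∨
    ((u + 1) % m = u % m + 1 ∧ u % m + 1 < m ∧ (u + 1) / m = u / m) := by
  have h0 := Int.emod_nonneg u hm.ne'
  have h1 := Int.emod_lt_of_pos u hm
  have h2 := Int.emod_add_ediv_mul u m
  obtain hs | hs : u % m = m - 1 ∨ u % m + 1 < m := by omega
  · have := (Int.ediv_emod_unique hm (a := u + 1) (r := 0) (q := u / m + 1)).2
      ⟨by linarith, le_rfl, hm⟩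
    exact Or.inl ⟨this.2, hs, this.1⟩
  · have := (Int.ediv_emod_unique hm (a := u + 1) (r := u % m + 1) (q := u / m)).2
      ⟨by linarith, by omega, hs⟩
    exact Or.inr ⟨this.2, hs, this.1⟩

theorem exists_eq_add_mul_of_emod_eq {s : ℤ} (h : u % m = s) : ∃ j, u = s + j * m :=
  ⟨u / m, by rw [← h, Int.emod_add_ediv_mul]⟩

theorem add_mul_inj_of_lt {s t i j : ℤ} (hs : 0 ≤ s) (hsm : s < m) (ht : 0 ≤ t) (htm : t < m)
    (h : s + j * m = t + i * m) : s = t ∧ j = i := by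
  have hm : 0 < m := by omega
  have h1 := (Int.ediv_emod_unique hm).2 ⟨show s + m * j = s + j * m by ring, hs, hsm⟩
  have h2 := (Int.ediv_emod_unique hm).2 ⟨show t + m * i = s + j * m by linarith, ht, htm⟩
  exact ⟨h1.2.symm.trans h2.2, h1.1.symm.trans h2.1⟩

theorem mul_ne_of_pos_of_lt {r : ℤ} (h0 : 0 < r) (hr : r < m) (k : ℤ) : k * m ≠ r := fun h => by
  have := add_mul_inj_of_lt (m := m) (s := 0) (t := r) (j := k) (i := 0) le_rfl (by omega) h0.le hr
    (by simpa using h)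
  omega

theorem collapseEnd_shift (hm : 0 < m) (j u x : ℤ) :
    collapseEnd m p (u + j * m) (x + j * m) = collapseEnd m p u x + j * (m - 1) := by
  have : p + (u + j * m) - 1 < x + j * m ↔ p + u - 1 < x := by constructor <;> intro <;> linarith
  simp only [collapseEnd, Int.add_mul_emod_self_right, Int.add_mul_ediv_right _ _ hm.ne', this]
  ring

theorem collapseEnd_add_five (hm : 0 < m) (u x : ℤ) :
    collapseEnd m p (u + 5 * m) (x + 5 * m) = collapseEnd m p u x + 5 * (m - 1) :=
  collapseEnd_shift hm 5 u x

theorem collapseEnd_mul (hm : 3 ≤ m) (j x : ℤ) : collapseEnd m p (j * m) x = j * (m - 1) := by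
  have := collapseEnd_shift (p := p) (by omega : 0 < m) j 0 (x - j * m)
  simpa [collapseEnd] using this

theorem collapseEnd_one_of_le (hm : 3 ≤ m) (hx : x ≤ p) : collapseEnd m p 1 x = 0 := by
  rw [collapseEnd, Int.emod_eq_of_lt (by omega) (by omega), Int.ediv_eq_zero_of_lt (by omega)
    (by omega), if_neg (by omega)]
  rfl

theorem collapseEnd_one_of_lt (hm : 3 ≤ m) (hx : p < x) : collapseEnd m p 1 x = 1 := by
  rw [collapseEnd, Int.emod_eq_of_lt (by omega) (by omega), Int.ediv_eq_zero_of_lt (by omega)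
    (by omega), if_pos (by omega)]
  rfl

theorem collapseEnd_of_two_le {s : ℤ} (hs : 2 ≤ s) (hsm : s < m) (x : ℤ) :
    collapseEnd m p s x = s - 1 := by
  rw [collapseEnd, Int.emod_eq_of_lt (by omega) (by omega), Int.ediv_eq_zero_of_lt (by omega)
    (by omega), if_neg (by omega), sub_zero]

theorem collapseEnd_two (hm : 3 ≤ m) (x : ℤ) : collapseEnd m p 2 x = 1 :=
  collapseEnd_of_two_le le_rfl (by omega) x

theorem collapseEnd_one_add_mul_of_le (hm : 3 ≤ m) {j : ℤ} (hx : x ≤ p + j * m) :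
    collapseEnd m p (1 + j * m) x = j * (m - 1) := by
  have := collapseEnd_shift (p := p) (by omega : 0 < m) j 1 (x - j * m)
  rwa [sub_add_cancel, collapseEnd_one_of_le hm (by omega), zero_add] at this

theorem collapseEnd_one_add_mul_of_lt (hm : 3 ≤ m) {j : ℤ} (hx : p + j * m < x) :
    collapseEnd m p (1 + j * m) x = 1 + j * (m - 1) := by
  have := collapseEnd_shift (p := p) (by omega : 0 < m) j 1 (x - j * m)
  rwa [sub_add_cancel, collapseEnd_one_of_lt hm (by omega)] at this

theorem collapseEnd_add_mul {s : ℤ} (hs : 2 ≤ s) (hsm : s < m) (j x : ℤ) :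
    collapseEnd m p (s + j * m) x = s - 1 + j * (m - 1) := by
  have := collapseEnd_shift (p := p) (by omega : 0 < m) j s (x - j * m)
  rwa [sub_add_cancel, collapseEnd_of_two_le hs hsm] at this

theorem collapseEnd_two_add_mul (hm : 3 ≤ m) (j x : ℤ) :
    collapseEnd m p (2 + j * m) x = 1 + j * (m - 1) :=
  collapseEnd_add_mul le_rfl (by omega) j x

/-- A lower bound for the possible positions `collapseEnd m p u x` of the vertex `u`, attained
unless `u` is a rotation of `1`. -/
def collapseMin (m u : ℤ) : ℤ := u - u / m - (if u % m = 0 then 0 else 1)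

theorem collapseMin_succ (hm : 3 ≤ m) (u : ℤ) :
    collapseMin m (u + 1) = collapseMin m u + (if u % m = 0 then 0 else 1) := by
  have h0 := Int.emod_nonneg u (by omega : m ≠ 0)
  simp only [collapseMin]
  rcases emod_ediv_succ_cases (by omega : 0 < m) u with ⟨h, -, h'⟩ | ⟨h, -, h'⟩ <;>
    rw [h, h'] <;> split_ifs <;> omega

theorem collapseMin_mono (hm : 3 ≤ m) : Monotone (collapseMin m) := by
  refine monotone_int_of_le_succ fun u => ?_
  rw [collapseMin_succ hm]
  split_ifs <;> omega

theorem collapseMin_le (u x : ℤ) : collapseMin m u ≤ collapseEnd m p u x := by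
  simp only [collapseMin, collapseEnd]; split_ifs <;> omega

theorem collapseEnd_le (u x : ℤ) :
    collapseEnd m p u x ≤ collapseMin m u + (if u % m = 1 then 1 else 0) := by
  simp only [collapseMin, collapseEnd]; split_ifs <;> omega

theorem collapseEnd_le_of_lt (hm : 3 ≤ m) (h : u < w) (x y : ℤ) :
    collapseEnd m p u x ≤ collapseEnd m p w y := by
  have hu := collapseEnd_le (m := m) (p := p) u x
  have hsucc := collapseMin_succ hm u
  have hmono := collapseMin_mono hm (by omega : u + 1 ≤ w)
  have hw := collapseMin_le (m := m) (p := p) w y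
  split_ifs at * <;> omega

theorem collapseEnd_lt_of_add_two_le (hm : 3 ≤ m) (h : u + 2 ≤ w) (x y : ℤ) :
    collapseEnd m p u x < collapseEnd m p w y := by
  have hu := collapseEnd_le (m := m) (p := p) u x
  have hsucc := collapseMin_succ hm u
  have hsucc' := collapseMin_succ hm (u + 1)
  have hmono := collapseMin_mono hm (by omega : u + 1 + 1 ≤ w)
  have hw := collapseMin_le (m := m) (p := p) w y
  have := emod_ediv_succ_cases (by omega : 0 < m) u
  split_ifs at * <;> omega

theorem collapseEnd_lt_succ (hm : 3 ≤ m) (h0 : u % m ≠ 0) (h1 : u % m ≠ 1) (x y : ℤ) :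
    collapseEnd m p u x < collapseEnd m p (u + 1) y := by
  have hu := collapseEnd_le (m := m) (p := p) u x
  have hsucc := collapseMin_succ hm u
  have hw := collapseMin_le (m := m) (p := p) (u + 1) y
  rw [if_neg h0] at hsucc
  rw [if_neg h1] at hu
  omega

theorem succ_of_collapseEnd_eq (hm : 3 ≤ m) (h : collapseEnd m p u x = collapseEnd m p w y)
    (huw : u < w) :
    w = u + 1 ∧ ((∃ j, u = j * m ∧ y ≤ p + j * m) ∨ (∃ j, u = 1 + j * m ∧ p + j * m < x)) := by
  obtain rfl : w = u + 1 := by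
    by_contra hne
    have := collapseEnd_lt_of_add_two_le (p := p) hm (by omega : u + 2 ≤ w) x y
    omega
  refine ⟨rfl, ?_⟩
  by_cases h0 : u % m = 0
  · obtain ⟨j, rfl⟩ := exists_eq_add_mul_of_emod_eq h0
    rw [zero_add] at *
    refine Or.inl ⟨j, rfl, ?_⟩
    by_contra! hy
    rw [collapseEnd_mul hm, add_comm (j * m) 1, collapseEnd_one_add_mul_of_lt hm hy] at h
    omega
  by_cases h1 : u % m = 1
  · obtain ⟨j, rfl⟩ := exists_eq_add_mul_of_emod_eq h1
    refine Or.inr ⟨j, rfl, ?_⟩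
    by_contra! hx
    rw [collapseEnd_one_add_mul_of_le hm hx, add_right_comm, one_add_one_eq_two,
      collapseEnd_two_add_mul hm] at h
    omega
  · have := collapseEnd_lt_succ (p := p) hm h0 h1 x y
    omega

theorem lt_of_collapseEnd_lt (hm : 3 ≤ m) (h : collapseEnd m p u x < collapseEnd m p w y) :
    u < w ∨ (u = w ∧ ∃ j, u = 1 + j * m ∧ x ≤ p + j * m ∧ p + j * m < y) := by
  rcases lt_trichotomy u w with hlt | rfl | hgt
  · exact Or.inl hlt
  · have h1 : u % m = 1 := by
      by_contra h1
      simp [collapseEnd, h1] at h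
    obtain ⟨j, rfl⟩ := exists_eq_add_mul_of_emod_eq h1
    refine Or.inr ⟨rfl, j, rfl, ?_⟩
    rw [collapseEnd, collapseEnd] at h
    split_ifs at h <;> omega
  · have := collapseEnd_le_of_lt (p := p) hm hgt y x
    omega

theorem le_of_collapseEnd_lt (hm : 3 ≤ m) (h : collapseEnd m p u x < collapseEnd m p w y) :
    u ≤ w := by
  rcases lt_of_collapseEnd_lt hm h with h | h
  · exact h.le
  · exact h.1.le

theorem collapseEnd_lt_collapseEnd (hm : 3 ≤ m) (hp : 2 < p) (hp5 : p < 5 * m) {u v : ℤ}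
    (h : u < v) (h' : v < u + 5 * m) : collapseEnd m p u v < collapseEnd m p v (u + 5 * m) := by
  refine lt_of_le_of_ne (collapseEnd_le_of_lt hm h _ _) fun he => ?_
  obtain ⟨rfl, ⟨j, rfl, hj⟩ | ⟨j, rfl, hj⟩⟩ := succ_of_collapseEnd_eq hm he h <;> omega

/-- The effect on chords of collapsing the rotations of the star `0, p, 1, q, 2`. It does not depend
on `q`. -/
def collapse (m p : ℤ) (z : ℤ × ℤ) : ℤ × ℤ :=
  (collapseEnd m p z.1 z.2, collapseEnd m p z.2 (z.1 + 5 * m))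

theorem collapse_shift (hm : 0 < m) (j u v : ℤ) : collapse m p (u + j * m, v + j * m) =
    ((collapse m p (u, v)).1 + j * (m - 1), (collapse m p (u, v)).2 + j * (m - 1)) := by
  simp only [collapse, collapseEnd_shift hm, Prod.mk.injEq, true_and]
  rw [← collapseEnd_shift hm, add_right_comm]

theorem collapse_twist (hm : 0 < m) (u v : ℤ) : collapse m p (v, u + 5 * m) =
    ((collapse m p (u, v)).2, (collapse m p (u, v)).1 + 5 * (m - 1)) := by
  simp only [collapse, collapseEnd_add_five hm]

theorem Periodic.image_collapse (hm : 3 ≤ m) (hp : 2 < p) (hp5 : p < 5 * m) (hE : Periodic m E) :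
    Periodic (m - 1) (collapse m p '' E) where
  shift := by
    rintro j x y ⟨⟨u, v⟩, h, he⟩
    exact ⟨_, hE.shift j h, by rw [collapse_shift (by omega), he]⟩
  twist := by
    rintro x y ⟨⟨u, v⟩, h, he⟩
    exact ⟨_, hE.twist h, by rw [collapse_twist (by omega), he]⟩
  lt := by
    rintro x y ⟨⟨u, v⟩, h, rfl, rfl⟩
    exact collapseEnd_lt_collapseEnd hm hp hp5 (hE.lt h) (hE.lt_add h)
  lt_add := by
    rintro x y ⟨⟨u, v⟩, h, rfl, rfl⟩
    have h' := hE.twist h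
    rw [← collapseEnd_add_five (by omega)]
    exact collapseEnd_lt_collapseEnd hm hp hp5 (hE.lt h') (hE.lt_add h')

/-- The condition on the end `u` of a chord from `u` to `x` not to form a triple crossing with two
chords of a rotation of the star `0, p, 1, q, 2`. -/
structure Compatible (m p q u x : ℤ) : Prop where
  zero : ∀ j, u = j * m → x ≤ 2 + j * m ∨ p + j * m ≤ x
  one : ∀ j, u = 1 + j * m → x ≤ p + j * m ∨ q + j * m ≤ x
  two : ∀ j, u = 2 + j * m → x ≤ q + j * m ∨ 5 * m + j * m ≤ x

theorem Compatible.shift (h : Compatible m p q u x) (j : ℤ) :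
    Compatible m p q (u + j * m) (x + j * m) := by
  constructor <;> intro i hi
  · have := h.zero (i - j) (by linarith)
    rw [sub_mul] at this; omega
  · have := h.one (i - j) (by linarith)
    rw [sub_mul] at this; omega
  · have := h.two (i - j) (by linarith)
    rw [sub_mul] at this; omega

theorem compatible_of_residue (hm : 3 ≤ m) {s j : ℤ} (hs : 0 ≤ s) (hsm : s < m)
    (hzero : s = 0 → x ≤ 2 + j * m ∨ p + j * m ≤ x) (hone : s = 1 → x ≤ p + j * m ∨ q + j * m ≤ x)
    (htwo : s = 2 → x ≤ q + j * m ∨ 5 * m + j * m ≤ x) : Compatible m p q (s + j * m) x := by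
  refine ⟨fun i hi => ?_, fun i hi => ?_, fun i hi => ?_⟩
  · obtain ⟨h, rfl⟩ := add_mul_inj_of_lt (t := 0) hs hsm (by omega) (by omega) (by simpa using hi)
    exact hzero h
  · obtain ⟨h, rfl⟩ := add_mul_inj_of_lt hs hsm (by omega) (by omega) hi
    exact hone h
  · obtain ⟨h, rfl⟩ := add_mul_inj_of_lt hs hsm (by omega) (by omega) hi
    exact htwo h

/-- The chords that form no triple crossing with two chords of a rotation of the star
`0, p, 1, q, 2`. -/
def region (m p q : ℤ) : Set (ℤ × ℤ) :=
  {z | z.1 < z.2 ∧ z.2 < z.1 + 5 * m ∧ Compatible m p q z.1 z.2 ∧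
    Compatible m p q z.2 (z.1 + 5 * m)}

theorem periodic_region : Periodic m (region m p q) where
  shift j u v := by
    rintro ⟨h1, h2, h3, h4⟩
    refine ⟨by simpa using h1, by simp only at *; omega, h3.shift j, ?_⟩
    simpa [add_right_comm] using h4.shift j
  twist {u v} := by
    rintro ⟨h1, h2, h3, h4⟩
    exact ⟨h2, by simp only at *; omega, h4, h3.shift 5⟩
  lt h := h.1
  lt_add h := h.2.1

theorem Star.compatible (hS : Star m E p q) (hE : TripleFree m E) (h : (u, x) ∈ E) :
    Compatible m p q u x := by
  obtain ⟨h2p, hpq, hq, h0p, h1p, h1q, h2q⟩ := hS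
  have := hE.lt_add h
  constructor <;> rintro j rfl <;> by_contra! hx
  · exact hE.not_fan (hE.of_eq_shift (v' := x - j * m) (-j) h (by ring) (by ring)) h1p h2q
      (by omega)
  · exact hE.not_fan h0p (hE.of_eq_shift (v' := x - j * m) (-j) h (by ring) (by ring)) h2q
      (by omega)
  · exact hE.not_fan h0p h1q (hE.of_eq_shift (v' := x - j * m) (-j) h (by ring) (by ring))
      (by omega)

theorem Star.subset_region (hS : Star m E p q) (hE : TripleFree m E) : E ⊆ region m p q :=
  fun _ h => ⟨hE.lt h, hE.lt_add h, hS.compatible hE h, hS.compatible hE (hE.twist h)⟩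

/-- The chords of `region m p q` whose collapse lies in `T`. -/
def pullback (m p q : ℤ) (T : Set (ℤ × ℤ)) : Set (ℤ × ℤ) :=
  {z | z ∈ region m p q ∧ collapse m p z ∈ T}

theorem Periodic.pullback (hm : 3 ≤ m) {T : Set (ℤ × ℤ)} (hT : Periodic (m - 1) T) :
    Periodic m (pullback m p q T) where
  shift j u v h := ⟨periodic_region.shift j h.1, by
    rw [collapse_shift (by omega)]
    exact hT.shift j h.2⟩
  twist h := ⟨periodic_region.twist h.1, by
    rw [collapse_twist (by omega)]
    exact hT.twist h.2⟩
  lt h := h.1.1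
  lt_add h := h.1.2.1

theorem TripleFree.pullback (hm : 3 ≤ m) {T : Set (ℤ × ℤ)} (hT : TripleFree (m - 1) T) :
    TripleFree m (pullback m p q T) := by
  have hP := hT.toPeriodic.pullback (p := p) (q := q) hm
  refine ⟨hP, noTripleCrossing_of_map hP hT.noTripleCrossing (collapseEnd m p)
    (fun _ => collapseEnd_add_five (by omega) _ _) (fun h _ _ => h.2) ?_⟩
  rintro a b c a' b' c' ⟨⟨-, -, ha, -⟩, -⟩ ⟨⟨-, -, hb, -⟩, -⟩ - ⟨hab, _⟩
  refine lt_of_le_of_ne (collapseEnd_le_of_lt hm hab _ _) fun he => ?_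
  obtain ⟨rfl, ⟨j, rfl, hj⟩ | ⟨j, rfl, hj⟩⟩ := succ_of_collapseEnd_eq hm he hab
  · have : a' ≤ 2 + j * m ∨ p + j * m ≤ a' := ha.zero j rfl
    omega
  · have : a' ≤ p + j * m ∨ q + j * m ≤ a' := ha.one j rfl
    have : b' ≤ q + j * m ∨ 5 * m + j * m ≤ b' := hb.two j (by ring)
    omega

/-- Above a vertex `x` of the collapsed polygon there are at most two vertices, and which one is the
end of a compatible chord depends on the side of a threshold `t` on which the chord ends. -/
theorem exists_compatible_ends (hm : 3 ≤ m) (hpq : p < q) (x : ℤ) :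
    ∃ u u' t : ℤ, u ≤ u' ∧ u' ≤ u + 1 ∧
      (∀ v, t ≤ v → collapseEnd m p u v = x ∧ Compatible m p q u v) ∧
      (∀ v, v ≤ t → collapseEnd m p u' v = x ∧ Compatible m p q u' v) := by
  have hm1 : 0 < m - 1 := by omega
  have h0 := Int.emod_nonneg x hm1.ne'
  have h1 := Int.emod_lt_of_pos x hm1
  obtain ⟨j, hx⟩ := exists_eq_add_mul_of_emod_eq (u := x) (m := m - 1) rfl
  obtain hs | hs | hs : x % (m - 1) = 0 ∨ x % (m - 1) = 1 ∨ 2 ≤ x % (m - 1) := by omega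
  · rw [hs, zero_add] at hx
    refine ⟨0 + j * m, 1 + j * m, p + j * m, by omega, by omega, fun v hv => ⟨?_, ?_⟩,
      fun v hv => ⟨?_, ?_⟩⟩
    · rw [zero_add, collapseEnd_mul hm, hx]
    · exact compatible_of_residue hm (by omega) (by omega) (by omega) (by omega) (by omega)
    · rw [collapseEnd_one_add_mul_of_le hm hv, hx]
    · exact compatible_of_residue hm (by omega) (by omega) (by omega) (by omega) (by omega)
  · rw [hs] at hx
    refine ⟨1 + j * m, 2 + j * m, q + j * m, by omega, by omega, fun v hv => ⟨?_, ?_⟩,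
      fun v hv => ⟨?_, ?_⟩⟩
    · rw [collapseEnd_one_add_mul_of_lt hm (by omega), hx]
    · exact compatible_of_residue hm (by omega) (by omega) (by omega) (by omega) (by omega)
    · rw [collapseEnd_two_add_mul hm, hx]
    · exact compatible_of_residue hm (by omega) (by omega) (by omega) (by omega) (by omega)
  · have hend : ∀ v, collapseEnd m p (x % (m - 1) + 1 + j * m) v = x ∧
        Compatible m p q (x % (m - 1) + 1 + j * m) v := fun v =>
      ⟨by rw [collapseEnd_add_mul (by omega) (by omega), add_sub_cancel_right, ← hx],
        compatible_of_residue hm (by omega) (by omega) (by omega) (by omega) (by omega)⟩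
    exact ⟨_, _, 0, le_rfl, by omega, fun v _ => hend v, fun v _ => hend v⟩

theorem exists_compatible_pair (hm : 3 ≤ m) (hpq : p < q) (x y : ℤ) :
    ∃ u v, Compatible m p q u v ∧ Compatible m p q v (u + 5 * m) ∧
      collapse m p (u, v) = (x, y) := by
  obtain ⟨u, u', s, _, _, hu, hu'⟩ := exists_compatible_ends (p := p) (q := q) hm hpq x
  obtain ⟨v, v', t, _, _, hv, hv'⟩ := exists_compatible_ends (p := p) (q := q) hm hpq y
  obtain ⟨a, b, ha, hb⟩ : ∃ a b, (collapseEnd m p a b = x ∧ Compatible m p q a b) ∧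
      (collapseEnd m p b (a + 5 * m) = y ∧ Compatible m p q b (a + 5 * m)) := by
    by_cases hs : v' ≤ s
    · by_cases ht : u' + 5 * m ≤ t
      · exact ⟨u', v', hu' _ hs, hv' _ ht⟩
      · exact ⟨u', v, hu' _ (by omega), hv _ (by omega)⟩
    · by_cases ht : u + 5 * m ≤ t
      · exact ⟨u, v', hu _ (by omega), hv' _ ht⟩
      · exact ⟨u, v, hu _ (by omega), hv _ (by omega)⟩
  exact ⟨a, b, ha.2, hb.2, Prod.ext ha.1 hb.1⟩

theorem one_two_mem_region (hm : 3 ≤ m) (hp : 2 < p) : (1, 2) ∈ region m p q := by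
  refine ⟨by norm_num, by simp only; omega, ?_, ?_⟩
  · simpa using compatible_of_residue (m := m) (p := p) (q := q) (s := 1) (j := 0) (x := 2) hm
      (by omega) (by omega) (by omega) (by omega) (by omega)
  · simpa using compatible_of_residue (m := m) (p := p) (q := q) (s := 2) (j := 0)
      (x := 1 + 5 * m) hm (by omega) (by omega) (by omega) (by omega) (by omega)

theorem collapse_one_two (hm : 3 ≤ m) (hp : 2 < p) : collapse m p (1, 2) = (0, 1) :=
  Prod.ext (collapseEnd_one_of_le hm hp.le) (collapseEnd_two hm _)

theorem exists_mem_region_collapse_eq (hm : 3 ≤ m) (hp : 2 < p) (hpq : p < q) (hxy : x < y)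
    (hyx : y < x + 5 * (m - 1)) : ∃ z ∈ region m p q, collapse m p z = (x, y) := by
  obtain ⟨u, v, huv, hvu, hcol⟩ := exists_compatible_pair (p := p) (q := q) hm hpq x y
  obtain ⟨rfl, rfl⟩ := Prod.mk.inj hcol
  simp only at hxy hyx ⊢
  have h12 := one_two_mem_region (q := q) hm hp
  have hc12 := collapse_one_two hm hp
  rw [← collapseEnd_add_five (by omega)] at hyx
  -- If `u` and `v` are the same vertex, a rotation of `1`, then the chord `(1, 2)` has that image.
  rcases lt_of_collapseEnd_lt hm hxy with h1 | ⟨rfl, j, rfl, h1, h2⟩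
  · rcases lt_of_collapseEnd_lt hm hyx with h3 | ⟨h3, j, rfl, h4, h5⟩
    · exact ⟨(u, v), ⟨h1, h3, huv, hvu⟩, rfl⟩
    · obtain rfl : u = 1 + (j - 5) * m := by linarith
      rw [collapseEnd_one_add_mul_of_lt hm (by linarith),
        collapseEnd_one_add_mul_of_le hm (by linarith)]
      refine ⟨_, periodic_region.shift (j - 5) (periodic_region.twist h12), ?_⟩
      rw [collapse_shift (by omega), collapse_twist (by omega), hc12]
      ext <;> simp only
      ring
  · rw [collapseEnd_one_add_mul_of_le hm h1, collapseEnd_one_add_mul_of_lt hm h2]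
    refine ⟨_, periodic_region.shift j h12, ?_⟩
    rw [collapse_shift (by omega), hc12]
    ext <;> simp only
    ring

/-- The collapses of the chords `(a, a')`, `(b, b')`, `(c, c')` pairwise cross, with their ends in
this cyclic order. -/
def CrossAfterCollapse (m p a a' b b' c c' : ℤ) : Prop :=
  collapseEnd m p a a' < collapseEnd m p b b' ∧ collapseEnd m p b b' < collapseEnd m p c c' ∧
  collapseEnd m p c c' < collapseEnd m p a' (a + 5 * m) ∧
  collapseEnd m p a' (a + 5 * m) < collapseEnd m p b' (b + 5 * m) ∧
  collapseEnd m p b' (b + 5 * m) < collapseEnd m p c' (c + 5 * m) ∧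
  collapseEnd m p c' (c + 5 * m) < collapseEnd m p (a + 5 * m) (a' + 5 * m)

namespace CrossAfterCollapse

variable {a a' b b' c c' : ℤ}

theorem rotate (hm : 0 < m) (h : CrossAfterCollapse m p a a' b b' c c') :
    CrossAfterCollapse m p b b' c c' a' (a + 5 * m) := by
  obtain ⟨h1, h2, h3, h4, h5, h6⟩ := h
  refine ⟨h2, h3, h4, h5, h6, ?_⟩
  rwa [collapseEnd_add_five hm, collapseEnd_add_five hm, add_lt_add_iff_right]

theorem shift (hm : 0 < m) (h : CrossAfterCollapse m p a a' b b' c c') (j : ℤ) :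
    CrossAfterCollapse m p (a + j * m) (a' + j * m) (b + j * m) (b' + j * m) (c + j * m)
      (c' + j * m) := by
  simpa only [CrossAfterCollapse, add_right_comm _ (j * m) (5 * m), collapseEnd_shift hm,
    add_lt_add_iff_right] using h

theorem bounds_of_one (hm : 3 ≤ m) (h : CrossAfterCollapse m p 1 a' 1 b' c c') :
    a' ≤ p ∧ p < b' ∧ 2 < c ∧ c ≤ a' ∧ b' ≤ c' ∧ c' < 5 * m := by
  obtain ⟨hab, hbc, hca, -, hbc', hca'⟩ := h
  obtain ⟨hap, hpb⟩ : a' ≤ p ∧ p < b' := by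
    obtain h | ⟨-, j, hj, h1, h2⟩ := lt_of_collapseEnd_lt hm hab
    · omega
    · rw [show j * m = 0 by linarith] at h1 h2
      omega
  refine ⟨hap, hpb, ?_, le_of_collapseEnd_lt hm hca, le_of_collapseEnd_lt hm hbc', ?_⟩
  · rw [collapseEnd_one_of_lt hm hpb, ← collapseEnd_two (p := p) hm 0] at hbc
    obtain h | ⟨-, j, hj, -⟩ := lt_of_collapseEnd_lt hm hbc
    · exact h
    · exact absurd (by linarith) (mul_ne_of_pos_of_lt (m := m) one_pos (by omega) j)
  · rw [collapseEnd_add_five (by omega), collapseEnd_one_of_le hm hap, zero_add,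
      ← collapseEnd_mul (p := p) hm 5 0] at hca'
    obtain h | ⟨rfl, j, hj, -⟩ := lt_of_collapseEnd_lt hm hca'
    · exact h
    · exact absurd (by linarith) (mul_ne_of_pos_of_lt (m := m) one_pos (by omega) (5 - j))

end CrossAfterCollapse

namespace Star

variable {a a' b b' c c' : ℤ}

theorem not_crossAfterCollapse_one_p (hm : 3 ≤ m) (hS : Star m E p q) (hE : TripleFree m E)
    (hqb : q ≤ b') (hbc' : b' ≤ c') : ¬ CrossAfterCollapse m p 1 p 1 b' p c' := by
  rintro ⟨-, -, hca, -, hbc, -⟩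
  have hpq := hS.lt
  have hq5 := hS.lt_five
  obtain h | ⟨-, t, ht, h1, h2⟩ := lt_of_collapseEnd_lt hm hca
  · omega
  have h3 := (hS.compatible hE (hE.twist hS.one_p)).one t ht
  have ht0 : 0 < t := by
    have := hS.two_lt
    by_contra! ht0
    nlinarith
  have hm_le : m ≤ t * m := by nlinarith
  have hq_ne : q ≠ 2 + t * m := fun he => by
    have h4 := (hS.compatible hE (hE.twist hS.one_q)).two t he
    exact mul_ne_of_pos_of_lt (m := m) (r := 1) (by omega) (by omega) (2 * t - 5 + 2 * (5 - 2 * t))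
      (by linarith [(by omega : 1 + 5 * m = 2 + t * m + t * m)])
  have hq_ne' : q ≠ p + t * m := fun he => by
    obtain h | ⟨-, j, h4, h5, -⟩ := lt_of_collapseEnd_lt hm hbc
    · omega
    · have : j * m = (2 * t) * m := by linarith
      have : q + t * m ≤ 1 + 5 * m := by omega
      have := mul_right_cancel₀ (b := m) (a := 3 * t) (c := 5) (by omega) (by linarith)
      omega
  exact hE.noTripleCrossing hS.two_q (hE.of_eq_shift (u' := t * m) t hS.zero_p (by ring) rfl)
    (hE.shift t hS.two_q) (by omega)

theorem not_crossAfterCollapse_one_q (hm : 3 ≤ m) (hS : Star m E p q) (hE : TripleFree m E)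
    (hc : (c, q) ∈ E) (hcp : c < p) : ¬ CrossAfterCollapse m p 1 a' 1 q c q := by
  rintro ⟨-, -, -, -, hbc, -⟩
  have hpq := hS.lt
  have hq5 := hS.lt_five
  obtain h | ⟨-, t, ht, h1, h2⟩ := lt_of_collapseEnd_lt hm hbc
  · omega
  have h3 := (hS.compatible hE (hE.twist hc)).one t ht
  have : 0 < t := by
    by_contra! ht0
    nlinarith
  have hq_ne : q ≠ p + 1 := fun he => by
    have h4 := (hS.compatible hE (hE.twist hS.one_p)).zero t (by omega)
    exact mul_ne_of_pos_of_lt (m := m) (r := 1) (by omega) (by omega) (2 * t - 5)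
      (by linarith [(by omega : 1 + 5 * m = p + t * m)])
  have hq_ne' : q + 1 ≠ 5 * m := fun he =>
    mul_ne_of_pos_of_lt (m := m) (r := 2) (by omega) (by omega) (5 - t) (by linarith)
  have hp : (p + t * m - 5 * m, t * m) ∈ E := hE.of_eq_twist (t - 5) hS.zero_p (by ring) (by ring)
  have hq : (q + t * m - 5 * m, 2 + t * m) ∈ E :=
    hE.of_eq_twist (t - 5) hS.two_q (by ring) (by ring)
  exact hE.noTripleCrossing hS.zero_p hp hq (by omega)

theorem not_crossAfterCollapse_one (hm : 3 ≤ m) (hS : Star m E p q) (hE : TripleFree m E)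
    (hb : (1, b') ∈ E) (hc : (c, c') ∈ E) : ¬ CrossAfterCollapse m p 1 a' 1 b' c c' := fun h => by
  obtain ⟨hap, hpb, h2c, hca, hbc, hc5⟩ := h.bounds_of_one hm
  have hpq := hS.lt
  have hqb : q ≤ b' := by
    have := (hS.compatible hE hb).one 0 (by ring)
    omega
  by_cases hcp : c = p
  · obtain rfl : a' = p := by omega
    subst hcp
    exact hS.not_crossAfterCollapse_one_p hm hE hqb hbc h
  by_cases hcq : c' = q
  · obtain rfl : b' = q := by omega
    subst hcq
    exact hS.not_crossAfterCollapse_one_q hm hE hc (by omega) h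
  exact hE.noTripleCrossing hS.zero_p hS.two_q hc (by omega)

theorem lt_of_crossAfterCollapse (hm : 3 ≤ m) (hS : Star m E p q) (hE : TripleFree m E)
    (hb : (b, b') ∈ E) (hc : (c, c') ∈ E)
    (h : CrossAfterCollapse m p a a' b b' c c') : a < b := by
  obtain hab | ⟨rfl, j, rfl, -⟩ := lt_of_collapseEnd_lt hm h.1
  · exact hab
  · have h' := h.shift (by omega) (-j)
    rw [show 1 + j * m + -j * m = 1 by ring] at h'
    exact (hS.not_crossAfterCollapse_one hm hE (hE.of_eq_shift (-j) hb (by ring) rfl)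
      (hE.shift (-j) hc) h').elim

theorem tripleFree_image_collapse (hm : 3 ≤ m) (hS : Star m E p q) (hE : TripleFree m E) :
    TripleFree (m - 1) (collapse m p '' E) := by
  refine ⟨hE.toPeriodic.image_collapse hm hS.two_lt (hS.lt.trans hS.lt_five), ?_⟩
  rintro _ _ _ _ _ _ ⟨⟨a, a'⟩, ha, rfl, rfl⟩ ⟨⟨b, b'⟩, hb, rfl, rfl⟩ ⟨⟨c, c'⟩, hc, rfl, rfl⟩
    ⟨h1, h2, h3, h4, h5, h6⟩
  have hm0 : 0 < m := by omega
  have hcross : CrossAfterCollapse m p a a' b b' c c' :=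
    ⟨h1, h2, h3, h4, h5, by rwa [collapseEnd_add_five hm0]⟩
  have hcross1 := hcross.rotate hm0
  have hcross2 := hcross1.rotate hm0
  have hcross3 := hcross2.rotate hm0
  have hcross4 := hcross3.rotate hm0
  have hcross5 := hcross4.rotate hm0
  have ha' := hE.twist ha
  have hb' := hE.twist hb
  have hc' := hE.twist hc
  exact hE.noTripleCrossing ha hb hc ⟨hS.lt_of_crossAfterCollapse hm hE hb hc hcross,
    hS.lt_of_crossAfterCollapse hm hE hc ha' hcross1,
    hS.lt_of_crossAfterCollapse hm hE ha' hb' hcross2,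
    hS.lt_of_crossAfterCollapse hm hE hb' hc' hcross3,
    hS.lt_of_crossAfterCollapse hm hE hc' (hE.twist ha') hcross4,
    hS.lt_of_crossAfterCollapse hm hE (hE.twist ha') (hE.twist hb') hcross5⟩

theorem maxTripleFree_image_collapse (hm : 3 ≤ m) (hS : Star m E p q) (hE : MaxTripleFree m E) :
    MaxTripleFree (m - 1) (collapse m p '' E) := by
  refine ⟨hS.tripleFree_image_collapse hm hE.tripleFree, fun T hT hET => ?_⟩
  have hsub : E ⊆ pullback m p q T := fun z hz =>
    ⟨hS.subset_region hE.tripleFree hz, hET ⟨z, hz, rfl⟩⟩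
  rintro ⟨x, y⟩ h
  obtain ⟨z, hz, hzx⟩ := exists_mem_region_collapse_eq hm hS.two_lt hS.lt (hT.lt h) (hT.lt_add h)
  exact ⟨z, hE.le_of_ge (hT.pullback hm) hsub ⟨hz, hzx ▸ h⟩, hzx⟩

end Star

end Collapse

section Core

variable {m p q : ℤ} {E : Set (ℤ × ℤ)}

theorem mem_orbit_of_lt {a b u v : ℤ} (ha : 0 ≤ a) (ham : a < m) (hu : 0 ≤ u) (hum : u < m) :
    (u, v) ∈ orbit m a b ↔ u = a ∧ v = b ∨ ∃ t, b = u + t * m ∧ v = a + (5 - t) * m := by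
  rw [mem_orbit]
  constructor
  · rintro ⟨j, ⟨hua, rfl⟩ | ⟨rfl, rfl⟩⟩
    · obtain ⟨rfl, rfl⟩ := add_mul_inj_of_lt (j := 0) (i := j) hu hum ha ham (by simpa using hua)
      exact Or.inl ⟨rfl, by ring⟩
    · exact Or.inr ⟨-j, by ring, by ring⟩
  · rintro (⟨rfl, rfl⟩ | ⟨t, rfl, rfl⟩)
    · exact ⟨0, Or.inl (by simp)⟩
    · exact ⟨-t, Or.inr ⟨by ring, by ring⟩⟩

theorem collapse_mem_orbit (hm : 0 < m) {a b u v : ℤ} (h : (u, v) ∈ orbit m a b) :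
    collapse m p (u, v) ∈ orbit (m - 1) (collapse m p (a, b)).1 (collapse m p (a, b)).2 := by
  obtain ⟨j, ⟨rfl, rfl⟩ | ⟨rfl, rfl⟩⟩ := mem_orbit.1 h
  · rw [collapse_shift hm]
    exact mem_orbit.2 ⟨j, Or.inl ⟨rfl, rfl⟩⟩
  · rw [collapse_shift hm, collapse_twist hm]
    exact mem_orbit.2 ⟨j, Or.inr ⟨rfl, rfl⟩⟩

theorem collapse_zero_one (hm : 3 ≤ m) (hp : 2 < p) (hp5 : p < 5 * m) :
    collapse m p (0, 1) = collapse m p (1, 2) := by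
  rw [collapse_one_two hm hp]
  exact Prod.ext (by simpa [collapse] using collapseEnd_mul (p := p) hm 0 1)
    (collapseEnd_one_of_lt hm (by simpa using hp5))

theorem collapse_zero_two (hm : 3 ≤ m) (hp : 2 < p) :
    collapse m p (0, 2) = collapse m p (1, 2) := by
  rw [collapse_one_two hm hp]
  exact Prod.ext (by simpa [collapse] using collapseEnd_mul (p := p) hm 0 2) (collapseEnd_two hm _)

theorem collapseEnd_succ_right {u x : ℤ} (h : ∀ t, u = 1 + t * m → x ≠ p + t * m) :
    collapseEnd m p u (x + 1) = collapseEnd m p u x := by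
  have : u % m = 1 → (p + u - 1 < x + 1 ↔ p + u - 1 < x) := fun hu => by
    obtain ⟨t, ht⟩ := exists_eq_add_mul_of_emod_eq hu
    have := h t ht
    omega
  simp only [collapseEnd, and_congr_right this]

theorem collapse_one_p (hm : 3 ≤ m) : collapse m p (1, p) = collapse m p (0, p) := by
  refine Prod.ext ?_ ?_
  · rw [collapse, collapse, collapseEnd_one_of_le hm le_rfl]
    simpa using (collapseEnd_mul (p := p) hm 0 p).symm
  · simp only [collapse, zero_add, add_comm 1 (5 * m)]
    exact collapseEnd_succ_right fun t ht h =>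
      mul_ne_of_pos_of_lt (m := m) one_pos (by omega) (5 - 2 * t) (by linarith)

/-- The chords of `E` outside the rotations of `(0, 1)`, `(0, 2)`, `(1, p)` and `(1, q)`. For a star
`0, p, 1, q, 2` of `E`, these are determined by their collapse. -/
def core (m p q : ℤ) (E : Set (ℤ × ℤ)) : Set (ℤ × ℤ) :=
  (((E \ orbit m 0 1) \ orbit m 0 2) \ orbit m 1 p) \ orbit m 1 q

theorem mem_core {z : ℤ × ℤ} : z ∈ core m p q E ↔
    z ∈ E ∧ z ∉ orbit m 0 1 ∧ z ∉ orbit m 0 2 ∧ z ∉ orbit m 1 p ∧ z ∉ orbit m 1 q := by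
  simp only [core, Set.mem_sdiff, and_assoc]

theorem core_subset : core m p q E ⊆ E := fun _ h => (mem_core.1 h).1

namespace Star

theorem periodic_core (hS : Star m E p q) (hE : TripleFree m E) : Periodic m (core m p q E) := by
  have := hS.two_lt
  have := hS.lt
  have := hS.lt_five
  exact (((hE.toPeriodic.diff (periodic_orbit (by omega) (by omega))).diff
    (periodic_orbit (by omega) (by omega))).diff (periodic_orbit (by omega) (by omega))).diff
    (periodic_orbit (by omega) (by omega))

theorem one_q_notMem_orbit_one_p (hm : 3 ≤ m) (hS : Star m E p q) (hE : TripleFree m E) :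
    (1, q) ∉ orbit m 1 p := fun h => by
  have h2p := hS.two_lt
  have hpq := hS.lt
  have hq5 := hS.lt_five
  obtain ⟨-, h⟩ | ⟨t, hp, hq⟩ :=
    (mem_orbit_of_lt (by omega) (by omega) (by omega) (by omega)).1 h
  · omega
  have ht0 : 0 < t := by
    by_contra! ht0
    nlinarith
  have ht2 : t ≤ 2 := by
    by_contra! ht2
    nlinarith
  have : m ≤ t * m := by nlinarith
  have : t * m ≤ 2 * m := by nlinarith
  have : q + t * m = 1 + 5 * m := by rw [hq]; ring
  exact hE.noTripleCrossing (hE.of_eq_shift (u' := t * m) t hS.zero_p (by ring) rfl)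
    (hE.of_eq_twist (u' := p) (v' := 5 * m) 0 hS.zero_p (by ring) (by ring))
    (hE.shift t hS.two_q) (by omega)

theorem not_zero_p_two_q (hm : 3 ≤ m) (hS : Star m E p q) (hE : TripleFree m E) {t : ℤ}
    (hp : p = 2 + t * m) : q ≠ (5 - t) * m := fun hq => by
  have h1 : (2, q + 1) ∈ E :=
    hE.of_eq_twist (-t) hS.one_p (by rw [hp]; ring) (by rw [hq]; ring)
  have h2 := (hS.compatible hE h1).two 0 (by ring)
  have h3 := hS.lt_five
  exact mul_ne_of_pos_of_lt (m := m) one_pos (by omega) t (by linarith [(by omega : q + 1 = 5 * m)])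

theorem collapse_one_q (hm : 3 ≤ m) (hS : Star m E p q) (hE : TripleFree m E) :
    collapse m p (1, q) = collapse m p (2, q) := by
  refine Prod.ext ?_ ?_
  · simp only [collapse, collapseEnd_one_of_lt hm hS.lt, collapseEnd_two hm]
  · simp only [collapse, show 2 + 5 * m = 1 + 5 * m + 1 by ring]
    refine (collapseEnd_succ_right fun t hq hp => hS.one_q_notMem_orbit_one_p hm hE ?_).symm
    exact mem_orbit.2 ⟨t - 5, Or.inr ⟨by linarith, by linarith⟩⟩

theorem one_two_mem_core (hm : 3 ≤ m) (hS : Star m E p q) (hE : shortChords m ⊆ E) :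
    (1, 2) ∈ core m p q E := by
  have h2p := hS.two_lt
  have hpq := hS.lt
  have n1 := mul_ne_of_pos_of_lt (m := m) one_pos (by omega)
  refine mem_core.2 ⟨hE (by rw [mem_shortChords]; omega), ?_, ?_, ?_, ?_⟩ <;>
    rw [mem_orbit_of_lt (by omega) (by omega) (by omega) (by omega)] <;>
    rintro (⟨h, h'⟩ | ⟨t, h, h'⟩)
  · omega
  · exact mul_ne_of_pos_of_lt (m := m) two_pos (by omega) (5 - t) (by linarith)
  · omega
  · exact n1 t (by linarith)
  · omega
  · exact n1 (5 - t) (by linarith)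
  · omega
  · exact n1 (5 - t) (by linarith)

theorem zero_p_mem_core (hm : 3 ≤ m) (hS : Star m E p q) (h : (0, p) ∉ orbit m 1 q) :
    (0, p) ∈ core m p q E := by
  have h2p := hS.two_lt
  have n1 := mul_ne_of_pos_of_lt (m := m) one_pos (by omega)
  refine mem_core.2 ⟨hS.zero_p, ?_, ?_, ?_, h⟩ <;>
    rw [mem_orbit_of_lt (by omega) (by omega) (by omega) (by omega)] <;>
    rintro (⟨h1, h2⟩ | ⟨t, h1, h2⟩)
  · omega
  · exact n1 t (by linarith)
  · omega
  · exact mul_ne_of_pos_of_lt (m := m) two_pos (by omega) t (by linarith)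
  · omega
  · exact n1 (2 * t - 5) (by linarith)

theorem two_q_mem_core (hm : 3 ≤ m) (hS : Star m E p q) (h : (2, q) ∉ orbit m 1 p) :
    (2, q) ∈ core m p q E := by
  have hq5 := hS.lt_five
  have n1 := mul_ne_of_pos_of_lt (m := m) one_pos (by omega)
  refine mem_core.2 ⟨hS.two_q, ?_, ?_, h, ?_⟩ <;>
    rw [mem_orbit_of_lt (by omega) (by omega) (by omega) (by omega)] <;>
    rintro (⟨h1, -⟩ | ⟨t, h1, h2⟩)
  · omega
  · exact n1 (-1 - t) (by linarith)
  · omega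
  · have : t * m = 0 := by linarith
    linarith
  · omega
  · exact n1 (5 - 2 * t) (by linarith)

theorem zero_p_mem_core_or_two_q_mem_core (hm : 3 ≤ m) (hS : Star m E p q) :
    (0, p) ∈ core m p q E ∨ (2, q) ∈ core m p q E := by
  have := hS.two_lt
  by_cases h : (0, p) ∈ orbit m 1 q
  · refine Or.inr (hS.two_q_mem_core hm fun h' => ?_)
    obtain ⟨h, -⟩ | ⟨s, hq, -⟩ :=
      (mem_orbit_of_lt (by omega) (by omega) (by omega) (by omega)).1 h
    · omega
    obtain ⟨h', -⟩ | ⟨t, -, hq'⟩ :=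
      (mem_orbit_of_lt (by omega) (by omega) (by omega) (by omega)).1 h'
    · omega
    exact mul_ne_of_pos_of_lt (m := m) one_pos (by omega) (s - (5 - t)) (by linarith)
  · exact Or.inl (hS.zero_p_mem_core hm h)

theorem exists_mem_core_of_zero_p (hm : 3 ≤ m) (hS : Star m E p q) (hE : TripleFree m E) :
    ∃ w ∈ core m p q E, (w = (0, p) ∨ w = (2, q)) ∧
      collapse m p (0, p) ∈ orbit (m - 1) (collapse m p w).1 (collapse m p w).2 := by
  by_cases h : (0, p) ∈ orbit m 1 q
  · have h' := collapse_mem_orbit (p := p) (by omega) h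
    rw [hS.collapse_one_q hm hE] at h'
    refine ⟨(2, q), (hS.zero_p_mem_core_or_two_q_mem_core hm).resolve_left fun hc => ?_,
      Or.inr rfl, h'⟩
    exact (mem_core.1 hc).2.2.2.2 h
  · exact ⟨(0, p), hS.zero_p_mem_core hm h, Or.inl rfl, self_mem_orbit⟩

theorem exists_mem_core_of_two_q (hm : 3 ≤ m) (hS : Star m E p q) :
    ∃ w ∈ core m p q E, (w = (0, p) ∨ w = (2, q)) ∧
      collapse m p (2, q) ∈ orbit (m - 1) (collapse m p w).1 (collapse m p w).2 := by
  by_cases h : (2, q) ∈ orbit m 1 p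
  · have h' := collapse_mem_orbit (p := p) (by omega) h
    rw [collapse_one_p hm] at h'
    refine ⟨(0, p), (hS.zero_p_mem_core_or_two_q_mem_core hm).resolve_right fun hc => ?_,
      Or.inl rfl, h'⟩
    exact (mem_core.1 hc).2.2.2.1 h
  · exact ⟨(2, q), hS.two_q_mem_core hm h, Or.inr rfl, self_mem_orbit⟩

theorem exists_mem_core (hm : 3 ≤ m) (hS : Star m E p q) (hE : TripleFree m E)
    (hsc : shortChords m ⊆ E) {z : ℤ × ℤ} (hz : z ∈ E) (hzc : z ∉ core m p q E) :
    ∃ w ∈ core m p q E, (w ∈ shortChords m ∨ w = (0, p) ∨ w = (2, q)) ∧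
      collapse m p z ∈ orbit (m - 1) (collapse m p w).1 (collapse m p w).2 := by
  have hm0 : 0 < m := by omega
  have h12 : ((1, 2) : ℤ × ℤ) ∈ shortChords m := by rw [mem_shortChords]; omega
  have h12c := hS.one_two_mem_core hm hsc
  have hz' : z ∈ orbit m 0 1 ∨ z ∈ orbit m 0 2 ∨ z ∈ orbit m 1 p ∨ z ∈ orbit m 1 q := by
    by_contra! h
    exact hzc (mem_core.2 ⟨hz, h⟩)
  obtain ⟨u, v⟩ := z
  rcases hz' with h | h | h | h <;> have h' := collapse_mem_orbit (p := p) hm0 h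
  · rw [collapse_zero_one hm hS.two_lt (hS.lt.trans hS.lt_five)] at h'
    exact ⟨_, h12c, Or.inl h12, h'⟩
  · rw [collapse_zero_two hm hS.two_lt] at h'
    exact ⟨_, h12c, Or.inl h12, h'⟩
  · rw [collapse_one_p hm] at h'
    obtain ⟨w, hw, hw', hpw⟩ := hS.exists_mem_core_of_zero_p hm hE
    exact ⟨w, hw, Or.inr hw', mem_orbit_trans h' hpw⟩
  · rw [hS.collapse_one_q hm hE] at h'
    obtain ⟨w, hw, hw', hqw⟩ := hS.exists_mem_core_of_two_q hm
    exact ⟨w, hw, Or.inr hw', mem_orbit_trans h' hqw⟩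

theorem image_collapse_core (hm : 3 ≤ m) (hS : Star m E p q) (hE : TripleFree m E)
    (hsc : shortChords m ⊆ E) : collapse m p '' core m p q E = collapse m p '' E := by
  refine Set.Subset.antisymm (Set.image_mono core_subset) ?_
  rintro _ ⟨z, hz, rfl⟩
  by_cases hc : z ∈ core m p q E
  · exact ⟨z, hc, rfl⟩
  obtain ⟨w, hw, -, h⟩ := hS.exists_mem_core hm hE hsc hz hc
  exact ((hS.periodic_core hE).image_collapse hm hS.two_lt (hS.lt.trans hS.lt_five)).orbit_subset
    ⟨w, hw, rfl⟩ h

theorem collapse_zero_ne_collapse_one (hm : 3 ≤ m) (hS : Star m E p q) (hE : TripleFree m E)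
    {v x : ℤ} (h0v : (0, v) ∈ core m p q E) (h1x : (1, x) ∈ core m p q E) :
    collapse m p (0, v) ≠ collapse m p (1, x) := fun h => by
  obtain ⟨hv, hv1, hv2, -, -⟩ := mem_core.1 h0v
  obtain ⟨hx, -, -, hxp, hxq⟩ := mem_core.1 h1x
  obtain ⟨hfst, hsnd⟩ := Prod.mk.inj h
  simp only [zero_add] at hfst hsnd
  have h2p := hS.two_lt
  have hpq := hS.lt
  have hq5 := hS.lt_five
  have hpv : p ≤ v := by
    obtain h | h := (hS.compatible hE hv).zero 0 (by ring)
    · have := hE.lt hv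
      obtain rfl | rfl : v = 1 ∨ v = 2 := by omega
      exacts [(hv1 self_mem_orbit).elim, (hv2 self_mem_orbit).elim]
    · omega
  have hlt : x < p := by
    have hne : x ≠ p := fun h => hxp (h ▸ self_mem_orbit)
    by_contra! hlt
    rw [collapseEnd_one_of_lt hm (by omega), ← zero_mul m, collapseEnd_mul hm] at hfst
    omega
  have hxv := hS.compatible hE (hE.twist hx)
  obtain ⟨rfl, ⟨t, rfl, h5⟩ | ⟨t, rfl, h5⟩⟩ := succ_of_collapseEnd_eq hm hsnd.symm (by omega)
  · have h5' := hxv.zero t rfl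
    have hmul := mul_ne_of_pos_of_lt (m := m) one_pos (by omega) (5 - 2 * t)
    have : (5 - 2 * t) * m = 0 := by
      rw [sub_mul, mul_assoc] at hmul ⊢
      omega
    obtain h | h := mul_eq_zero.1 this <;> omega
  · obtain rfl : 1 + t * m + 1 = p := by omega
    have h5' := hxv.one t rfl
    have h5'' := (hS.compatible hE (hE.twist hv)).two t (by ring)
    obtain h | h : q + t * m = 5 * m ∨ q + t * m = 1 + 5 * m := by omega
    · exact hS.not_zero_p_two_q hm hE (t := t) (by ring) (by linarith)
    · exact hxq (mem_orbit.2 ⟨t - 5, Or.inr ⟨by linarith, by linarith⟩⟩)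

theorem lt_of_collapseEnd_one_eq_collapseEnd_two (hm : 3 ≤ m) (hS : Star m E p q)
    (hE : TripleFree m E) {v x : ℤ} (h1v : (1, v) ∈ core m p q E)
    (h : collapseEnd m p 1 v = collapseEnd m p 2 x) : q < v := by
  obtain ⟨hv, -, -, -, hvq⟩ := mem_core.1 h1v
  have hne : v ≠ q := fun hvq' => hvq (hvq' ▸ self_mem_orbit)
  have hcases := (hS.compatible hE hv).one 0 (by ring)
  have hpv : p < v := by
    by_contra! hvp
    rw [collapseEnd_one_of_le hm hvp, collapseEnd_two hm] at h
    omega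
  omega

theorem collapse_one_ne_collapse_two (hm : 3 ≤ m) (hS : Star m E p q) (hE : TripleFree m E)
    {v x : ℤ} (h1v : (1, v) ∈ core m p q E) (h2x : (2, x) ∈ core m p q E) :
    collapse m p (1, v) ≠ collapse m p (2, x) := fun h => by
  obtain ⟨hv, hv1, -, hvp, -⟩ := mem_core.1 h1v
  obtain ⟨hx, -, hx2, -, -⟩ := mem_core.1 h2x
  obtain ⟨hfst, hsnd⟩ := Prod.mk.inj h
  simp only at hfst hsnd
  have h2p := hS.two_lt
  have hpq := hS.lt
  have hv5 := hE.lt_add hv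
  have hx5 := hE.lt_add hx
  have hqv := hS.lt_of_collapseEnd_one_eq_collapseEnd_two hm hE h1v hfst
  have hxq : x ≤ q := by
    obtain h | h := (hS.compatible hE hx).two 0 (by ring)
    · omega
    obtain rfl | rfl : x = 5 * m ∨ x = 1 + 5 * m := by omega
    · exact (hx2 (mem_orbit.2 ⟨0, Or.inr ⟨by ring, by ring⟩⟩)).elim
    · obtain rfl | hlt : v = 5 * m ∨ v + 2 ≤ 1 + 5 * m := by omega
      · exact (hv1 (mem_orbit.2 ⟨0, Or.inr ⟨by ring, by ring⟩⟩)).elim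
      · have := collapseEnd_lt_of_add_two_le (p := p) hm hlt (1 + 5 * m) (2 + 5 * m)
        omega
  have hxv := hS.compatible hE (hE.twist hx)
  obtain ⟨rfl, ⟨t, rfl, h5⟩ | ⟨t, rfl, h5⟩⟩ := succ_of_collapseEnd_eq hm hsnd.symm (by omega)
  · obtain rfl : t * m = q := by omega
    have h5' := hxv.zero t rfl
    obtain h | h : p + t * m = 1 + 5 * m ∨ p + t * m = 2 + 5 * m := by omega
    · exact hvp (mem_orbit.2 ⟨t - 5, Or.inr ⟨by linarith, by linarith⟩⟩)
    · exact hS.not_zero_p_two_q hm hE (t := 5 - t) (by linarith) (by ring)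
  · obtain rfl : 1 + t * m = q := by omega
    have h5' := hxv.one t rfl
    have h5'' := (hS.compatible hE (hE.twist hv)).two t (by ring)
    have hmul := mul_ne_of_pos_of_lt (m := m) one_pos (by omega) (2 * t - 5)
    have hmul' : (2 * t - 5) * m = 0 := by
      rw [sub_mul, mul_assoc] at hmul ⊢
      omega
    obtain h | h := mul_eq_zero.1 hmul' <;> omega

theorem not_lt_of_collapse_eq (hm : 3 ≤ m) (hS : Star m E p q) (hE : TripleFree m E)
    {u v w x : ℤ} (huv : (u, v) ∈ core m p q E) (hwx : (w, x) ∈ core m p q E)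
    (h : collapse m p (u, v) = collapse m p (w, x)) : ¬ u < w := fun huw => by
  have hC := hS.periodic_core hE
  have hshift (j : ℤ) :
      collapse m p (u + j * m, v + j * m) = collapse m p (w + j * m, x + j * m) := by
    rw [collapse_shift (by omega), collapse_shift (by omega), h]
  obtain ⟨rfl, ⟨j, rfl, -⟩ | ⟨j, rfl, -⟩⟩ := succ_of_collapseEnd_eq hm (Prod.mk.inj h).1 huw
  · refine hS.collapse_zero_ne_collapse_one hm hE (hC.of_eq_shift (-j) huv (by ring) rfl)
      (hC.of_eq_shift (-j) hwx (by ring) rfl) ?_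
    convert hshift (-j) using 3 <;> ring
  · refine hS.collapse_one_ne_collapse_two hm hE (hC.of_eq_shift (-j) huv (by ring) rfl)
      (hC.of_eq_shift (-j) hwx (by ring) rfl) ?_
    convert hshift (-j) using 3 <;> ring

theorem injOn_collapse_core (hm : 3 ≤ m) (hS : Star m E p q) (hE : TripleFree m E) :
    Set.InjOn (collapse m p) (core m p q E) := by
  have hm0 : 0 < m := by omega
  have hC := hS.periodic_core hE
  have hfst {u v w x} (huv : (u, v) ∈ core m p q E) (hwx : (w, x) ∈ core m p q E)
      (h : collapse m p (u, v) = collapse m p (w, x)) : u = w :=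
    le_antisymm (not_lt.1 (hS.not_lt_of_collapse_eq hm hE hwx huv h.symm))
      (not_lt.1 (hS.not_lt_of_collapse_eq hm hE huv hwx h))
  rintro ⟨u, v⟩ huv ⟨w, x⟩ hwx h
  exact Prod.ext (hfst huv hwx h) (hfst (hC.twist huv) (hC.twist hwx)
    (by rw [collapse_twist hm0, collapse_twist hm0, h]))

theorem chordCount_core (hm : 3 ≤ m) (hS : Star m E p q) (hE : TripleFree m E)
    (hsc : shortChords m ⊆ E) : chordCount m E = chordCount m (core m p q E) + 8 := by
  have h2p := hS.two_lt
  have hpq := hS.lt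
  have hq5 := hS.lt_five
  have n1 := mul_ne_of_pos_of_lt (m := m) one_pos (by omega)
  have hP1 := hE.toPeriodic.diff (periodic_orbit (a := 0) (b := 1) (by omega) (by omega))
  have hP2 := hP1.diff (periodic_orbit (a := 0) (b := 2) (by omega) (by omega))
  have hP3 := hP2.diff (periodic_orbit (a := 1) (b := p) (by omega) (by omega))
  have h02 : (0, 2) ∉ orbit m 0 1 := by
    rw [mem_orbit_of_lt (by omega) (by omega) (by omega) (by omega)]
    rintro (⟨-, h⟩ | ⟨t, h, -⟩)
    · omega
    · exact n1 t (by linarith)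
  have h01 {x : ℤ} (hx : x < 5 * m) : (1, x) ∉ orbit m 0 1 := by
    rw [mem_orbit_of_lt (by omega) (by omega) (by omega) (by omega)]
    rintro (⟨h, -⟩ | ⟨t, h, h'⟩)
    · omega
    · rw [sub_mul] at h'
      omega
  have h12 {x : ℤ} : (1, x) ∉ orbit m 0 2 := by
    rw [mem_orbit_of_lt (by omega) (by omega) (by omega) (by omega)]
    rintro (⟨h, -⟩ | ⟨t, h, -⟩)
    · omega
    · exact n1 t (by linarith)
  have hc1 := chordCount_eq_diff_orbit_add_two hE.toPeriodic (a := 0) (b := 1)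
    (hsc (by rw [mem_shortChords]; omega))
  have hc2 := chordCount_eq_diff_orbit_add_two hP1 (a := 0) (b := 2)
    ⟨hsc (by rw [mem_shortChords]; omega), h02⟩
  have hc3 := chordCount_eq_diff_orbit_add_two hP2 ⟨⟨hS.one_p, h01 (by omega)⟩, h12⟩
  have hc4 := chordCount_eq_diff_orbit_add_two hP3
    ⟨⟨⟨hS.one_q, h01 (by omega)⟩, h12⟩, hS.one_q_notMem_orbit_one_p hm hE⟩
  rw [core]
  omega

theorem chordCount_eq (hm : 3 ≤ m) (hS : Star m E p q) (hE : TripleFree m E)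
    (hsc : shortChords m ⊆ E) : chordCount m E = chordCount (m - 1) (collapse m p '' E) + 8 := by
  have hC := hS.periodic_core hE
  have hcol := chordCount_eq_of_bijOn (by omega) (by omega : 0 < m - 1) hC
    (hC.image_collapse hm hS.two_lt (hS.lt.trans hS.lt_five)) (collapse m p)
    (collapse_shift (by omega)) (hS.injOn_collapse_core hm hE).bijOn_image
  rw [hS.chordCount_core hm hE hsc, hcol, hS.image_collapse_core hm hE hsc]

end Star

end Core

section Exchange

variable {m p q a b : ℤ} {E F T : Set (ℤ × ℤ)} {z w : ℤ × ℤ}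

/-- The rotations of the chords `(0, p)`, `(1, p)`, `(1, q)` and `(2, q)` of a star. -/
def starChords (m p q : ℤ) : Set (ℤ × ℤ) :=
  orbit m 0 p ∪ orbit m 1 p ∪ orbit m 1 q ∪ orbit m 2 q

theorem notMem_starChords : z ∉ starChords m p q ↔
    z ∉ orbit m 0 p ∧ z ∉ orbit m 1 p ∧ z ∉ orbit m 1 q ∧ z ∉ orbit m 2 q := by
  simp only [starChords, Set.mem_union, not_or, and_assoc]

theorem mem_shortChords_congr (h : z ∈ orbit m w.1 w.2) :
    z ∈ shortChords m ↔ w ∈ shortChords m :=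
  ⟨fun hz => periodic_shortChords.orbit_subset hz (mem_orbit_comm h),
    fun hw => periodic_shortChords.orbit_subset hw h⟩

theorem shortChords_subset_diff_orbit (hsc : shortChords m ⊆ E) (hab : (a, b) ∉ shortChords m) :
    shortChords m ⊆ E \ orbit m a b :=
  fun _ hz => ⟨hsc hz, fun h => hab ((mem_shortChords_congr (w := (a, b)) h).1 hz)⟩

theorem collapseEnd_of_two_le_of_le (hm : 3 ≤ m) {s : ℤ} (hs : 2 ≤ s) (hsm : s ≤ m) (x : ℤ) :
    collapseEnd m p s x = s - 1 := by
  rcases hsm.lt_or_eq with hlt | rfl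
  · exact collapseEnd_of_two_le hs hlt x
  · simpa using collapseEnd_mul (p := p) hm 1 x

theorem exists_mem_shortChords_collapse_eq_of_lt (hm : 3 ≤ m) (hp : 2 < p) (hp5 : p < 5 * m - 1)
    {x y : ℤ} (hx : 0 ≤ x) (hxm : x < m - 1) (hxy : x < y) (hyx : y ≤ x + 2) :
    (x, y) ∈ collapse m p '' shortChords m := by
  have hend {s : ℤ} (hs : 2 ≤ s + 1) (hsm : s + 1 ≤ m) (x : ℤ) :
      collapseEnd m p (s + 1) x = s := by
    rw [collapseEnd_of_two_le_of_le hm hs hsm, add_sub_cancel_right]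
  rcases hx.eq_or_lt with rfl | hx0
  · exact ⟨(1, y + 1), by rw [mem_shortChords]; omega,
      Prod.ext (collapseEnd_one_of_le hm (by simp only; omega)) (hend (by omega) (by omega) _)⟩
  refine ⟨(x + 1, y + 1), by rw [mem_shortChords]; omega,
    Prod.ext (hend (by omega) (by omega) _) ?_⟩
  obtain hy | rfl : y + 1 ≤ m ∨ y = m := by omega
  · exact hend (by omega) hy _
  · have := collapseEnd_one_add_mul_of_lt (p := p) (j := 1) (x := x + 1 + 5 * y) hm (by omega)
    simp only [collapse, add_comm y 1, one_mul] at this ⊢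
    linarith

theorem shortChords_subset_image_collapse (hm : 3 ≤ m) (hp : 2 < p) (hp5 : p < 5 * m - 1) :
    shortChords (m - 1) ⊆ collapse m p '' shortChords m := by
  have hP : Periodic (m - 1) (collapse m p '' shortChords m) :=
    periodic_shortChords.image_collapse hm hp (by omega)
  have hle {x y : ℤ} (hxy : x < y) (hyx : y ≤ x + 2) : (x, y) ∈ collapse m p '' shortChords m := by
    obtain ⟨j, hj⟩ := exists_eq_add_mul_of_emod_eq (u := x) (m := m - 1) rfl
    have h0 := Int.emod_nonneg x (by omega : m - 1 ≠ 0)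
    have h1 := Int.emod_lt_of_pos x (by omega : 0 < m - 1)
    exact hP.of_eq_shift (u := x % (m - 1)) (v := y - j * (m - 1)) j
      (exists_mem_shortChords_collapse_eq_of_lt hm hp hp5 h0 h1 (by omega) (by omega)) hj (by ring)
  rintro ⟨x, y⟩ h
  obtain ⟨hxy, hyx, hlen | hlen⟩ := mem_shortChords.1 h
  · exact hle hxy hlen
  · exact hP.untwist (hle hyx hlen)

/-- The chord `(a, b)` of `E` can be exchanged in exactly one way: apart from `E`, a single maximal
triple-free set contains the chords of `E` that are not rotations of `(a, b)`. -/
def HasFlip (m : ℤ) (E : Set (ℤ × ℤ)) (a b : ℤ) : Prop :=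
  ∃! G, MaxTripleFree m G ∧ E \ orbit m a b ⊆ G ∧ G ≠ E

/-- All the chords that are not in every maximal triple-free set have flips; the statement to be
proved by induction on `m`. -/
def HasFlips (m : ℤ) : Prop :=
  ∀ ⦃E : Set (ℤ × ℤ)⦄, MaxTripleFree m E → ∀ ⦃a b : ℤ⦄, (a, b) ∈ E → (a, b) ∉ shortChords m →
    HasFlip m E a b

theorem diff_orbit_subset_image_collapse (hm : 0 < m) {G : Set (ℤ × ℤ)}
    (hG : E \ orbit m a b ⊆ G) :
    collapse m p '' E \ orbit (m - 1) (collapse m p (a, b)).1 (collapse m p (a, b)).2 ⊆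
      collapse m p '' G := by
  rintro _ ⟨⟨⟨u, v⟩, hz, rfl⟩, hzo⟩
  exact ⟨_, hG ⟨hz, fun h => hzo (collapse_mem_orbit hm h)⟩, rfl⟩

namespace Star

theorem of_diff_orbit_subset (hS : Star m E p q) (hab : (a, b) ∉ starChords m p q)
    (hF : E \ orbit m a b ⊆ F) : Star m F p q := by
  obtain ⟨h0p, h1p, h1q, h2q⟩ := notMem_starChords.1 hab
  exact ⟨hS.two_lt, hS.lt, hS.lt_five, hF ⟨hS.zero_p, mt mem_orbit_comm h0p⟩,
    hF ⟨hS.one_p, mt mem_orbit_comm h1p⟩, hF ⟨hS.one_q, mt mem_orbit_comm h1q⟩,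
    hF ⟨hS.two_q, mt mem_orbit_comm h2q⟩⟩

theorem mem_core_of_notMem (hm : 3 ≤ m) (hz : z ∈ E) (hzs : z ∉ shortChords m)
    (hzS : z ∉ starChords m p q) : z ∈ core m p q E := by
  obtain ⟨-, h1p, h1q, -⟩ := notMem_starChords.1 hzS
  have hshort {c : ℤ} (hc : 0 < c) (hc2 : c ≤ 2) : z ∉ orbit m 0 c := fun h =>
    hzs ((mem_shortChords_congr (w := (0, c)) h).2 (by rw [mem_shortChords]; omega))
  exact mem_core.2 ⟨hz, hshort one_pos one_le_two, hshort two_pos le_rfl, h1p, h1q⟩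

theorem mem_orbit_of_mem_core (hm : 3 ≤ m) (hS : Star m E p q) (hE : TripleFree m E)
    (hz : z ∈ core m p q E) (hw : w ∈ core m p q E)
    (h : collapse m p z ∈ orbit (m - 1) (collapse m p w).1 (collapse m p w).2) :
    z ∈ orbit m w.1 w.2 := by
  have hm0 : 0 < m := by omega
  have hC := hS.periodic_core hE
  obtain ⟨j, h | h⟩ := h
  · rw [← collapse_shift hm0] at h
    exact ⟨j, Or.inl (hS.injOn_collapse_core hm hE hz (hC.shift j hw) h)⟩
  · have e := collapse_shift (p := p) hm0 j w.2 (w.1 + 5 * m)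
    rw [collapse_twist hm0] at e
    rw [← e] at h
    exact ⟨j, Or.inr (hS.injOn_collapse_core hm hE hz (hC.shift j (hC.twist hw)) h)⟩

theorem mem_orbit_of_collapse_mem_orbit (hm : 3 ≤ m) (hS : Star m E p q) (hE : TripleFree m E)
    (hsc : shortChords m ⊆ E) (hz : z ∈ E) (hzs : z ∉ shortChords m)
    (hzS : z ∉ starChords m p q) (hw : w ∈ E)
    (h : collapse m p w ∈ orbit (m - 1) (collapse m p z).1 (collapse m p z).2) :
    w ∈ orbit m z.1 z.2 := by
  have hzc := mem_core_of_notMem hm hz hzs hzS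
  by_cases hwc : w ∈ core m p q E
  · exact hS.mem_orbit_of_mem_core hm hE hwc hzc h
  obtain ⟨x, hx, hx', hwx⟩ := hS.exists_mem_core hm hE hsc hw hwc
  have hzx := hS.mem_orbit_of_mem_core hm hE hzc hx (mem_orbit_trans (mem_orbit_comm h) hwx)
  obtain ⟨h0p, -, -, h2q⟩ := notMem_starChords.1 hzS
  rcases hx' with hx' | rfl | rfl
  · exact absurd ((mem_shortChords_congr hzx).2 hx') hzs
  · exact absurd hzx h0p
  · exact absurd hzx h2q

theorem collapse_notMem_shortChords (hm : 3 ≤ m) (hS : Star m E p q) (hE : TripleFree m E)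
    (hsc : shortChords m ⊆ E) (hz : z ∈ E) (hzs : z ∉ shortChords m)
    (hzS : z ∉ starChords m p q) : collapse m p z ∉ shortChords (m - 1) := fun h => by
  have hpq := hS.lt
  have hq5 := hS.lt_five
  obtain ⟨w, hw, hwz⟩ := shortChords_subset_image_collapse hm hS.two_lt (by omega) h
  exact hzs ((mem_shortChords_congr (hS.mem_orbit_of_collapse_mem_orbit hm hE hsc hz hzs hzS
    (hsc hw) (hwz ▸ self_mem_orbit))).1 hw)

theorem subset_pullback (hS : Star m E p q) (hE : TripleFree m E) :
    E ⊆ pullback m p q (collapse m p '' E) :=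
  fun z hz => ⟨hS.subset_region hE hz, z, hz, rfl⟩

theorem eq_pullback (hm : 3 ≤ m) (hS : Star m E p q) (hE : MaxTripleFree m E) :
    pullback m p q (collapse m p '' E) = E :=
  (hE.eq_of_subset ((hS.tripleFree_image_collapse hm hE.tripleFree).pullback hm)
    (hS.subset_pullback hE.tripleFree)).symm

theorem diff_orbit_subset_pullback (hm : 3 ≤ m) (hS : Star m E p q) (hE : MaxTripleFree m E)
    (hab : (a, b) ∈ E) (habs : (a, b) ∉ shortChords m) (habS : (a, b) ∉ starChords m p q)
    (hT : collapse m p '' E \ orbit (m - 1) (collapse m p (a, b)).1 (collapse m p (a, b)).2 ⊆ T) :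
    E \ orbit m a b ⊆ pullback m p q T := fun z ⟨hz, hzo⟩ =>
  ⟨hS.subset_region hE.tripleFree hz, hT ⟨⟨z, hz, rfl⟩, fun h =>
    hzo (hS.mem_orbit_of_collapse_mem_orbit hm hE.tripleFree hE.shortChords_subset hab habs habS
      hz h)⟩⟩

theorem hasFlip_of_notMem_starChords (hm : 3 ≤ m) (ih : HasFlips (m - 1)) (hS : Star m E p q)
    (hE : MaxTripleFree m E) (hab : (a, b) ∈ E) (habs : (a, b) ∉ shortChords m)
    (habS : (a, b) ∉ starChords m p q) : HasFlip m E a b := by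
  obtain ⟨T, ⟨hT, hsub, hne⟩, huniq⟩ := ih (hS.maxTripleFree_image_collapse hm hE) ⟨_, hab, rfl⟩
    (hS.collapse_notMem_shortChords hm hE.tripleFree hE.shortChords_subset hab habs habS)
  have hFT := hS.diff_orbit_subset_pullback hm hE hab habs habS hsub
  have hpullback : ∀ {G}, MaxTripleFree m G → E \ orbit m a b ⊆ G → G ≠ E →
      pullback m p q T = G := fun {G} hG hFG hGE => by
    have hSG := hS.of_diff_orbit_subset habS hFG
    have hGT : collapse m p '' G = T := huniq _ ⟨hSG.maxTripleFree_image_collapse hm hG,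
      diff_orbit_subset_image_collapse (by omega) hFG, fun h =>
        hGE (by rw [← hSG.eq_pullback hm hG, h, hS.eq_pullback hm hE])⟩
    rw [← hGT, hSG.eq_pullback hm hG]
  obtain ⟨G, hTG, hG⟩ := (hT.tripleFree.pullback (p := p) (q := q) hm).exists_maxTripleFree
  have hGE : G ≠ E := by
    rintro rfl
    refine hne (hT.eq_of_subset (hS.tripleFree_image_collapse hm hG.tripleFree) ?_)
    rintro ⟨x, y⟩ h
    obtain ⟨z, hz, hzx⟩ := exists_mem_region_collapse_eq hm hS.two_lt hS.lt (hT.periodic.lt h)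
      (hT.periodic.lt_add h)
    exact ⟨z, hTG ⟨hz, hzx ▸ h⟩, hzx⟩
  exact ⟨G, ⟨hG, hFT.trans hTG, hGE⟩, fun G' ⟨hG', hFG', hGE'⟩ =>
    (hpullback hG' hFG' hGE').symm.trans (hpullback hG (hFT.trans hTG) hGE)⟩

end Star

end Exchange

section StarExchange

variable {m p q a b c d : ℤ} {E : Set (ℤ × ℤ)}

/-- A triple-free set contains all chords of `E` that are not rotations of `(a, b)`, and a chord
that is not in `E`; the existence part of `HasFlip`. -/
def IsExchangeable (m : ℤ) (E : Set (ℤ × ℤ)) (a b : ℤ) : Prop :=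
  ∃ G, TripleFree m G ∧ E \ orbit m a b ⊆ G ∧ ¬ G ⊆ E

theorem IsExchangeable.of_mem_orbit (hab : (a, b) ∈ orbit m c d) (h : IsExchangeable m E c d) :
    IsExchangeable m E a b := by
  rwa [IsExchangeable, orbit_eq_of_mem hab]

/-- The reflection of the `5 * m`-gon that fixes the vertex `1`. It exchanges the roles of the two
ends of a star. -/
def mirror (E : Set (ℤ × ℤ)) : Set (ℤ × ℤ) := {z | (2 - z.2, 2 - z.1) ∈ E}

theorem mem_mirror {u v : ℤ} : (u, v) ∈ mirror E ↔ (2 - v, 2 - u) ∈ E := Iff.rfl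

theorem TripleFree.mirror (hE : TripleFree m E) : TripleFree m (HalfCylinder.mirror E) where
  shift j _ _ h := hE.of_eq_shift (-j) h (by ring) (by ring)
  twist h := hE.of_eq_twist (-5) h (by ring) (by ring)
  lt h := by have := hE.lt h; omega
  lt_add h := by have := hE.lt_add h; omega
  noTripleCrossing _ _ _ _ _ _ ha hb hc h := hE.noTripleCrossing hc hb ha (by omega)

theorem mem_orbit_mirror {u v : ℤ} (h : (u, v) ∈ orbit m a b) :
    (2 - v, 2 - u) ∈ orbit m (2 - b) (2 - a) := by
  obtain ⟨j, ⟨rfl, rfl⟩ | ⟨rfl, rfl⟩⟩ := mem_orbit.1 h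
  · exact mem_orbit.2 ⟨-j, Or.inl ⟨by ring, by ring⟩⟩
  · exact mem_orbit.2 ⟨-j - 5, Or.inr ⟨by ring, by ring⟩⟩

theorem mem_shortChords_mirror {u v : ℤ} :
    (2 - v, 2 - u) ∈ shortChords m ↔ (u, v) ∈ shortChords m := by
  simp only [mem_shortChords]
  omega

theorem shortChords_subset_mirror (hsc : shortChords m ⊆ E) : shortChords m ⊆ mirror E :=
  fun ⟨_, _⟩ h => hsc (mem_shortChords_mirror.2 h)

theorem IsExchangeable.of_mirror (h : IsExchangeable m (mirror E) (2 - b) (2 - a)) :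
    IsExchangeable m E a b := by
  obtain ⟨G, hG, hsub, hGE⟩ := h
  refine ⟨mirror G, hG.mirror, fun ⟨x, y⟩ ⟨hx, hxo⟩ => hsub ⟨?_, fun ho => hxo ?_⟩,
    fun hle => hGE fun ⟨x, y⟩ hx => hle ?_⟩
  · simpa only [mem_mirror, sub_sub_cancel] using hx
  · simpa only [sub_sub_cancel] using mem_orbit_mirror ho
  · simpa only [mem_mirror, sub_sub_cancel] using hx

namespace Star

theorem mirror (hS : Star m E p q) (hE : TripleFree m E) :
    Star m (HalfCylinder.mirror E) (2 - q + 5 * m) (2 - p + 5 * m) where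
  two_lt := by have := hS.lt_five; omega
  lt := by have := hS.lt; omega
  lt_five := by have := hS.two_lt; omega
  zero_p := hE.of_eq_twist (-5) hS.two_q (by ring) (by ring)
  one_p := hE.of_eq_twist (-5) hS.one_q (by ring) (by ring)
  one_q := hE.of_eq_twist (-5) hS.one_p (by ring) (by ring)
  two_q := hE.of_eq_twist (-5) hS.zero_p (by ring) (by ring)

theorem isExchangeable_zero_p (hm : 3 ≤ m) (hS : Star m E p q) (hE : TripleFree m E)
    (hsc : shortChords m ⊆ E) (hp : (0, p) ∉ shortChords m) : IsExchangeable m E 0 p := by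
  have h2p := hS.two_lt
  have hF := hE.diff_orbit hS.zero_p
  have hshort := shortChords_subset_diff_orbit hsc hp
  obtain ⟨x, hx5, hx⟩ := exists_isNextNeighbor (c := 0) (l := 2) (y := 5 * m - 2) (by omega)
    (hshort (by rw [mem_shortChords]; omega))
  by_cases h1x : (1, x) ∈ E
  swap
  · exact ⟨_, hx.union_orbit_one hm hF, Set.subset_union_left,
      fun h => h1x (h (Or.inr self_mem_orbit))⟩
  obtain ⟨r, hr5, hr⟩ := exists_isNextNeighbor (c := 1) (l := x) (y := 5 * m - 1) (by omega)
    (hshort (by rw [mem_shortChords]; omega))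
  refine ⟨_, hx.union_orbit_two hm hF hr (by omega), Set.subset_union_left, fun h => ?_⟩
  have hpx : p < x := by
    have hne : x ≠ p := fun h => hx.mem.2 (h ▸ self_mem_orbit)
    have := (hS.compatible hE hx.mem.1).zero 0 (by ring)
    have := hx.lt
    omega
  exact hE.not_fan hS.zero_p h1x (h (Or.inr self_mem_orbit)) ⟨h2p, hpx, hr.lt, by omega⟩

theorem isExchangeable_one_q (hm : 3 ≤ m) (hS : Star m E p q) (hE : TripleFree m E)
    (hsc : shortChords m ⊆ E) (hq : (1, q) ∉ shortChords m) : IsExchangeable m E 1 q := by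
  by_cases h0p : (0, p) ∈ orbit m 1 q
  · exact (hS.isExchangeable_zero_p hm hE hsc
      (mt (mem_shortChords_congr (w := (1, q)) h0p).1 hq)).of_mem_orbit (mem_orbit_comm h0p)
  have h2p := hS.two_lt
  have hpq := hS.lt
  have hq5 := hS.lt_five
  have hp : IsNextNeighbor (E \ orbit m 1 q) 0 2 p := ⟨h2p, ⟨hS.zero_p, h0p⟩, fun hx h => by
    have := (hS.compatible hE h.1).zero 0 (by ring)
    omega⟩
  rw [mem_shortChords] at hq
  obtain ⟨r, hr5, hr⟩ := exists_isNextNeighbor (c := 1) (l := p) (y := 5 * m - 1) (by omega)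
    (shortChords_subset_diff_orbit hsc hq (by rw [mem_shortChords]; omega))
  refine ⟨_, hp.union_orbit_two hm (hE.diff_orbit hS.one_q) hr (by omega), Set.subset_union_left,
    fun h => ?_⟩
  have hone := (hS.compatible hE hr.mem.1).one 0 (by ring)
  have htwo := (hS.compatible hE (h (Or.inr self_mem_orbit))).two 0 (by ring)
  have hpr := hr.lt
  obtain rfl : r = q := by omega
  exact hr.mem.2 self_mem_orbit

theorem isExchangeable_of_mem_starChords (hm : 3 ≤ m) (hS : Star m E p q) (hE : TripleFree m E)
    (hsc : shortChords m ⊆ E) (hab : (a, b) ∉ shortChords m) (h : (a, b) ∈ starChords m p q) :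
    IsExchangeable m E a b := by
  have hS' := hS.mirror hE
  have hsc' := shortChords_subset_mirror hsc
  have hlong {c d : ℤ} (h : (a, b) ∈ orbit m c d) : (c, d) ∉ shortChords m :=
    mt (mem_shortChords_congr (w := (c, d)) h).2 hab
  have hmirror {c d c' : ℤ} (hc : 2 - c = c') (h : (a, b) ∈ orbit m c d) :
      (2 - b, 2 - a) ∈ orbit m c' (2 - d + 5 * m) :=
    mem_orbit_trans (mem_orbit_mirror h)
      (mem_orbit.2 ⟨-5, Or.inr ⟨by ring, by rw [← hc]; ring⟩⟩)
  have hlong' {c d : ℤ} (h : (2 - b, 2 - a) ∈ orbit m c d) : (c, d) ∉ shortChords m :=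
    mt (mem_shortChords_congr (w := (c, d)) h).2 (mt mem_shortChords_mirror.1 hab)
  rcases h with ((h | h) | h) | h
  · exact (hS.isExchangeable_zero_p hm hE hsc (hlong h)).of_mem_orbit h
  · have h' := hmirror (c' := 1) (by ring) h
    exact ((hS'.isExchangeable_one_q hm hE.mirror hsc' (hlong' h')).of_mem_orbit h').of_mirror
  · exact (hS.isExchangeable_one_q hm hE hsc (hlong h)).of_mem_orbit h
  · have h' := hmirror (c' := 0) (by ring) h
    exact ((hS'.isExchangeable_zero_p hm hE.mirror hsc' (hlong' h')).of_mem_orbit h').of_mirror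

end Star

end StarExchange

section ExchangeUnique

variable {m p q p' q' a b u v : ℤ} {E F T T' : Set (ℤ × ℤ)}

theorem succ_notMem_orbit (hm : 2 ≤ m) : (a + 1, b) ∉ orbit m a b := fun h => by
  obtain ⟨j, ⟨hj, -⟩ | ⟨hj, hj'⟩⟩ := mem_orbit.1 h
  · exact mul_ne_of_pos_of_lt (m := m) one_pos (by omega) j (by linarith)
  · exact mul_ne_of_pos_of_lt (m := m) one_pos (by omega) (5 + 2 * j) (by linarith)

/-- A maximal set that is obtained from `F` by adding a single orbit of chords, one that is needed
for its star. -/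
structure Completion (m : ℤ) (F T : Set (ℤ × ℤ)) (p q : ℤ) : Prop where
  maxTripleFree : MaxTripleFree m T
  subset : F ⊆ T
  star : Star m T p q
  not_star : ¬ Star m F p q
  subset_union_orbit : ∀ {z}, z ∈ T → z ∉ F → T ⊆ F ∪ orbit m z.1 z.2

namespace Completion

theorem eq_of_mem (h : Completion m F T p q) (h' : Completion m F T' p' q') {z : ℤ × ℤ}
    (hz : z ∈ T) (hz' : z ∈ T') (hzF : z ∉ F) : T = T' :=
  h.maxTripleFree.eq_of_subset h'.maxTripleFree.tripleFree ((h.subset_union_orbit hz hzF).trans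
    (Set.union_subset h'.subset (h'.maxTripleFree.periodic.orbit_subset hz')))

theorem mem_of_notMem_orbit (h : Completion m F T p q) {z w : ℤ × ℤ} (hz : z ∈ T) (hzF : z ∉ F)
    (hw : w ∈ T) (hwz : w ∉ orbit m z.1 z.2) : w ∈ F :=
  (h.subset_union_orbit hz hzF hw).resolve_right hwz

theorem two_q_notMem_orbit (hm : 3 ≤ m) (h : Completion m F T p q) :
    (2, q) ∉ orbit m 0 p := fun ho => by
  obtain ⟨j, ⟨hj, -⟩ | ⟨hj, hj'⟩⟩ := mem_orbit.1 ho
  · exact mul_ne_of_pos_of_lt (m := m) two_pos (by omega) j (by linarith)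
  · exact h.star.not_zero_p_two_q hm h.maxTripleFree.tripleFree (t := -j) (by linarith)
      (by linarith)

theorem zero_p_or_two_q_mem (hm : 3 ≤ m) (h : Completion m F T p q) :
    (0, p) ∈ F ∨ (2, q) ∈ F :=
  or_iff_not_imp_left.2 fun h0p =>
    h.mem_of_notMem_orbit h.star.zero_p h0p h.star.two_q (h.two_q_notMem_orbit hm)

theorem zero_p_or_one_p_mem (hm : 3 ≤ m) (h : Completion m F T p q) :
    (0, p) ∈ F ∨ (1, p) ∈ F :=
  or_iff_not_imp_left.2 fun h0p =>
    h.mem_of_notMem_orbit h.star.zero_p h0p h.star.one_p (succ_notMem_orbit (a := 0) (by omega))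

theorem one_q_or_two_q_mem (hm : 3 ≤ m) (h : Completion m F T p q) :
    (1, q) ∈ F ∨ (2, q) ∈ F :=
  or_iff_not_imp_left.2 fun h1q =>
    h.mem_of_notMem_orbit h.star.one_q h1q h.star.two_q (succ_notMem_orbit (a := 1) (by omega))

theorem le_of_zero_p_notMem (hm : 3 ≤ m) (h : Completion m F T p q)
    (h' : Completion m F T' p' q') (h0p' : (0, p') ∉ F) : p' ≤ p := by
  by_contra! hlt
  exact h.maxTripleFree.tripleFree.not_fan h.star.zero_p
    (h.subset ((h'.zero_p_or_one_p_mem hm).resolve_left h0p'))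
    (h.subset ((h'.zero_p_or_two_q_mem hm).resolve_left h0p'))
    ⟨h.star.two_lt, hlt, h'.star.lt, h'.star.lt_five⟩

theorem le_of_two_q_notMem (hm : 3 ≤ m) (h : Completion m F T p q)
    (h' : Completion m F T' p' q') (h2q : (2, q) ∉ F) : q' ≤ q := by
  by_contra! hlt
  exact h'.maxTripleFree.tripleFree.not_fan
    (h'.subset ((h.zero_p_or_two_q_mem hm).resolve_right h2q))
    (h'.subset ((h.one_q_or_two_q_mem hm).resolve_right h2q)) h'.star.two_q
    ⟨h.star.two_lt, h.star.lt, hlt, h'.star.lt_five⟩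

theorem eq_of_zero_p_notMem (hm : 3 ≤ m) (h : Completion m F T p q)
    (h' : Completion m F T' p' q') (h0p : (0, p) ∉ F) (h0p' : (0, p') ∉ F) : T = T' := by
  obtain rfl : p = p' :=
    le_antisymm (h'.le_of_zero_p_notMem hm h h0p) (h.le_of_zero_p_notMem hm h' h0p')
  exact h.eq_of_mem h' h.star.zero_p h'.star.zero_p h0p

theorem eq_of_two_q_notMem (hm : 3 ≤ m) (h : Completion m F T p q)
    (h' : Completion m F T' p' q') (h2q : (2, q) ∉ F) (h2q' : (2, q') ∉ F) : T = T' := by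
  obtain rfl : q = q' :=
    le_antisymm (h'.le_of_two_q_notMem hm h h2q') (h.le_of_two_q_notMem hm h' h2q)
  exact h.eq_of_mem h' h.star.two_q h'.star.two_q h2q

theorem eq_of_one_p_notMem (hm : 3 ≤ m) (h : Completion m F T p q)
    (h' : Completion m F T' p' q') (h1p : (1, p) ∉ F) (h0p' : (0, p') ∈ F) : T = T' := by
  have h0p := (h.zero_p_or_one_p_mem hm).resolve_right h1p
  have hle := (h.star.compatible h.maxTripleFree.tripleFree (h.subset h0p')).zero 0 (by ring)
  have hge := (h'.star.compatible h'.maxTripleFree.tripleFree (h'.subset h0p)).zero 0 (by ring)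
  have h2p := h.star.two_lt
  have h2p' := h'.star.two_lt
  obtain rfl : p = p' := by omega
  exact h.eq_of_mem h' h.star.one_p h'.star.one_p h1p

theorem eq_of_one_q_notMem (hm : 3 ≤ m) (h : Completion m F T p q)
    (h' : Completion m F T' p' q') (h1q : (1, q) ∉ F) (h2q' : (2, q') ∈ F) : T = T' := by
  have h2q := (h.one_q_or_two_q_mem hm).resolve_left h1q
  have hle := (h.star.compatible h.maxTripleFree.tripleFree (h.subset h2q')).two 0 (by ring)
  have hge := (h'.star.compatible h'.maxTripleFree.tripleFree (h'.subset h2q)).two 0 (by ring)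
  have hq5 := h.star.lt_five
  have hq5' := h'.star.lt_five
  obtain rfl : q = q' := by omega
  exact h.eq_of_mem h' h.star.one_q h'.star.one_q h1q

theorem eq_of_zero_p_or_one_q_notMem (hm : 3 ≤ m) (h : Completion m F T p q)
    (h' : Completion m F T' p' q') (hF : (0, p) ∉ F ∨ (1, q) ∉ F)
    (hF' : (0, p') ∉ F ∨ (1, q') ∉ F) : T = T' := by
  have htwo {T p q} (h : Completion m F T p q) (hF : (0, p) ∉ F ∨ (1, q) ∉ F) : (2, q) ∈ F :=
    hF.elim (h.zero_p_or_two_q_mem hm).resolve_left (h.one_q_or_two_q_mem hm).resolve_left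
  rcases hF with h0p | h1q
  · rcases hF' with h0p' | h1q'
    · exact h.eq_of_zero_p_notMem hm h' h0p h0p'
    · exact (h'.eq_of_one_q_notMem hm h h1q' (htwo h (.inl h0p))).symm
  · exact h.eq_of_one_q_notMem hm h' h1q (htwo h' hF')

theorem eq_of_one_p_or_two_q_notMem (hm : 3 ≤ m) (h : Completion m F T p q)
    (h' : Completion m F T' p' q') (hF : (1, p) ∉ F ∨ (2, q) ∉ F)
    (hF' : (1, p') ∉ F ∨ (2, q') ∉ F) : T = T' := by
  have hzero {T p q} (h : Completion m F T p q) (hF : (1, p) ∉ F ∨ (2, q) ∉ F) : (0, p) ∈ F :=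
    hF.elim (h.zero_p_or_one_p_mem hm).resolve_right (h.zero_p_or_two_q_mem hm).resolve_right
  rcases hF with h1p | h2q
  · exact h.eq_of_one_p_notMem hm h' h1p (hzero h' hF')
  · rcases hF' with h1p' | h2q'
    · exact (h'.eq_of_one_p_notMem hm h h1p' (hzero h (.inr h2q))).symm
    · exact h.eq_of_two_q_notMem hm h' h2q h2q'

theorem notMem_or_notMem (h : Completion m F T p q) :
    ((0, p) ∉ F ∨ (1, q) ∉ F) ∨ ((1, p) ∉ F ∨ (2, q) ∉ F) := by
  by_contra! hF
  exact h.not_star ⟨h.star.two_lt, h.star.lt, h.star.lt_five, hF.1.1, hF.2.1, hF.1.2, hF.2.2⟩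

theorem eq_or_eq (hm : 3 ≤ m) {T₁ T₂ T₃ : Set (ℤ × ℤ)} {p₁ q₁ p₂ q₂ p₃ q₃ : ℤ}
    (h₁ : Completion m F T₁ p₁ q₁) (h₂ : Completion m F T₂ p₂ q₂)
    (h₃ : Completion m F T₃ p₃ q₃) : T₁ = T₂ ∨ T₁ = T₃ ∨ T₂ = T₃ := by
  rcases h₁.notMem_or_notMem with hF₁ | hF₁ <;> rcases h₂.notMem_or_notMem with hF₂ | hF₂ <;>
    rcases h₃.notMem_or_notMem with hF₃ | hF₃
  · exact .inl (h₁.eq_of_zero_p_or_one_q_notMem hm h₂ hF₁ hF₂)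
  · exact .inl (h₁.eq_of_zero_p_or_one_q_notMem hm h₂ hF₁ hF₂)
  · exact .inr (.inl (h₁.eq_of_zero_p_or_one_q_notMem hm h₃ hF₁ hF₃))
  · exact .inr (.inr (h₂.eq_of_one_p_or_two_q_notMem hm h₃ hF₂ hF₃))
  · exact .inr (.inr (h₂.eq_of_zero_p_or_one_q_notMem hm h₃ hF₂ hF₃))
  · exact .inr (.inl (h₁.eq_of_one_p_or_two_q_notMem hm h₃ hF₁ hF₃))
  · exact .inl (h₁.eq_of_one_p_or_two_q_notMem hm h₂ hF₁ hF₂)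
  · exact .inl (h₁.eq_of_one_p_or_two_q_notMem hm h₂ hF₁ hF₂)

end Completion

theorem Star.eq_and_eq (hS : Star m E p q) (hS' : Star m E p' q') (hE : TripleFree m E) :
    p = p' ∧ q = q' := by
  have h0p := (hS.compatible hE hS'.zero_p).zero 0 (by ring)
  have h0p' := (hS'.compatible hE hS.zero_p).zero 0 (by ring)
  have h2q := (hS.compatible hE hS'.two_q).two 0 (by ring)
  have h2q' := (hS'.compatible hE hS.two_q).two 0 (by ring)
  have := hS.two_lt
  have := hS'.two_lt
  have := hS.lt_five
  have := hS'.lt_five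
  omega

theorem subset_diff_orbit_union_orbit (hm : 0 < m) (hE : Periodic m E) (hT : Periodic m T)
    (hcount : chordCount m E = chordCount m T) (hab : (a, b) ∈ E) (hsub : E \ orbit m a b ⊆ T)
    (huv : (u, v) ∈ T) (huvE : (u, v) ∉ E \ orbit m a b) :
    T ⊆ (E \ orbit m a b) ∪ orbit m u v := by
  have hF := hE.diff (periodic_orbit (hE.lt hab) (hE.lt_add hab))
  have hU := hF.union (periodic_orbit (hT.lt huv) (hT.lt_add huv))
  have hdiff : ((E \ orbit m a b) ∪ orbit m u v) \ orbit m u v = E \ orbit m a b := by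
    rw [Set.union_sdiff_right, sdiff_eq_left, Set.disjoint_left]
    exact fun z hz hzo => huvE (hF.orbit_subset hz (mem_orbit_comm hzo))
  have hcountE := chordCount_eq_diff_orbit_add_two hE hab
  have hcountU := chordCount_eq_diff_orbit_add_two hU (Or.inr (self_mem_orbit (a := u) (b := v)))
  rw [hdiff] at hcountU
  exact (eq_of_chordCount_le hm hU hT (Set.union_subset hsub (hT.orbit_subset huv)) (by omega)).ge

theorem exists_completion (hm : 3 ≤ m) (hE : MaxTripleFree m E) (hS : Star m E p q)
    (hab : (a, b) ∈ E) (habS : (a, b) ∈ starChords m p q) (hT : MaxTripleFree m T)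
    (hcount : chordCount m E = chordCount m T) (hsub : E \ orbit m a b ⊆ T) :
    ∃ p' q', Completion m (E \ orbit m a b) T p' q' := by
  obtain ⟨p', q', hS'⟩ := hT.exists_star hm
  refine ⟨p', q', hT, hsub, hS', fun hSF => ?_, fun {z} => subset_diff_orbit_union_orbit (by omega)
    hE.periodic hT.periodic hcount hab hsub⟩
  obtain ⟨rfl, rfl⟩ := hS.eq_and_eq ⟨hSF.two_lt, hSF.lt, hSF.lt_five, hSF.zero_p.1, hSF.one_p.1,
    hSF.one_q.1, hSF.two_q.1⟩ hE.tripleFree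
  rcases habS with ((h | h) | h) | h
  · exact hSF.zero_p.2 (mem_orbit_comm h)
  · exact hSF.one_p.2 (mem_orbit_comm h)
  · exact hSF.one_q.2 (mem_orbit_comm h)
  · exact hSF.two_q.2 (mem_orbit_comm h)

theorem Star.hasFlip_of_mem_starChords (hm : 3 ≤ m) (hS : Star m E p q) (hE : MaxTripleFree m E)
    (hcount : ∀ ⦃T⦄, MaxTripleFree m T → chordCount m E = chordCount m T) (hab : (a, b) ∈ E)
    (habs : (a, b) ∉ shortChords m) (habS : (a, b) ∈ starChords m p q) : HasFlip m E a b := by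
  obtain ⟨G, hG, hsub, hGE⟩ :=
    hS.isExchangeable_of_mem_starChords hm hE.tripleFree hE.shortChords_subset habs habS
  obtain ⟨T, hGT, hT⟩ := hG.exists_maxTripleFree
  have hTE : T ≠ E := fun h => hGE (h ▸ hGT)
  refine ⟨T, ⟨hT, hsub.trans hGT, hTE⟩, fun T' ⟨hT', hsub', hTE'⟩ => ?_⟩
  have hcompletion {T} (hT : MaxTripleFree m T) :=
    exists_completion hm hE hS hab habS hT (hcount hT)
  obtain ⟨_, _, h₁⟩ := hcompletion hE Set.sdiff_subset
  obtain ⟨_, _, h₂⟩ := hcompletion hT (hsub.trans hGT)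
  obtain ⟨_, _, h₃⟩ := hcompletion hT' hsub'
  obtain h | h | h := h₁.eq_or_eq hm h₂ h₃
  · exact absurd h.symm hTE
  · exact absurd h.symm hTE'
  · exact h.symm

theorem hasFlips_of_hasFlips_sub_one (hm : 3 ≤ m) (ih : HasFlips (m - 1))
    (hcount : ∀ ⦃E F⦄, MaxTripleFree m E → MaxTripleFree m F → chordCount m E = chordCount m F) :
    HasFlips m := by
  intro E hE a b hab habs
  obtain ⟨p, q, hS⟩ := hE.exists_star hm
  by_cases habS : (a, b) ∈ starChords m p q
  · exact hS.hasFlip_of_mem_starChords hm hE (fun _ => hcount hE) hab habs habS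
  · exact hS.hasFlip_of_notMem_starChords hm ih hE hab habs habS

end ExchangeUnique

section BaseCases

variable {m a b d i j i' j' u v : ℤ} {E : Set (ℤ × ℤ)}

theorem chordCount_shortChords (hm : 0 < m) : (chordCount m (shortChords m) : ℤ) = 4 * m := by
  have hfund : fundamental m (shortChords m) = (fun z : ℤ × ℤ => (z.1, z.1 + z.2)) ''
      ((Finset.Ico 0 m ×ˢ {1, 2, 5 * m - 1, 5 * m - 2} : Finset (ℤ × ℤ)) : Set (ℤ × ℤ)) := by
    ext ⟨u, v⟩
    simp only [fundamental, shortChords, Set.mem_ofPred_eq, Set.mem_image, Finset.mem_coe,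
      Finset.mem_product, Finset.mem_Ico, Finset.mem_insert, Finset.mem_singleton, Prod.exists,
      Prod.mk.injEq]
    constructor
    · rintro h
      exact ⟨u, v - u, by omega, rfl, by omega⟩
    · rintro ⟨x, y, h1, rfl, rfl⟩
      omega
  rw [chordCount, hfund, Set.InjOn.ncard_image, Set.ncard_coe_finset, Finset.card_product,
    Int.card_Ico, Finset.card_insert_of_notMem, Finset.card_insert_of_notMem, Finset.card_pair]
  · push_cast
    omega
  · omega
  · simp only [Finset.mem_insert, Finset.mem_singleton]; omega
  · simp only [Finset.mem_insert, Finset.mem_singleton]; omega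
  · rintro ⟨u, v⟩ - ⟨x, y⟩ - h
    simp only [Prod.mk.injEq] at h ⊢
    omega

theorem MaxTripleFree.eq_shortChords_one (hE : MaxTripleFree 1 E) : E = shortChords 1 := by
  refine Set.Subset.antisymm (fun ⟨u, v⟩ hz => ?_) hE.shortChords_subset
  have := hE.periodic.lt hz
  have := hE.periodic.lt_add hz
  rw [mem_shortChords]
  omega

theorem hasFlips_one : HasFlips 1 := fun _ hE _ _ hab habs =>
  absurd (hE.eq_shortChords_one ▸ hab) habs

/-- The maximal triple-free sets for `m = 2`: up to rotation they contain one chord of length `3`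
and one of length `4`. Only the parities of `i` and `j` matter. -/
def decagon (i j : ℤ) : Set (ℤ × ℤ) := shortChords 2 ∪ (orbit 2 i (i + 3) ∪ orbit 2 j (j + 4))

theorem mem_orbit_two : (u, v) ∈ orbit 2 i (i + d) ↔
    (v = u + d ∧ 2 ∣ u - i) ∨ (v = u + 10 - d ∧ 2 ∣ v - i) := by
  rw [mem_orbit]
  constructor
  · rintro ⟨k, h⟩
    omega
  · rintro (h | h)
    · exact ⟨(u - i) / 2, by omega⟩
    · exact ⟨(v - i) / 2 - 5, by omega⟩

theorem mem_decagon : (u, v) ∈ decagon i j ↔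
    (u < v ∧ v < u + 10 ∧ (v ≤ u + 2 ∨ u + 8 ≤ v)) ∨ (v = u + 3 ∧ 2 ∣ u - i) ∨
      (v = u + 7 ∧ 2 ∣ v - i) ∨ (v = u + 4 ∧ 2 ∣ u - j) ∨ (v = u + 6 ∧ 2 ∣ v - j) := by
  simp only [decagon, Set.mem_union, mem_shortChords, mem_orbit_two]
  omega

theorem decagon_congr (hi : 2 ∣ i - i') (hj : 2 ∣ j - j') : decagon i j = decagon i' j' := by
  ext ⟨u, v⟩
  simp only [mem_decagon]
  omega

theorem periodic_decagon : Periodic 2 (decagon i j) :=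
  periodic_shortChords.union
    ((periodic_orbit (by omega) (by omega)).union (periodic_orbit (by omega) (by omega)))

theorem tripleFree_decagon : TripleFree 2 (decagon i j) := by
  refine ⟨periodic_decagon, fun a b c a' b' c' ha hb hc h => ?_⟩
  have long : ∀ {u v}, (u, v) ∈ decagon i j → u + 3 ≤ v → v ≤ u + 7 →
      (v = u + 3 ∧ 2 ∣ u - i) ∨ (v = u + 7 ∧ 2 ∣ v - i) ∨ (v = u + 4 ∧ 2 ∣ u - j) ∨
      (v = u + 6 ∧ 2 ∣ v - j) := by
    intro u v h h1 h2
    rw [mem_decagon] at h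
    omega
  have ha := long ha (by omega) (by omega)
  have hb := long hb (by omega) (by omega)
  have hc := long hc (by omega) (by omega)
  rcases ha with ha | ha | ha | ha <;> rcases hb with hb | hb | hb | hb <;>
    rcases hc with hc | hc | hc | hc <;> omega

/-- Otherwise the chords of length `d` starting at `0`, `1` and `2` would cross. -/
theorem TripleFree.exists_forall_dvd_sub (hE : TripleFree 2 E) (hd : 3 ≤ d) (hd' : d ≤ 7) :
    ∃ i, ∀ u, (u, u + d) ∈ E → 2 ∣ u - i := by
  by_cases h0 : (0, d) ∈ E
  · refine ⟨0, fun u hu => ?_⟩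
    by_contra hodd
    have h1 : (1, 1 + d) ∈ E := hE.of_eq_shift (-((u - 1) / 2)) hu (by omega) (by omega)
    have h2 : (2, 2 + d) ∈ E := hE.of_eq_shift 1 h0 (by omega) (by omega)
    exact hE.noTripleCrossing h0 h1 h2 (by omega)
  · refine ⟨1, fun u hu => ?_⟩
    by_contra heven
    exact h0 (hE.of_eq_shift (-(u / 2)) hu (by omega) (by omega))

theorem TripleFree.exists_subset_decagon (hE : TripleFree 2 E) : ∃ i j, E ⊆ decagon i j := by
  obtain ⟨i, hi⟩ := hE.exists_forall_dvd_sub (d := 3) le_rfl (by omega)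
  obtain ⟨j, hj⟩ := hE.exists_forall_dvd_sub (d := 4) (by omega) (by omega)
  refine ⟨i, j, fun ⟨u, v⟩ hz => ?_⟩
  have := hE.lt hz
  have := hE.lt_add hz
  have := hE.length_le hz
  have : v = u + 3 → 2 ∣ u - i := fun h => hi u (h ▸ hz)
  have : v = u + 4 → 2 ∣ u - j := fun h => hj u (h ▸ hz)
  have : v = u + 7 → 2 ∣ v - i := fun h => hi v (hE.of_eq_twist 0 hz (by omega) (by omega))
  have : v = u + 6 → 2 ∣ v - j := fun h => hj v (hE.of_eq_twist 0 hz (by omega) (by omega))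
  rw [mem_decagon]
  omega

theorem dvd_sub_of_decagon_subset (h : decagon i j ⊆ decagon i' j') :
    2 ∣ i - i' ∧ 2 ∣ j - j' := by
  have hi : (i, i + 3) ∈ decagon i' j' := h (Or.inr (Or.inl self_mem_orbit))
  have hj : (j, j + 4) ∈ decagon i' j' := h (Or.inr (Or.inr self_mem_orbit))
  rw [mem_decagon] at hi hj
  omega

theorem maxTripleFree_decagon : MaxTripleFree 2 (decagon i j) := by
  refine ⟨tripleFree_decagon, fun F hF hsub => ?_⟩
  obtain ⟨i', j', h⟩ := hF.exists_subset_decagon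
  obtain ⟨hi, hj⟩ := dvd_sub_of_decagon_subset (hsub.trans h)
  rwa [decagon_congr hi hj]

theorem MaxTripleFree.exists_eq_decagon (hE : MaxTripleFree 2 E) : ∃ i j, E = decagon i j := by
  obtain ⟨i, j, h⟩ := hE.tripleFree.exists_subset_decagon
  exact ⟨i, j, hE.eq_of_subset tripleFree_decagon h⟩

theorem chordCount_decagon : chordCount 2 (decagon i j) = 12 := by
  have hi : (i, i + 3) ∈ decagon i j := Or.inr (Or.inl self_mem_orbit)
  have hj : (j, j + 4) ∈ decagon i j \ orbit 2 i (i + 3) :=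
    ⟨Or.inr (Or.inr self_mem_orbit), by rw [mem_orbit_two]; omega⟩
  have hshort : (decagon i j \ orbit 2 i (i + 3)) \ orbit 2 j (j + 4) = shortChords 2 := by
    ext ⟨u, v⟩
    simp only [decagon, Set.mem_sdiff, Set.mem_union, mem_shortChords, mem_orbit_two]
    omega
  have hP := periodic_decagon (i := i) (j := j)
  have hcount := chordCount_shortChords (m := 2) (by norm_num)
  rw [chordCount_eq_diff_orbit_add_two hP hi, chordCount_eq_diff_orbit_add_two
    (hP.diff (periodic_orbit (hP.lt hi) (hP.lt_add hi))) hj, hshort]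
  omega

theorem hasFlip_decagon_three : HasFlip 2 (decagon i j) i (i + 3) := by
  refine ⟨decagon (i + 1) j, ⟨maxTripleFree_decagon, ?_, fun h => ?_⟩, ?_⟩
  · rintro z ⟨hz | hz | hz, hnot⟩
    · exact Or.inl hz
    · exact absurd hz hnot
    · exact Or.inr (Or.inr hz)
  · have := (dvd_sub_of_decagon_subset h.subset).1
    omega
  · rintro _ ⟨hG, hsub, hne⟩
    obtain ⟨i', j', rfl⟩ := hG.exists_eq_decagon
    have hj : (j, j + 4) ∈ decagon i' j' :=
      hsub ⟨Or.inr (Or.inr self_mem_orbit), by rw [mem_orbit_two]; omega⟩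
    rw [mem_decagon] at hj
    have hi : ¬ 2 ∣ i' - i := fun hi => hne (decagon_congr hi (by omega))
    exact decagon_congr (by omega) (by omega)

theorem hasFlip_decagon_four : HasFlip 2 (decagon i j) j (j + 4) := by
  refine ⟨decagon i (j + 1), ⟨maxTripleFree_decagon, ?_, fun h => ?_⟩, ?_⟩
  · rintro z ⟨hz | hz | hz, hnot⟩
    · exact Or.inl hz
    · exact Or.inr (Or.inl hz)
    · exact absurd hz hnot
  · have := (dvd_sub_of_decagon_subset h.subset).2
    omega
  · rintro _ ⟨hG, hsub, hne⟩
    obtain ⟨i', j', rfl⟩ := hG.exists_eq_decagon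
    have hi : (i, i + 3) ∈ decagon i' j' :=
      hsub ⟨Or.inr (Or.inl self_mem_orbit), by rw [mem_orbit_two]; omega⟩
    rw [mem_decagon] at hi
    have hj : ¬ 2 ∣ j' - j := fun hj => hne (decagon_congr (by omega) hj)
    exact decagon_congr (by omega) (by omega)

theorem HasFlip.of_mem_orbit {c : ℤ} (h : HasFlip m E c d) (hab : (a, b) ∈ orbit m c d) :
    HasFlip m E a b := by
  rwa [HasFlip, orbit_eq_of_mem hab]

theorem hasFlips_two : HasFlips 2 := by
  intro E hE a b hab habs
  obtain ⟨i, j, rfl⟩ := hE.exists_eq_decagon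
  rcases hab with h | h | h
  · exact absurd h habs
  · exact HasFlip.of_mem_orbit hasFlip_decagon_three h
  · exact HasFlip.of_mem_orbit hasFlip_decagon_four h

end BaseCases

section Induction

variable {m : ℤ} {E : Set (ℤ × ℤ)}

theorem chordCount_eq (hm : 1 ≤ m) (hE : MaxTripleFree m E) :
    (chordCount m E : ℤ) = 8 * m - 4 := by
  induction m, hm using Int.leInduction generalizing E with
  | base => rw [hE.eq_shortChords_one, chordCount_shortChords one_pos]; norm_num
  | succ m hm ih =>
    obtain rfl | hm := hm.eq_or_lt
    · obtain ⟨i, j, rfl⟩ := MaxTripleFree.exists_eq_decagon hE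
      exact congrArg _ chordCount_decagon
    · obtain ⟨p, q, hS⟩ := hE.exists_star (by omega)
      have hcollapse := hS.maxTripleFree_image_collapse (by omega) hE
      have hcount := hS.chordCount_eq (by omega) hE.tripleFree hE.shortChords_subset
      rw [add_sub_cancel_right] at hcollapse hcount
      rw [hcount, Nat.cast_add, ih hcollapse]
      push_cast
      ring

theorem hasFlips (hm : 1 ≤ m) : HasFlips m := by
  induction m, hm using Int.leInduction with
  | base => exact hasFlips_one
  | succ m hm ih =>
    obtain rfl | hm := hm.eq_or_lt
    · exact hasFlips_two
    · refine hasFlips_of_hasFlips_sub_one (by omega) (by rwa [add_sub_cancel_right]) ?_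
      intro E F hE hF
      have := chordCount_eq (by omega) hE
      have := chordCount_eq (by omega) hF
      omega

end Induction

section CoverEdges

variable {n : ℕ} {L : Set CoverEdge} {a b : CoverEdge}

theorem not_crossing_of_crossingFree_three (hL : CrossingFree 3 L) {e f g : CoverEdge}
    (he : e ∈ L) (hf : f ∈ L) (hg : g ∈ L) :
    ¬ (e.lo < f.lo ∧ f.lo < g.lo ∧ g.lo < e.hi ∧ e.hi < f.hi ∧ f.hi < g.hi) := by
  classical
  intro h
  have hef : e.Intersects f := Or.inl (by omega)
  have heg : e.Intersects g := Or.inl (by omega)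
  have hfg : f.Intersects g := Or.inl (by omega)
  have : Std.Symm CoverEdge.Intersects := ⟨fun _ _ => Or.symm⟩
  refine hL {e, f, g} (by simp [Set.insert_subset_iff, he, hf, hg])
    ⟨Finset.card_eq_three.2 ⟨e, f, g, ?_, ?_, ?_, rfl⟩, ?_⟩
  · rintro rfl; omega
  · rintro rfl; omega
  · rintro rfl; omega
  · simp [Set.pairwise_insert_of_symm, hef, heg, hfg]

theorem crossingFree_three_of_forall_not
    (hL : ∀ ⦃e f g⦄, e ∈ L → f ∈ L → g ∈ L →
      ¬ (e.lo < f.lo ∧ f.lo < g.lo ∧ g.lo < e.hi ∧ e.hi < f.hi ∧ f.hi < g.hi)) :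
    CrossingFree 3 L := by
  classical
  rintro s hs ⟨hcard, hpair⟩
  obtain ⟨e, f, g, hef, heg, hfg, rfl⟩ := Finset.card_eq_three.1 hcard
  have ief := hpair (x := e) (by simp) (y := f) (by simp) hef
  have ieg := hpair (x := e) (by simp) (y := g) (by simp) heg
  have ifg := hpair (x := f) (by simp) (y := g) (by simp) hfg
  have he : e ∈ L := hs (by simp)
  have hf : f ∈ L := hs (by simp)
  have hg : g ∈ L := hs (by simp)
  unfold CoverEdge.Intersects at ief ieg ifg
  rcases ief with ief | ief <;> rcases ieg with ieg | ieg <;> rcases ifg with ifg | ifg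
  · exact hL he hf hg (by omega)
  · exact hL he hg hf (by omega)
  · omega
  · exact hL hg he hf (by omega)
  · exact hL hf he hg (by omega)
  · omega
  · exact hL hf hg he (by omega)
  · exact hL hg hf he (by omega)

theorem proj_eq_iff :
    proj n a = proj n b ↔ ∃ l : ℤ, b.lo = a.lo + l * n ∧ b.hi = a.hi + l * n := by
  constructor
  · intro h
    obtain ⟨l, rfl⟩ := Quotient.exact h
    exact ⟨l, rfl, rfl⟩
  · rintro ⟨l, h1, h2⟩
    exact Quotient.sound ⟨l, CoverEdge.ext h1 h2⟩

theorem proj_surjective (n : ℕ) : Function.Surjective (proj n) := Quotient.exists_rep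

theorem proj_shift (a : CoverEdge) (l : ℤ) : proj n (a.shift (l * n)) = proj n a :=
  (proj_eq_iff.2 ⟨l, rfl, rfl⟩).symm

theorem length_proj (a : CoverEdge) : ((proj n a).length : ℤ) = a.hi - a.lo :=
  Int.toNat_of_nonneg (sub_nonneg.2 a.lt.le)

theorem isRelevant_proj : (proj n a).IsRelevant 2 ↔ a.lo + 3 ≤ a.hi ∧ a.hi ≤ a.lo + 2 * n := by
  have := length_proj (n := n) a
  unfold Edge.IsRelevant
  omega

theorem orbit_eq_of_proj_eq (h : proj n a = proj n b) :
    orbit n a.lo a.hi = orbit n b.lo b.hi := by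
  obtain ⟨l, hlo, hhi⟩ := proj_eq_iff.1 h
  exact (orbit_eq_of_mem (mem_orbit.2 ⟨l, Or.inl ⟨hlo, hhi⟩⟩)).symm

theorem finite_relevantEdge (n : ℕ) : Finite (RelevantEdge n 2) := by
  obtain rfl | hn := Nat.eq_zero_or_pos n
  · refine @Finite.of_subsingleton _ ⟨fun ⟨e, he⟩ => ?_⟩
    unfold Edge.IsRelevant at he
    omega
  have hfin : {a : CoverEdge | 0 ≤ a.lo ∧ a.lo ≤ n ∧ a.hi ≤ 3 * n}.Finite := by
    refine Set.Finite.of_injOn (f := fun a => (a.lo, a.hi))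
      (t := Set.Icc 0 (n : ℤ) ×ˢ Set.Icc 0 (3 * n : ℤ)) ?_ ?_
      ((Set.finite_Icc _ _).prod (Set.finite_Icc _ _))
    · rintro a ⟨h0, h1, h2⟩
      have := a.lt
      exact ⟨⟨h0, h1⟩, ⟨by dsimp only; omega, h2⟩⟩
    · exact fun a _ b _ h => CoverEdge.ext (congrArg Prod.fst h) (congrArg Prod.snd h)
  refine (hfin.image (proj n)).subset fun e he => ?_
  obtain ⟨a, rfl⟩ := proj_surjective n e
  have hrel := isRelevant_proj.1 he
  have := Int.emod_nonneg a.lo (by omega : (n : ℤ) ≠ 0)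
  have := Int.emod_lt_of_pos a.lo (by omega : (0 : ℤ) < n)
  have hmod : a.lo + -(a.lo / n) * n = a.lo % n := by rw [Int.emod_def]; ring
  refine ⟨a.shift (-(a.lo / n) * n), ?_, proj_shift a _⟩
  simp only [CoverEdge.shift, Set.mem_ofPred_eq]
  omega

end CoverEdges

section Chords

variable {n : ℕ} {s t : Set (RelevantEdge n 2)} {E F : Set (ℤ × ℤ)} {a : CoverEdge}

/-- A set of relevant edges without three pairwise crossing ones; unlike the faces of
`complex n 2`, it may be empty. -/
def IsFace (s : Set (RelevantEdge n 2)) : Prop := CrossingFree 3 (lift (Subtype.val '' s))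

/-- The chords of the `5 * n`-gon given by a set of relevant edges, obtained by wrapping the
universal cover around the polygon, together with the sides and the chords of length two. -/
def chords (s : Set (RelevantEdge n 2)) : Set (ℤ × ℤ) :=
  (⋃ a ∈ lift (Subtype.val '' s), orbit n a.lo a.hi) ∪ shortChords n

/-- The relevant edges given by a set of chords of the `5 * n`-gon. -/
def edges (n : ℕ) (E : Set (ℤ × ℤ)) : Set (RelevantEdge n 2) :=
  {e | ∃ a : CoverEdge, proj n a = e.1 ∧ (a.lo, a.hi) ∈ E}

theorem mem_lift_image : a ∈ lift (Subtype.val '' s) ↔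
    ∃ h : (proj n a).IsRelevant 2, (⟨proj n a, h⟩ : RelevantEdge n 2) ∈ s := by
  constructor
  · rintro ⟨⟨e, he⟩, hs, h⟩
    obtain rfl : e = proj n a := h
    exact ⟨he, hs⟩
  · rintro ⟨h, hs⟩
    exact ⟨_, hs, rfl⟩

theorem mem_lift_image_of_isRelevant (h : (proj n a).IsRelevant 2) :
    a ∈ lift (Subtype.val '' s) ↔ (⟨proj n a, h⟩ : RelevantEdge n 2) ∈ s :=
  mem_lift_image.trans (exists_prop_of_true h)

theorem bounds_of_mem_lift_image (ha : a ∈ lift (Subtype.val '' s)) :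
    a.lo + 3 ≤ a.hi ∧ a.hi ≤ a.lo + 2 * n :=
  isRelevant_proj.1 (mem_lift_image.1 ha).1

theorem chords_mono (h : s ⊆ t) : chords s ⊆ chords t :=
  Set.union_subset_union_left _
    (Set.biUnion_subset_biUnion_left (Set.preimage_mono (Set.image_mono h)))

theorem edges_mono (h : E ⊆ F) : edges n E ⊆ edges n F :=
  fun _ ⟨a, ha, hz⟩ => ⟨a, ha, h hz⟩

theorem mem_chords {z : ℤ × ℤ} : z ∈ chords s ↔
    (∃ a ∈ lift (Subtype.val '' s), z ∈ orbit n a.lo a.hi) ∨ z ∈ shortChords n := by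
  simp only [chords, Set.mem_union, Set.mem_iUnion, exists_prop]

theorem periodic_chords (s : Set (RelevantEdge n 2)) : Periodic n (chords s) := by
  rw [chords, ← Set.sUnion_image]
  refine Periodic.union (Periodic.sUnion ?_) periodic_shortChords
  rintro _ ⟨a, ha, rfl⟩
  have := bounds_of_mem_lift_image ha
  exact periodic_orbit (by omega) (by omega)

theorem mem_chords_of_mem_lift_image (ha : a ∈ lift (Subtype.val '' s)) :
    (a.lo, a.hi) ∈ chords s :=
  mem_chords.2 (Or.inl ⟨a, ha, self_mem_orbit⟩)

theorem mem_lift_image_of_mem_chords (h : (a.lo, a.hi) ∈ chords s) (h3 : a.lo + 3 ≤ a.hi)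
    (h2n : a.hi ≤ a.lo + 2 * n) : a ∈ lift (Subtype.val '' s) := by
  obtain ⟨b, hb, hab⟩ | hshort := mem_chords.1 h
  · have := bounds_of_mem_lift_image hb
    obtain ⟨l, ⟨hlo, hhi⟩ | ⟨hlo, hhi⟩⟩ := mem_orbit.1 hab
    · rwa [lift, Set.mem_preimage, ← proj_eq_iff.2 ⟨l, hlo, hhi⟩]
    · omega
  · rw [mem_shortChords] at hshort
    omega

theorem le_or_le_of_mem_chords {u v : ℤ} (h : (u, v) ∈ chords s) (h3 : u + 3 ≤ v)
    (h3' : v + 3 ≤ u + 5 * n) : v ≤ u + 2 * n ∨ u + 3 * n ≤ v := by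
  obtain ⟨a, ha, hz⟩ | hshort := mem_chords.1 h
  · have := bounds_of_mem_lift_image ha
    obtain ⟨l, h | h⟩ := mem_orbit.1 hz <;> omega
  · rw [mem_shortChords] at hshort
    omega

theorem edges_chords (s : Set (RelevantEdge n 2)) : edges n (chords s) = s := by
  ext ⟨e, he⟩
  obtain ⟨a, rfl⟩ := proj_surjective n e
  rw [← mem_lift_image_of_isRelevant (s := s) he]
  constructor
  · rintro ⟨b, hba, hb⟩
    replace hba : proj n b = proj n a := hba
    have hb' := isRelevant_proj.1 (hba ▸ he)
    have := mem_lift_image_of_mem_chords hb hb'.1 hb'.2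
    rwa [lift, Set.mem_preimage, hba] at this
  · exact fun h => ⟨a, rfl, mem_chords_of_mem_lift_image h⟩

theorem chords_edges (hE : TripleFree n E) (hshort : shortChords n ⊆ E) :
    chords (edges n E) = E := by
  have hlift : ∀ {u v : ℤ}, (u, v) ∈ E → u + 3 ≤ v → v ≤ u + 2 * n →
      (u, v) ∈ chords (edges n E) := fun {u v} huv h3 h2n =>
    mem_chords_of_mem_lift_image (a := ⟨u, v, by omega⟩)
      (mem_lift_image.2 ⟨isRelevant_proj.2 ⟨h3, h2n⟩, _, rfl, huv⟩)
  apply Set.Subset.antisymm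
  · rintro z hz
    obtain ⟨a, ha, hza⟩ | hz := mem_chords.1 hz
    · obtain ⟨_, b, hb, hbE⟩ := mem_lift_image.1 ha
      rw [← orbit_eq_of_proj_eq hb] at hza
      exact hE.orbit_subset hbE hza
    · exact hshort hz
  · rintro ⟨u, v⟩ hz
    by_cases hb : (u, v) ∈ shortChords n
    · exact Or.inr hb
    have := hE.lt hz
    have := hE.lt_add hz
    rw [mem_shortChords] at hb
    rcases hE.length_le hz with h | h
    · exact hlift hz (by omega) h
    · exact (periodic_chords _).untwist (hlift (hE.twist hz) (by omega) (by omega))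

theorem chords_sdiff_singleton (h : (proj n a).IsRelevant 2) :
    chords (s \ {⟨proj n a, h⟩}) = chords s \ orbit n a.lo a.hi := by
  have hbounds := isRelevant_proj.1 h
  ext z
  constructor
  · refine fun hz => ⟨chords_mono Set.sdiff_subset hz, fun ho => ?_⟩
    have hchord := (periodic_chords _).orbit_subset hz (mem_orbit_comm ho)
    have hlift := mem_lift_image_of_mem_chords hchord hbounds.1 hbounds.2
    exact ((mem_lift_image_of_isRelevant h).1 hlift).2 rfl
  · rintro ⟨hz, ho⟩
    obtain ⟨b, hb, hzb⟩ | hz := mem_chords.1 hz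
    · obtain ⟨hb, hbs⟩ := mem_lift_image.1 hb
      refine mem_chords.2 (Or.inl ⟨b, mem_lift_image.2 ⟨hb, hbs, fun heq => ho ?_⟩, hzb⟩)
      rwa [← orbit_eq_of_proj_eq (congrArg Subtype.val heq)]
    · exact Or.inr hz

end Chords

section Faces

variable {n : ℕ} {s t : Set (RelevantEdge n 2)} {E : Set (ℤ × ℤ)}

theorem IsFace.not_crossing (hs : IsFace s) {a b c a' b' c' : ℤ} (ha : (a, a') ∈ chords s)
    (hb : (b, b') ∈ chords s) (hc : (c, c') ∈ chords s) (la : a' ≤ a + 2 * n)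
    (lb : b' ≤ b + 2 * n) (lc : c' ≤ c + 2 * n) :
    ¬ (a < b ∧ b < c ∧ c < a' ∧ a' < b' ∧ b' < c') := fun h =>
  not_crossing_of_crossingFree_three hs
    (mem_lift_image_of_mem_chords (a := ⟨a, a', by omega⟩) ha (by dsimp; omega) la)
    (mem_lift_image_of_mem_chords (a := ⟨b, b', by omega⟩) hb (by dsimp; omega) lb)
    (mem_lift_image_of_mem_chords (a := ⟨c, c', by omega⟩) hc (by dsimp; omega) lc) h

/-- A triple crossing that winds around the centre of the polygon is impossible, because it can be
rotated back into a triple crossing of edges of the universal cover. -/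
theorem IsFace.not_crossing_around (hs : IsFace s) {a b c a' b' c' : ℤ} (ha : (a, a') ∈ chords s)
    (hc : (c, c') ∈ chords s) (hb : (b', b + 5 * n) ∈ chords s) (la : a' ≤ a + 2 * n)
    (lc : c' ≤ c + 2 * n) (lb : b + 5 * n ≤ b' + 2 * n) :
    ¬ (a < b ∧ b < c ∧ c < a' ∧ a' < b' ∧ b' < c' ∧ c' < a + 5 * n) := fun h =>
  hs.not_crossing ha ((periodic_chords s).shift (-1) hc) ((periodic_chords s).shift (-2) hb)
    (by omega) (by omega) (by omega) (by omega)

theorem IsFace.tripleFree_chords (hs : IsFace s) : TripleFree n (chords s) := by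
  have hP := periodic_chords s
  refine ⟨hP, fun a b c a' b' c' ha hb hc h => ?_⟩
  have ta := hP.twist ha
  have tb := hP.twist hb
  have tc := hP.twist hc
  rcases le_or_le_of_mem_chords ha (by omega) (by omega) with la | la <;>
    rcases le_or_le_of_mem_chords hb (by omega) (by omega) with lb | lb <;>
    rcases le_or_le_of_mem_chords hc (by omega) (by omega) with lc | lc
  · exact hs.not_crossing ha hb hc la lb lc (by omega)
  · exact hs.not_crossing (hP.of_eq_twist (-5) hc rfl rfl) ha hb
      (by omega) la lb (by omega)
  · exact hs.not_crossing_around ha hc tb la lc (by omega) (by omega)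
  · exact hs.not_crossing (hP.of_eq_twist (-5) hb rfl rfl)
      (hP.of_eq_twist (-5) hc rfl rfl) ha (by omega) (by omega) la (by omega)
  · exact hs.not_crossing hb hc ta lb lc (by omega) (by omega)
  · exact hs.not_crossing_around hb ta tc lb (by omega) (by omega) (by omega)
  · exact hs.not_crossing hc ta tb lc (by omega) (by omega) (by omega)
  · exact hs.not_crossing ta tb tc (by omega) (by omega) (by omega) (by omega)

theorem isFace_iff : IsFace s ↔ TripleFree n (chords s) := by
  refine ⟨IsFace.tripleFree_chords, fun h => ?_⟩
  refine crossingFree_three_of_forall_not fun e f g he hf hg hcross => ?_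
  have := bounds_of_mem_lift_image he
  have := bounds_of_mem_lift_image hg
  exact h.noTripleCrossing (mem_chords_of_mem_lift_image he) (mem_chords_of_mem_lift_image hf)
    (mem_chords_of_mem_lift_image hg) (by omega)

theorem MaxTripleFree.chords_edges (hE : MaxTripleFree n E) : chords (edges n E) = E :=
  HalfCylinder.chords_edges hE.tripleFree hE.shortChords_subset

theorem maximal_isFace_iff : Maximal IsFace s ↔ MaxTripleFree n (chords s) := by
  constructor
  · refine fun h => ⟨isFace_iff.1 h.prop, fun F hF hsub => ?_⟩
    have hF' : chords (edges n F) = F := chords_edges hF (Set.subset_union_right.trans hsub)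
    have hface : IsFace (edges n F) := by rwa [isFace_iff, hF']
    have hle : s ⊆ edges n F := by simpa only [edges_chords] using edges_mono (n := n) hsub
    rw [← hF']
    exact chords_mono (h.le_of_ge hface hle)
  · refine fun h => ⟨isFace_iff.2 h.tripleFree, fun t ht hst => ?_⟩
    have := edges_mono (n := n) (h.le_of_ge (isFace_iff.1 ht) (chords_mono hst))
    simpa only [edges_chords] using this

theorem MaxTripleFree.maximal_edges (hE : MaxTripleFree n E) : Maximal IsFace (edges n E) := by
  rwa [maximal_isFace_iff, hE.chords_edges]

theorem IsFace.exists_maximal (hs : IsFace s) : ∃ t, s ⊆ t ∧ Maximal IsFace t := by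
  obtain ⟨F, hsub, hF⟩ := (isFace_iff.1 hs).exists_maxTripleFree
  exact ⟨edges n F, by simpa only [edges_chords] using edges_mono (n := n) hsub, hF.maximal_edges⟩

theorem chordCount_chords (hn : 1 ≤ n) (s : Set (RelevantEdge n 2)) :
    chordCount n (chords s) = 4 * n + 2 * s.ncard := by
  have := finite_relevantEdge n
  induction s, s.toFinite using Set.Finite.induction_on with
  | empty =>
    have hempty : chords (∅ : Set (RelevantEdge n 2)) = shortChords n := by simp [chords, lift]
    have := chordCount_shortChords (m := n) (by omega)
    rw [hempty, Set.ncard_empty]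
    omega
  | @insert e s he hs ih =>
    obtain ⟨e, hr⟩ := e
    obtain ⟨a, rfl⟩ := proj_surjective n e
    have hmem : (a.lo, a.hi) ∈ chords (insert ⟨proj n a, hr⟩ s) :=
      mem_chords_of_mem_lift_image ((mem_lift_image_of_isRelevant hr).2 (Set.mem_insert _ _))
    rw [chordCount_eq_diff_orbit_add_two (periodic_chords _) hmem, ← chords_sdiff_singleton hr,
      Set.insert_sdiff_self_of_notMem he, ih, Set.ncard_insert_of_notMem he hs]
    ring

theorem ncard_of_maximal (hn : 1 ≤ n) (hs : Maximal IsFace s) : s.ncard = 2 * (n - 1) := by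
  have := chordCount_eq (by omega) (maximal_isFace_iff.1 hs)
  rw [chordCount_chords hn] at this
  omega

theorem existsUnique_flip (hn : 1 ≤ n) (hs : Maximal IsFace s) {e : RelevantEdge n 2}
    (he : e ∈ s) : ∃! t, Maximal IsFace t ∧ s \ {e} ⊆ t ∧ t ≠ s := by
  obtain ⟨e, hr⟩ := e
  obtain ⟨a, rfl⟩ := proj_surjective n e
  have hbounds := isRelevant_proj.1 hr
  obtain ⟨G, ⟨hG, hsub, hne⟩, huniq⟩ := hasFlips (by omega) (maximal_isFace_iff.1 hs)
    (mem_chords_of_mem_lift_image ((mem_lift_image_of_isRelevant hr).2 he))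
    (by rw [mem_shortChords]; omega)
  rw [← chords_sdiff_singleton hr] at hsub huniq
  refine ⟨edges n G, ⟨hG.maximal_edges, ?_, fun h => hne ?_⟩, fun t ⟨ht, htsub, htne⟩ => ?_⟩
  · simpa only [edges_chords] using edges_mono (n := n) hsub
  · rw [← hG.chords_edges, h]
  · rw [← huniq (chords t) ⟨maximal_isFace_iff.1 ht, chords_mono htsub, fun h => htne ?_⟩,
      edges_chords]
    rw [← edges_chords t, h, edges_chords]

end Faces

section Triangulations

variable {n : ℕ} {s t : Set (RelevantEdge n 2)} {T T' : Set (Edge n)}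

/-- A longer edge crosses two of its translations. -/
theorem length_le_of_crossingFree (hn : 1 ≤ n) (hT : CrossingFree 3 (lift T)) {e : Edge n}
    (he : e ∈ T) : e.length ≤ 2 * n := by
  obtain ⟨a, rfl⟩ := proj_surjective n e
  by_contra! hlt
  have := length_proj (n := n) a
  have hmem : ∀ j : ℤ, a.shift (j * n) ∈ lift T := fun j => by
    rwa [lift, Set.mem_preimage, proj_shift]
  refine not_crossing_of_crossingFree_three hT (hmem 0) (hmem 1) (hmem 2) ?_
  simp only [CoverEdge.shift]
  omega

/-- The `2`-triangulation with set of relevant edges `s`, if `s` is a maximal face: all edges of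
length at most two, together with `s`. -/
def withShort (s : Set (RelevantEdge n 2)) : Set (Edge n) :=
  {e | e.length ≤ 2} ∪ Subtype.val '' s

theorem crossingFree_withShort : CrossingFree 3 (lift (withShort s)) ↔ IsFace s := by
  refine ⟨fun h => h.mono (Set.preimage_mono Set.subset_union_right), fun h => ?_⟩
  have hlong : ∀ {a}, a ∈ lift (withShort s) → a.lo + 3 ≤ a.hi → a ∈ lift (Subtype.val '' s) := by
    rintro a (ha | ha) hlt
    · have := length_proj (n := n) a
      simp only [Set.mem_ofPred_eq] at ha
      omega
    · exact ha
  exact crossingFree_three_of_forall_not fun e f g he hf hg hcross =>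
    not_crossing_of_crossingFree_three h (hlong he (by omega)) (hlong hf (by omega))
      (hlong hg (by omega)) hcross

theorem relevantPart_mono (h : T ⊆ T') : relevantPart 2 T ⊆ relevantPart 2 T' := fun _ he => h he

theorem relevantPart_withShort (s : Set (RelevantEdge n 2)) : relevantPart 2 (withShort s) = s := by
  ext e
  constructor
  · rintro (h | ⟨f, hf, h⟩)
    · exact absurd e.2.1 (not_lt.2 h)
    · rwa [← Subtype.ext h]
  · exact fun h => Or.inr ⟨e, h, rfl⟩

theorem withShort_mono (h : s ⊆ t) : withShort s ⊆ withShort t :=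
  Set.union_subset_union_right _ (Set.image_mono h)

theorem withShort_insert_sdiff (e f : RelevantEdge n 2) :
    withShort (insert f (s \ {e})) = insert f.1 (withShort s \ {e.1}) := by
  have h : e.1 ∉ {x : Edge n | x.length ≤ 2} := not_le.2 e.2.1
  simp only [withShort, Set.image_insert_eq, Set.image_sdiff Subtype.val_injective,
    Set.image_singleton, Set.union_insert, Set.union_sdiff_distrib, Set.sdiff_singleton_eq_self h]

theorem subset_withShort (hn : 1 ≤ n) (hT : CrossingFree 3 (lift T)) :
    T ⊆ withShort (relevantPart 2 T) := by
  intro e he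
  by_cases h : e.length ≤ 2
  · exact Or.inl h
  · exact Or.inr ⟨⟨e, not_le.1 h, length_le_of_crossingFree hn hT he⟩, he, rfl⟩

theorem isFace_relevantPart (hT : CrossingFree 3 (lift T)) : IsFace (relevantPart 2 T) :=
  hT.mono (Set.preimage_mono (by rintro _ ⟨e, he, rfl⟩; exact he))

namespace IsTriangulation

theorem withShort_relevantPart (hn : 1 ≤ n) (hT : IsTriangulation 2 T) :
    withShort (relevantPart 2 T) = T :=
  Set.Subset.antisymm (hT.le_of_ge (crossingFree_withShort.2 (isFace_relevantPart hT.prop))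
    (subset_withShort hn hT.prop)) (subset_withShort hn hT.prop)

theorem maximal_relevantPart (hn : 1 ≤ n) (hT : IsTriangulation 2 T) :
    Maximal IsFace (relevantPart 2 T) := by
  refine ⟨isFace_relevantPart hT.prop, fun t ht hsub => ?_⟩
  have hTt : T ⊆ withShort t := (subset_withShort hn hT.prop).trans (withShort_mono hsub)
  simpa only [relevantPart_withShort] using
    relevantPart_mono (hT.le_of_ge (crossingFree_withShort.2 ht) hTt)

end IsTriangulation

theorem isTriangulation_withShort (hn : 1 ≤ n) (hs : Maximal IsFace s) :
    IsTriangulation 2 (withShort s) := by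
  refine ⟨crossingFree_withShort.2 hs.prop, fun T hT hsub => ?_⟩
  have hsT : s ⊆ relevantPart 2 T := by
    simpa only [relevantPart_withShort] using relevantPart_mono hsub
  exact (subset_withShort hn hT).trans (withShort_mono (hs.le_of_ge (isFace_relevantPart hT) hsT))

theorem injOn_relevantPart (hn : 1 ≤ n) :
    Set.InjOn (relevantPart (n := n) 2) {T | IsTriangulation 2 T} :=
  Set.LeftInvOn.injOn (f₁' := withShort) fun _ hT =>
    IsTriangulation.withShort_relevantPart hn hT

end Triangulations

section Complex

variable {n : ℕ} {t : Finset (RelevantEdge n 2)}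

theorem isFacet_iff :
    (complex n 2).IsFacet t ↔ t.Nonempty ∧ Maximal IsFace (t : Set (RelevantEdge n 2)) := by
  have := finite_relevantEdge n
  constructor
  · intro h
    refine ⟨h.prop.1, h.prop.2, fun u hu htu => ?_⟩
    obtain ⟨u, rfl⟩ := u.toFinite.exists_finset_coe
    exact Finset.coe_subset.2 (h.le_of_ge ⟨h.prop.1.mono (Finset.coe_subset.1 htu), hu⟩
      (Finset.coe_subset.1 htu))
  · rintro ⟨hne, h⟩
    exact ⟨⟨hne, h.prop⟩, fun u hu htu => Finset.coe_subset.1 (h.le_of_ge hu.2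
      (Finset.coe_subset.2 htu))⟩

theorem isFacet_iff_exists (hn : 1 ≤ n) :
    (complex n 2).IsFacet t ↔ t.Nonempty ∧ ∃ T : Set (Edge n), IsTriangulation 2 T ∧
      relevantPart 2 T = (t : Set (RelevantEdge n 2)) := by
  rw [isFacet_iff]
  refine and_congr_right fun _ => ⟨fun h => ?_, ?_⟩
  · exact ⟨_, isTriangulation_withShort hn h, relevantPart_withShort _⟩
  · rintro ⟨T, hT, h⟩
    exact h ▸ hT.maximal_relevantPart hn

theorem isPure (hn : 1 ≤ n) : (complex n 2).IsPure (2 * (n - 1)) := by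
  have := finite_relevantEdge n
  refine ⟨fun t ht => ?_, fun t ht => ?_⟩
  · obtain ⟨u, htu, hu⟩ := IsFace.exists_maximal ht.2
    obtain ⟨u, rfl⟩ := u.toFinite.exists_finset_coe
    exact ⟨u, isFacet_iff.2 ⟨ht.1.mono (Finset.coe_subset.1 htu), hu⟩, Finset.coe_subset.1 htu⟩
  · rw [← Set.ncard_coe_finset, ncard_of_maximal hn (isFacet_iff.1 ht).2]

theorem exists_setOf_isFacet_eq_pair (hn : 1 ≤ n) {r u : Finset (RelevantEdge n 2)}
    (hr : r.Nonempty) (hu : (complex n 2).IsFacet u) {e : RelevantEdge n 2} (he : e ∈ u)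
    (hue : (u : Set (RelevantEdge n 2)) \ {e} = r) :
    ∃ w ≠ u, {t | (complex n 2).IsFacet t ∧ r ⊆ t} = {u, w} := by
  have := finite_relevantEdge n
  obtain ⟨w, ⟨hw, hsub, hne⟩, huniq⟩ := existsUnique_flip hn (isFacet_iff.1 hu).2 (e := e) he
  obtain ⟨w, rfl⟩ := w.toFinite.exists_finset_coe
  rw [hue] at hsub huniq
  refine ⟨w, fun h => hne (congrArg _ h), Set.ext fun t => ⟨fun ⟨ht, hrt⟩ => ?_, ?_⟩⟩
  · refine or_iff_not_imp_left.2 fun htu => Finset.coe_injective (huniq _ ⟨?_, ?_, ?_⟩)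
    · exact (isFacet_iff.1 ht).2
    · exact Finset.coe_subset.2 hrt
    · exact fun h => htu (Finset.coe_injective h)
  · rintro (rfl | rfl)
    · exact ⟨hu, Finset.coe_subset.1 (hue ▸ Set.sdiff_subset)⟩
    · have hrt := Finset.coe_subset.1 hsub
      exact ⟨isFacet_iff.2 ⟨hr.mono hrt, hw⟩, hrt⟩

theorem isWeakPseudomanifold (hn : 1 ≤ n) :
    (complex n 2).IsWeakPseudomanifold (2 * (n - 1)) := by
  classical
  refine ⟨isPure hn, fun r hr hcard => ?_⟩
  obtain ⟨u, hu, hru⟩ := (isPure hn).1 r hr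
  obtain ⟨e, he, hue⟩ : ∃ e ∈ u, u.erase e = r := by
    obtain ⟨e, he, rfl⟩ := Finset.exists_eq_insert_iff.2 ⟨hru, by rw [hcard, (isPure hn).2 u hu]⟩
    exact ⟨e, Finset.mem_insert_self _ _, Finset.erase_insert he⟩
  obtain ⟨w, hne, hpair⟩ := exists_setOf_isFacet_eq_pair hn hr.1 hu he
    (by rw [← hue, Finset.coe_erase])
  rw [hpair, Set.encard_pair hne.symm]

end Complex

section FlipGraph

theorem eq_insert_of_sdiff_subset {α : Type*} {s t : Set α} {e : α} (hs : s.Finite) (ht : t.Finite)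
    (he : e ∈ s) (hsub : s \ {e} ⊆ t) (hcard : t.ncard = s.ncard) (hne : t ≠ s) :
    ∃ f, f ∉ s ∧ t = insert f (s \ {e}) := by
  obtain ⟨f, hft, hfs⟩ : ∃ f ∈ t, f ∉ s :=
    Set.not_subset.1 fun h => hne (Set.eq_of_subset_of_ncard_le h hcard.ge hs)
  refine ⟨f, hfs, (Set.eq_of_subset_of_ncard_le (Set.insert_subset hft hsub) ?_ ht).symm⟩
  rw [Set.ncard_insert_of_notMem (fun h => hfs h.1) (hs.subset Set.sdiff_subset),
    Set.ncard_sdiff_singleton_add_one he hs, hcard]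

theorem eq_of_forall_sdiff_singleton_subset {α : Type*} {P : Set α → Prop} {s t : Set α} {e e' : α}
    (hs : Maximal P s) (ht : Maximal P t) (hee' : e ≠ e') (h : s \ {e} ⊆ t) (h' : s \ {e'} ⊆ t) :
    s = t := by
  refine hs.eq_of_subset ht.prop fun x hx => ?_
  by_cases hxe : x = e
  · exact h' ⟨hx, fun hxe' => hee' (hxe.symm.trans hxe')⟩
  · exact h ⟨hx, hxe⟩

variable {n : ℕ} {s : Set (RelevantEdge n 2)}

theorem ncard_flips (hn : 1 ≤ n) (hs : Maximal IsFace s) :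
    {t | Maximal IsFace t ∧ t ≠ s ∧ ∃ e ∈ s, s \ {e} ⊆ t}.ncard = 2 * (n - 1) := by
  choose! φ hφ huniq using fun e (he : e ∈ s) => existsUnique_flip hn hs he
  rw [← ncard_of_maximal hn hs]
  refine (Set.BijOn.ncard_eq (f := φ) ⟨fun e he => ?_, fun e he e' he' h => ?_, ?_⟩).symm
  · exact ⟨(hφ e he).1, (hφ e he).2.2, e, he, (hφ e he).2.1⟩
  · by_contra hee'
    exact (hφ e he).2.2 (eq_of_forall_sdiff_singleton_subset hs (hφ e he).1 hee' (hφ e he).2.1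
      (h ▸ (hφ e' he').2.1)).symm
  · rintro t ⟨ht, hne, e, he, hsub⟩
    exact ⟨e, he, (huniq e he t ⟨ht, hsub, hne⟩).symm⟩

theorem flipGraph_adj_iff (hn : 1 ≤ n) {T T' : {T : Set (Edge n) // IsTriangulation 2 T}} :
    (flipGraph n 2).Adj T T' ↔ relevantPart 2 T'.1 ≠ relevantPart 2 T.1 ∧
      ∃ e ∈ relevantPart 2 T.1, relevantPart 2 T.1 \ {e} ⊆ relevantPart 2 T'.1 := by
  obtain ⟨T, hT⟩ := T
  obtain ⟨T', hT'⟩ := T'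
  have := finite_relevantEdge n
  have hTs := hT.withShort_relevantPart hn
  have hTs' := hT'.withShort_relevantPart hn
  constructor
  · rintro ⟨e, f, he, hf, h⟩
    dsimp only at he hf h ⊢
    have hne : T' ≠ T := fun h' => hf (by rw [← h', h]; exact Set.mem_insert _ _)
    refine ⟨fun h => hne (injOn_relevantPart hn hT' hT h), ?_⟩
    have hsub : T \ {e} ⊆ T' := h ▸ Set.subset_insert _ _
    have hlong : ¬ e.length ≤ 2 := by
      intro hshort
      have heT' : e ∈ T' := hTs' ▸ Or.inl hshort
      exact hne (Maximal.eq_of_subset hT hT'.prop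
        ((Set.sdiff_singleton_subset_iff.1 hsub).trans (Set.insert_subset heT' subset_rfl))).symm
    exact ⟨⟨e, not_le.1 hlong, length_le_of_crossingFree hn hT.prop he⟩, he,
      fun x hx => hsub ⟨hx.1, fun h => hx.2 (Subtype.ext h)⟩⟩
  · rintro ⟨hne, e, he, hsub⟩
    dsimp only at hne he hsub
    obtain ⟨f, hf, h⟩ := eq_insert_of_sdiff_subset (Set.toFinite _) (Set.toFinite _) he hsub
      (by rw [ncard_of_maximal hn (hT.maximal_relevantPart hn),
        ncard_of_maximal hn (hT'.maximal_relevantPart hn)]) hne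
    refine ⟨e.1, f.1, he, hf, ?_⟩
    dsimp only
    rw [← hTs', h, withShort_insert_sdiff, hTs]

theorem ncard_neighborSet (hn : 1 ≤ n) (T : {T : Set (Edge n) // IsTriangulation 2 T}) :
    ((flipGraph n 2).neighborSet T).ncard = 2 * (n - 1) := by
  rw [← ncard_flips hn (T.2.maximal_relevantPart hn)]
  refine Set.BijOn.ncard_eq (f := fun T' => relevantPart 2 T'.1)
    ⟨fun T' hT' => ?_, fun T₁ _ T₂ _ h => ?_, fun t ⟨ht, hadj⟩ => ?_⟩
  · exact ⟨T'.2.maximal_relevantPart hn, (flipGraph_adj_iff hn).1 hT'⟩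
  · exact Subtype.ext (injOn_relevantPart hn T₁.2 T₂.2 h)
  · refine ⟨⟨withShort t, isTriangulation_withShort hn ht⟩, (flipGraph_adj_iff hn).2 ?_, ?_⟩
    · rwa [relevantPart_withShort]
    · exact relevantPart_withShort t

theorem exists_locallyFinite_isRegularOfDegree (hn : 1 ≤ n) :
    ∃ _ : (flipGraph n 2).LocallyFinite, (flipGraph n 2).IsRegularOfDegree (2 * (n - 1)) := by
  have := finite_relevantEdge n
  have : Finite {T : Set (Edge n) // IsTriangulation 2 T} :=
    Finite.of_injective _ (injOn_relevantPart hn).injective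
  let _ : (flipGraph n 2).LocallyFinite := fun T => Fintype.ofFinite _
  refine ⟨inferInstance, fun T => ?_⟩
  rw [← SimpleGraph.card_neighborSet_eq_degree, ← Nat.card_eq_fintype_card, Nat.card_coe_set_eq]
  exact ncard_neighborSet hn T

end FlipGraph

end HalfCylinder

/-- For every `n ≥ 1`, the flip graph of `2`-triangulations of the half-cylinder with `n` marked
points is regular, of degree `2 * (n - 1)`; and the associated simplicial complex, whose facets
correspond to the `2`-triangulations, is pure with `2 * (n - 1)` vertices in each facet, and is a weak
pseudomanifold. -/
theorem theorem1p1 (n : ℕ) (hn : 1 ≤ n) :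
    (∃ _ : (HalfCylinder.flipGraph n 2).LocallyFinite,
      (HalfCylinder.flipGraph n 2).IsRegularOfDegree (2 * (n - 1))) ∧
    (∀ s : Finset (HalfCylinder.RelevantEdge n 2),
      (HalfCylinder.complex n 2).IsFacet s ↔
        s.Nonempty ∧ ∃ T : Set (HalfCylinder.Edge n), HalfCylinder.IsTriangulation 2 T ∧
          HalfCylinder.relevantPart 2 T = (s : Set (HalfCylinder.RelevantEdge n 2))) ∧
    Set.InjOn (HalfCylinder.relevantPart (n := n) 2) {T | HalfCylinder.IsTriangulation 2 T} ∧
    (HalfCylinder.complex n 2).IsPure (2 * (n - 1)) ∧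
    (HalfCylinder.complex n 2).IsWeakPseudomanifold (2 * (n - 1)) :=
  ⟨HalfCylinder.exists_locallyFinite_isRegularOfDegree hn,
    fun _ => HalfCylinder.isFacet_iff_exists hn, HalfCylinder.injOn_relevantPart hn,
    HalfCylinder.isPure hn, HalfCylinder.isWeakPseudomanifold hn⟩
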